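/- Let $\mathcal L$ be the language of arithmetic with relation symbols $=,<$ and function symbols for the elementary recursive functions, and let $\mathsf{EA}$ be the theory in $\mathcal L$ whose axioms are the axioms for $=,<$, the defining equations of the function symbols, and complete induction for bounded formulas of $\mathcal L$. An $\mathsf{Acc}$-operator is a formula $\varphi(X,x)\equiv\forall y(\theta_0(x,y)\to t_0(x,y)\in X)$ with a bounded $\mathcal L$-formula $\theta_0$ and an $\mathcal L$-term $t_0$ whose variables are among $x,y$; for each such $\varphi$ a unary predicate constant $R_\varphi$ is added to $\mathcal L$. $Acc$ is the class of formulas $\sigma(x)\equiv\forall y(\theta_0(x,y)\to t_0(x,y)\in R)$, where $R$ is one of these constants, $\theta_0$ is a bounded $\mathcal L$-formula and $t_0$ a term, both possibly with further free variables. A formula of the extended language is positive if every $R_\varphi$ occurs only positively in it. $\Pi^0_0(\mathrm P)=\Sigma^0_0(\mathrm P)$ is the closure of the positive formulas under $\lnot,\lor,\land$ and bounded quantifiers, and for $k\ge 1$ the classes $\Pi^0_k(\mathrm P),\Sigma^0_k(\mathrm P)$ are the least classes such that $\Pi^0_{k-1}(\mathrm P)\cup\Sigma^0_{k-1}(\mathrm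 P)\subseteq\Pi^0_k(\mathrm P)\cap\Sigma^0_k(\mathrm P)$, both are closed under $\lor,\land$ and bounded quantifiers, $\lnot$ exchanges them, $\Pi^0_k(\mathrm P)$ is closed under $\forall$ and $\Sigma^0_k(\mathrm P)$ under $\exists$. The theory $(\Pi^0_k(\mathrm P),Acc)\text{-}\mathrm{ID}(\mathsf{Acc})$ is $\mathsf{EA}$ together with $\theta(0)\land\forall x(\theta(x)\to\theta(x+1))\to\forall y\,\theta(y)$ for $\theta\in\Pi^0_k(\mathrm P)$, and $\forall x[\varphi(R_\varphi,x)\to R_\varphi(x)]$ and $\forall u[R_\varphi(u)\to\forall x(\varphi(\sigma,x)\to\sigma(x))\to\sigma(u)]$ for $\varphi\in\mathsf{Acc}$, $\sigma\in Acc$. Let $\Omega=\omega_1$ be the first uncountable ordinal; for ordinals $\alpha$ and sets $X$ of ordinals let $\mathcal H_\alpha(X)$ be the least set such that $X\cup\{0,\Omega\}\subseteq\mathcal H_\alpha(X)$, $\omega^\beta\in\mathcal H_\alpha(X)$ if $\Omega<\beta\in\mathcal H_\alpha(X)$, $\beta+\gamma\in\mathcal H_\alpha(X)$ if $\beta,\gamma\in\mathcal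 H_\alpha(X)$, and $\psi\beta\in\mathcal H_\alpha(X)$ if $\beta\in\mathcal H_\alpha(X)$ and $\beta<\alpha$, where $\psi\alpha=\min\{\beta\le\Omega:\mathcal H_\alpha(\beta)\cap\Omega\subseteq\beta\}$ (recursion on $\alpha$). Ordinals in $\mathcal H_{\varepsilon_{\Omega+1}}(0)$ are denoted by terms in normal form built from $0,\Omega,+,\omega^{\beta},\psi$ (summands of a sum non-increasing, $\beta>\Omega$ in $\omega^\beta$, and $G\alpha<\alpha$ in $\psi\alpha$, where $G0=G\Omega=\emptyset$, $G(\psi\alpha)=\{\alpha\}\cup G\alpha$, $G\omega^\alpha=G\alpha$, $G(\beta+\gamma)=G\beta\cup G\gamma$), encoded by natural numbers in a standard way, and $\prec$ denotes the resulting elementary recursive ordering of codes (comparison of normal forms), given by a function symbol of $\mathcal L$ formalizing the recursive definition of the comparison. Let $W$ be the constant $R_\varphi$ for $\varphi(X,x)\equiv\forall y(y\prec x\to y\in X)$ (the accessible part of $\prec$), and let $\omega_0=1$ and $\omega_{n+1}=\omega^{\omega_n}$. Then for every $k\ge 0$ and each term $\alpha$ in normal form that denotes an ordinal smaller than $\psi(\Omega^{\omega_{1+k}})$,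 $(\Pi^0_k(\mathrm P),Acc)\text{-}\mathrm{ID}(\mathsf{Acc})\vdash\alpha\in W$, where $\alpha$ is written as the numeral of its code. -/

import Mathlib

namespace WeakID

/-! ## Elementary recursive functions -/

/-- Symbols for the elementary recursive functions: the closure of `0`, successor, predecessor,
`+`, truncated subtraction, `*`, `2 ^ x` and the projections under composition and limited
recursion (the third Grzegorczyk class). -/
inductive Elem : ℕ → Type
  | zero : Elem 0
  | succ : Elem 1
  | pred : Elem 1
  | add : Elem 2
  | sub : Elem 2
  | mul : Elem 2
  | exp : Elem 1
  | proj {n : ℕ} (i : Fin n) : Elem n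
  | comp {m n : ℕ} (f : Elem m) (g : Fin m → Elem n) : Elem n
  /-- Limited recursion, with the values cut off at the bound `b`: `f (0, x) = min (g x) (b (0, x))` and
  `f (y + 1, x) = min (h (y, f (y, x), x)) (b (y + 1, x))`. -/
  | brec {n : ℕ} (g : Elem n) (h : Elem (n + 2)) (b : Elem (n + 1)) : Elem (n + 1)

namespace Elem

/-- The function denoted by a symbol. -/
def eval : {n : ℕ} → Elem n → (Fin n → ℕ) → ℕ
  | _, zero, _ => 0
  | _, succ, v => v 0 + 1
  | _, pred, v => v 0 - 1
  | _, add, v => v 0 + v 1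
  | _, sub, v => v 0 - v 1
  | _, mul, v => v 0 * v 1
  | _, exp, v => 2 ^ v 0
  | _, proj i, v => v i
  | _, comp f g, v => f.eval (fun i => (g i).eval v)
  | _, brec g h b, v =>
      Nat.rec (min (g.eval (Matrix.vecTail v)) (b.eval (Matrix.vecCons 0 (Matrix.vecTail v))))
        (fun y r => min (h.eval (Matrix.vecCons y (Matrix.vecCons r (Matrix.vecTail v))))
          (b.eval (Matrix.vecCons (y + 1) (Matrix.vecTail v))))
        (v 0)

/-! The following functions of `n` arguments are built from functions `c`, `x`, `y` of `n`
arguments. -/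

def ap1 {n : ℕ} (f : Elem 1) (x : Elem n) : Elem n := comp f ![x]

def ap2 {n : ℕ} (f : Elem 2) (x y : Elem n) : Elem n := comp f ![x, y]

/-- The constant function `k`. -/
def num {n : ℕ} : ℕ → Elem n
  | 0 => comp zero ![]
  | k + 1 => ap1 succ (num k)

/-- `1` if `x` is positive, else `0`. -/
def pos {n : ℕ} (x : Elem n) : Elem n := ap2 sub (num 1) (ap2 sub (num 1) x)

/-- `x` if `c` is positive, else `y`. -/
def cond {n : ℕ} (c x y : Elem n) : Elem n :=
  ap2 add (ap2 mul (pos c) x) (ap2 mul (ap2 sub (num 1) c) y)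

/-- The characteristic function of `x < y`. -/
def ltC {n : ℕ} (x y : Elem n) : Elem n := ap2 sub (num 1) (ap2 sub (ap1 succ x) y)

/-- The characteristic function of `x = y`. -/
def eqC {n : ℕ} (x y : Elem n) : Elem n :=
  ap2 sub (num 1) (ap2 add (ap2 sub x y) (ap2 sub y x))

/-- Conjunction of characteristic functions. -/
def andC {n : ℕ} (x y : Elem n) : Elem n := pos (ap2 mul x y)

/-- Integer division `x / y`, for positive `y`. -/
def div : Elem 2 :=
  brec (num 0)
    (cond (ltC (ap1 succ (proj 0)) (ap2 mul (proj 2) (ap1 succ (proj 1))))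
      (proj 1) (ap1 succ (proj 1)))
    (proj 0)

/-- Integer square root. -/
def sqrt : Elem 1 :=
  brec (num 0)
    (cond (ltC (ap1 succ (proj 0)) (ap2 mul (ap1 succ (proj 1)) (ap1 succ (proj 1))))
      (proj 1) (ap1 succ (proj 1)))
    (proj 0)

/-- The pairing function `Nat.pair`. -/
def pair : Elem 2 :=
  cond (ltC (proj 0) (proj 1))
    (ap2 add (ap2 mul (proj 1) (proj 1)) (proj 0))
    (ap2 add (ap2 add (ap2 mul (proj 0) (proj 0)) (proj 0)) (proj 1))

/-- `x - (sqrt x) ^ 2`. -/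
def sqrtRem : Elem 1 := ap2 sub (proj 0) (ap2 mul sqrt sqrt)

/-- The first component of a pair. -/
def fst : Elem 1 := cond (ltC sqrtRem sqrt) sqrtRem sqrt

/-- The second component of a pair. -/
def snd : Elem 1 := cond (ltC sqrtRem sqrt) sqrt (ap2 sub sqrtRem sqrt)

/-- `4 ^ x`. -/
def exp4 : Elem 1 := ap1 exp (ap2 add (proj 0) (proj 0))

/-- The digit at position `i` of `t` in base `4`, as a function of `(t, i)`. -/
def digit : Elem 2 :=
  ap2 sub (ap2 div (proj 0) (ap1 exp4 (proj 1)))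
    (ap2 mul (num 4) (ap2 div (ap2 div (proj 0) (ap1 exp4 (proj 1))) (num 4)))

/-- The table `t (z, x) = ∑ i < z, c (i, t (i, x), x) * 4 ^ i`, where the values of `c` are
smaller than `4`. -/
def table {n : ℕ} (c : Elem (n + 2)) : Elem (n + 1) :=
  brec (num 0)
    (ap2 add (proj 1) (ap2 mul c (ap1 exp4 (proj 0))))
    (ap1 exp4 (proj 0))

/-- Course-of-values recursion `f (z, x) = c (z, t, x)`, where the digit of `t` at position `i`
is `f (i, x)` for all `i < z`. -/
def covRec {n : ℕ} (c : Elem (n + 2)) : Elem (n + 1) :=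
  comp c (Matrix.vecCons (proj 0) (Matrix.vecCons (table c) fun i => proj i.succ))

end Elem

/-! ## The notation system for the ordinals generated from `0`, `Ω`, `+`, `ω ^ β` and `ψ` -/

/-- Ordinal terms. A term is a finite sum of terms `ψ a`, `Ω` and `ω ^ a`. -/
inductive OT : Type
  | zero : OT
  /-- `ψ a + b` -/
  | psi (a b : OT) : OT
  /-- `Ω + b` -/
  | Om (b : OT) : OT
  /-- `ω ^ a + b` -/
  | pow (a b : OT) : OT

namespace OT

/-- The comparison of ordinal terms: summands `ψ a` lie below `Ω`, summands `ω ^ a` above `Ω`,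
summands of the same kind are compared by their arguments, and sums lexicographically. -/
def cmp : OT → OT → Ordering
  | zero, zero => .eq
  | zero, _ => .lt
  | _, zero => .gt
  | psi a b, psi c d => (cmp a c).then (cmp b d)
  | psi _ _, _ => .lt
  | Om _, psi _ _ => .gt
  | Om b, Om d => cmp b d
  | Om _, pow _ _ => .lt
  | pow a b, pow c d => (cmp a c).then (cmp b d)
  | pow _ _, _ => .gt

/-- `a < b` for ordinal terms. -/
def Lt (a b : OT) : Prop := cmp a b = .lt

/-- `G 0 = G Ω = ∅`, `G (ψ a) = {a} ∪ G a`, `G (ω ^ a) = G a`, `G (a + b) = G a ∪ G b`. -/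
def G : OT → Set OT
  | zero => ∅
  | psi a b => {a} ∪ G a ∪ G b
  | Om b => G b
  | pow a b => G a ∪ G b

/-- The first summand of a term, as a term. -/
def head : OT → OT
  | zero => zero
  | psi a _ => psi a zero
  | Om _ => Om zero
  | pow a _ => pow a zero

/-- Terms in normal form: the summands do not increase, `Ω < a` in every `ω ^ a`, and `G a < a`
in every `ψ a`. -/
def NF : OT → Prop
  | zero => True
  | psi a b => a.NF ∧ b.NF ∧ (∀ g ∈ G a, Lt g a) ∧ cmp b.head (psi a zero) ≠ .gt
  | Om b => b.NF ∧ cmp b.head (Om zero) ≠ .gt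
  | pow a b => a.NF ∧ b.NF ∧ Lt (Om zero) a ∧ cmp b.head (pow a zero) ≠ .gt

/-- The number that encodes a term. -/
def code : OT → ℕ
  | zero => 0
  | psi a b => Nat.pair (Nat.pair 0 a.code) b.code + 1
  | Om b => Nat.pair (Nat.pair 1 0) b.code + 1
  | pow a b => Nat.pair (Nat.pair 2 a.code) b.code + 1

end OT

/-- The hull `H_α(X)`, where `f` is `ψ` restricted to the ordinals below `α`. -/
inductive Hull (α : Ordinal.{0}) (f : (β : Ordinal.{0}) → β < α → Ordinal.{0})
    (X : Set Ordinal.{0}) : Ordinal.{0} → Prop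
  | base {β : Ordinal.{0}} : β ∈ X → Hull α f X β
  | zero : Hull α f X 0
  | Om : Hull α f X (Ordinal.omega 1)
  | pow {β : Ordinal.{0}} : Ordinal.omega 1 < β → Hull α f X β →
      Hull α f X (Ordinal.omega0 ^ β)
  | add {β γ : Ordinal.{0}} : Hull α f X β → Hull α f X γ → Hull α f X (β + γ)
  | psi {β : Ordinal.{0}} (h : β < α) : Hull α f X β → Hull α f X (f β h)

/-- Buchholz's collapsing function: `ψ α = min {β ≤ Ω : H_α(β) ∩ Ω ⊆ β}`, where `Ω` is the first
uncountable ordinal. The set is never empty, since `Ω` belongs to it. -/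
noncomputable def psi (α : Ordinal.{0}) : Ordinal.{0} :=
  sInf {β | β ≤ Ordinal.omega 1 ∧
    ∀ γ, Hull α (fun δ _ => psi δ) (Set.Iio β) γ → γ < Ordinal.omega 1 → γ < β}
termination_by α

/-- `ω_0 = 1` and `ω_{n+1} = ω ^ ω_n`. -/
noncomputable def omegaTower : ℕ → Ordinal.{0}
  | 0 => 1
  | n + 1 => Ordinal.omega0 ^ omegaTower n

/-- The ordinal denoted by a term. -/
noncomputable def OT.val : OT → Ordinal.{0}
  | .zero => 0
  | .psi a b => WeakID.psi a.val + b.val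
  | .Om b => Ordinal.omega 1 + b.val
  | .pow a b => Ordinal.omega0 ^ a.val + b.val

/-! ## The ordering of the notation system as an elementary recursive relation -/

namespace Elem

/-! The kind (`0` for `ψ a + b`, `1` for `Ω + b`, `2` for `ω ^ a + b`), the argument `a` and the
rest `b` of the encoded nonzero term `x`. -/

def kind {n : ℕ} (x : Elem n) : Elem n := ap1 fst (ap1 fst (ap1 pred x))

def arg {n : ℕ} (x : Elem n) : Elem n := ap1 snd (ap1 fst (ap1 pred x))

def rest {n : ℕ} (x : Elem n) : Elem n := ap1 snd (ap1 pred x)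

/-- The encoded term with kind `k`, argument `a` and rest `b`. -/
def node {n : ℕ} (k a b : Elem n) : Elem n := ap1 succ (ap2 pair (ap2 pair k a) b)

/-- One step of the comparison of the components `x`, `y` of the first argument: `0` for `<`,
`1` for `=`, `2` for `>`. The second argument is the table of the earlier values. -/
def cmpStep : Elem 2 :=
  let x : Elem 2 := ap1 fst (proj 0)
  let y : Elem 2 := ap1 snd (proj 0)
  let old (u v : Elem 2) : Elem 2 := ap2 digit (proj 1) (ap2 pair u v)
  cond x
    (cond y
      (cond (ltC (kind x) (kind y)) (num 0)
        (cond (ltC (kind y) (kind x)) (num 2)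
          (cond (eqC (old (arg x) (arg y)) (num 1))
            (old (rest x) (rest y))
            (old (arg x) (arg y)))))
      (num 2))
    (cond y (num 0) (num 1))

/-- Comparison of encoded terms. -/
def cmp : Elem 2 := ap1 (covRec cmpStep) pair

/-- The characteristic function of the relation that the encoded term `x` is smaller than `y`,
irrespective of normal forms. -/
def smaller {n : ℕ} (x y : Elem n) : Elem n := eqC (ap2 cmp x y) (num 0)

/-- One step of `gLt`, for the arguments `x`, the table of the earlier values, and `a`. -/
def gLtStep : Elem 3 :=
  let x : Elem 3 := proj 0
  let old (u : Elem 3) : Elem 3 := ap2 digit (proj 1) u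
  cond x
    (andC (old (rest x))
      (cond (eqC (kind x) (num 0))
        (andC (smaller (arg x) (proj 2)) (old (arg x)))
        (cond (eqC (kind x) (num 2)) (old (arg x)) (num 1))))
    (num 1)

/-- The characteristic function of the relation `G x < a`, for encoded terms `x` and `a`. -/
def gLt : Elem 2 := covRec gLtStep

/-- One step of `nf`, for the arguments `x` and the table of the earlier values. -/
def nfStep : Elem 2 :=
  let x : Elem 2 := proj 0
  let old (u : Elem 2) : Elem 2 := ap2 digit (proj 1) u
  let y : Elem 2 := rest x
  let decreasing : Elem 2 :=
    cond y
      (ltC (ap2 cmp (node (kind y) (arg y) (num 0)) (node (kind x) (arg x) (num 0))) (num 2))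
      (num 1)
  let argument : Elem 2 :=
    cond (eqC (kind x) (num 0)) (andC (old (arg x)) (ap2 gLt (arg x) (arg x)))
      (cond (eqC (kind x) (num 1)) (eqC (arg x) (num 0))
        (cond (eqC (kind x) (num 2))
          (andC (old (arg x)) (smaller (node (num 1) (num 0) (num 0)) (arg x)))
          (num 0)))
  cond x (andC (old y) (andC decreasing argument)) (num 1)

/-- The characteristic function of the set of the codes of terms in normal form. -/
def nf : Elem 1 := covRec nfStep

/-- The characteristic function of the ordering of (the codes of) the terms in normal form. -/
def less : Elem 2 :=
  andC (andC (ap1 nf (proj 0)) (ap1 nf (proj 1))) (smaller (proj 0) (proj 1))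

end Elem

/-! ## First-order formulas -/

/-- Terms with the de Bruijn variables `var 0, var 1, …`. -/
inductive Tm : Type
  | var (i : ℕ) : Tm
  | fn {n : ℕ} (f : Elem n) (v : Fin n → Tm) : Tm

namespace Tm

def subst (τ : ℕ → Tm) : Tm → Tm
  | var i => τ i
  | fn f v => fn f fun i => (v i).subst τ

/-- Renaming of the variables that makes room for a new variable `var 0`. -/
def lift (t : Tm) : Tm := t.subst fun i => var (i + 1)

/-- All variables of the term are among `var 0, …, var (n - 1)`. -/
def VarsBelow (n : ℕ) : Tm → Prop
  | var i => i < n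
  | fn _ v => ∀ i, (v i).VarsBelow n

def zero : Tm := fn .zero ![]

def succ (t : Tm) : Tm := fn .succ ![t]

def numeral : ℕ → Tm
  | 0 => zero
  | n + 1 => succ (numeral n)

end Tm

/-- The substitution `0 ↦ t`, `i + 1 ↦ τ i`. -/
def scons (t : Tm) (τ : ℕ → Tm) : ℕ → Tm
  | 0 => t
  | i + 1 => τ i

/-- Formulas with the relation symbols `=`, `<` and a unary predicate constant for every element
of `ι`. In `all A` the variable `var 0` of `A` is bound. The other connectives of classical logic
are abbreviations. -/
inductive Fm (ι : Type) : Type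
  | eq (s t : Tm) : Fm ι
  | lt (s t : Tm) : Fm ι
  | mem (R : ι) (t : Tm) : Fm ι
  | bot : Fm ι
  | imp (A B : Fm ι) : Fm ι
  | all (A : Fm ι) : Fm ι

namespace Fm

variable {ι : Type}

def neg (A : Fm ι) : Fm ι := A.imp bot

def and (A B : Fm ι) : Fm ι := (A.imp B.neg).neg

def or (A B : Fm ι) : Fm ι := A.neg.imp B

def iff (A B : Fm ι) : Fm ι := (A.imp B).and (B.imp A)

/-- The bounded quantifier `∀ x < t`, where `x` does not occur in `t`. The bounded quantifier
`∃ x < t` is `¬ ∀ x < t ¬`. -/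
def ball (t : Tm) (A : Fm ι) : Fm ι := all (imp (lt (.var 0) t.lift) A)

/-- Capture-avoiding substitution. -/
def subst (τ : ℕ → Tm) : Fm ι → Fm ι
  | eq s t => eq (s.subst τ) (t.subst τ)
  | lt s t => lt (s.subst τ) (t.subst τ)
  | mem R t => mem R (t.subst τ)
  | bot => bot
  | imp A B => imp (A.subst τ) (B.subst τ)
  | all A => all (A.subst (scons (.var 0) fun i => (τ i).lift))

/-- Renaming of the variables that makes room for a new variable `var 0`. -/
def lift (A : Fm ι) : Fm ι := A.subst fun i => .var (i + 1)

/-- Substitution of `t` for `var 0`, which removes this variable. -/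
def inst (A : Fm ι) (t : Tm) : Fm ι := A.subst (scons t .var)

/-- All free variables of the formula are among `var 0, …, var (n - 1)`. -/
def VarsBelow : ℕ → Fm ι → Prop
  | n, eq s t => s.VarsBelow n ∧ t.VarsBelow n
  | n, lt s t => s.VarsBelow n ∧ t.VarsBelow n
  | n, mem _ t => t.VarsBelow n
  | _, bot => True
  | n, imp A B => A.VarsBelow n ∧ B.VarsBelow n
  | n, all A => A.VarsBelow (n + 1)

/-- Formulas without predicate constants as formulas of a larger language. -/
def ofArith : Fm Empty → Fm ι
  | eq s t => eq s t
  | lt s t => lt s t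
  | mem R _ => R.elim
  | bot => bot
  | imp A B => imp A.ofArith B.ofArith
  | all A => all A.ofArith

end Fm

/-- Derivability of a formula from the (universally closed) axioms `T` and the hypotheses in the
list, in a natural deduction calculus for classical first-order logic with equality. -/
inductive Derives {ι : Type} (T : Set (Fm ι)) : List (Fm ι) → Fm ι → Prop
  | ax {Γ : List (Fm ι)} {A : Fm ι} : A ∈ T → Derives T Γ A
  | hyp {Γ : List (Fm ι)} {A : Fm ι} : A ∈ Γ → Derives T Γ A
  | impI {Γ : List (Fm ι)} {A B : Fm ι} : Derives T (A :: Γ) B → Derives T Γ (A.imp B)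
  | impE {Γ : List (Fm ι)} {A B : Fm ι} : Derives T Γ (A.imp B) → Derives T Γ A →
      Derives T Γ B
  | raa {Γ : List (Fm ι)} {A : Fm ι} : Derives T (A.neg :: Γ) .bot → Derives T Γ A
  | allI {Γ : List (Fm ι)} {A : Fm ι} : Derives T (Γ.map Fm.lift) A →
      Derives T Γ A.all
  | allE {Γ : List (Fm ι)} {A : Fm ι} (t : Tm) : Derives T Γ A.all →
      Derives T Γ (A.inst t)
  | eqI {Γ : List (Fm ι)} (t : Tm) : Derives T Γ (.eq t t)
  | eqE {Γ : List (Fm ι)} {A : Fm ι} {s t : Tm} : Derives T Γ (.eq s t) →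
      Derives T Γ (A.inst s) → Derives T Γ (A.inst t)

/-! ## Classes of formulas -/

/-- Bounded arithmetical formulas: no predicate constants, and bounded quantifiers only. -/
inductive Delta0 {ι : Type} : Fm ι → Prop
  | eq (s t : Tm) : Delta0 (.eq s t)
  | lt (s t : Tm) : Delta0 (.lt s t)
  | bot : Delta0 .bot
  | imp {A B : Fm ι} : Delta0 A → Delta0 B → Delta0 (A.imp B)
  | ball (t : Tm) {A : Fm ι} : Delta0 A → Delta0 (.ball t A)

/-- `Polarity true A`: predicate constants occur only positively in `A`.
`Polarity false A`: predicate constants occur only negatively in `A`. -/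
def Polarity {ι : Type} : Bool → Fm ι → Prop
  | _, .eq _ _ => True
  | _, .lt _ _ => True
  | p, .mem _ _ => p = true
  | _, .bot => True
  | p, .imp A B => Polarity (!p) A ∧ Polarity p B
  | p, .all A => Polarity p A

/-- The classes `Π⁰ₖ(P)` (`Hier true k`) and `Σ⁰ₖ(P)` (`Hier false k`). As `A → B` stands for
`¬ A ∨ B`, the clause `imp` amounts to the closure of the classes under `∨` and `∧` together with
the exchange of the two classes by `¬`. For `k = 0` both are the class of the formulas obtained
from positive formulas by propositional connectives and bounded quantifiers. -/
inductive Hier {ι : Type} : Bool → ℕ → Fm ι → Prop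
  | positive {p : Bool} {A : Fm ι} : Polarity true A → Hier p 0 A
  | mono {p q : Bool} {k : ℕ} {A : Fm ι} : Hier p k A → Hier q (k + 1) A
  | imp {p : Bool} {k : ℕ} {A B : Fm ι} : Hier (!p) k A → Hier p k B → Hier p k (A.imp B)
  | ball {p : Bool} {k : ℕ} (t : Tm) {A : Fm ι} : Hier p k A → Hier p k (.ball t A)
  | all {k : ℕ} {A : Fm ι} : Hier true (k + 1) A → Hier true (k + 1) A.all
  | ex {k : ℕ} {A : Fm ι} : Hier false (k + 1) A → Hier false (k + 1) A.neg.all.neg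

/-! ## The theories -/

/-- An operator form `φ(X, x) = ∀ y (θ(x, y) → t(x, y) ∈ X)` with a bounded arithmetical formula
`θ` and a term `t`. Here `y` is `var 0` and `x` is `var 1`. -/
structure AccOp where
  guard : Fm Empty
  term : Tm
  guard_bounded : Delta0 guard
  guard_vars : guard.VarsBelow 2
  term_vars : term.VarsBelow 2

/-- The formula `∀ y (θ(x, y) → S(t(x, y)))`, where `x` is the variable `var 0`. -/
def AccOp.app (φ : AccOp) (S : Tm → Fm AccOp) : Fm AccOp :=
  .all (φ.guard.ofArith.imp (S φ.term))

/-- The class of the formulas `σ(x) = ∀ y (θ(x, y) → t(x, y) ∈ R)` with a bounded arithmetical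
formula `θ` and a term `t`, both possibly with parameters, and a predicate constant `R`. -/
inductive AccFm : Fm AccOp → Prop
  | mk (θ : Fm AccOp) (t : Tm) (R : AccOp) : Delta0 θ → AccFm (.all (θ.imp (.mem R t)))

/-- Complete induction `θ(0) ∧ ∀ x (θ(x) → θ(x + 1)) → ∀ y θ(y)`. The induction variable of `θ`
is `var 0`, the other variables are parameters. -/
def indAx {ι : Type} (θ : Fm ι) : Fm ι :=
  ((θ.inst .zero).and
    (Fm.all (θ.imp (θ.subst (scons (Tm.succ (.var 0)) fun i => .var (i + 1)))))).imp θ.all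

open Tm in
/-- The axioms of elementary recursive arithmetic, apart from those of logic with equality. -/
inductive EA {ι : Type} : Fm ι → Prop
  | succ_ne_zero (t : Tm) : EA (Fm.neg (.eq (succ t) zero))
  | succ_inj (s t : Tm) : EA ((Fm.eq (succ s) (succ t)).imp (.eq s t))
  | not_lt_zero (t : Tm) : EA (Fm.neg (.lt t zero))
  | lt_succ (s t : Tm) : EA ((Fm.lt s (succ t)).iff ((Fm.lt s t).or (.eq s t)))
  | pred_zero : EA (.eq (fn .pred ![zero]) zero)
  | pred_succ (t : Tm) : EA (.eq (fn .pred ![succ t]) t)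
  | add_zero (s : Tm) : EA (.eq (fn .add ![s, zero]) s)
  | add_succ (s t : Tm) : EA (.eq (fn .add ![s, succ t]) (succ (fn .add ![s, t])))
  | sub_zero (s : Tm) : EA (.eq (fn .sub ![s, zero]) s)
  | sub_succ (s t : Tm) : EA (.eq (fn .sub ![s, succ t]) (fn .pred ![fn .sub ![s, t]]))
  | mul_zero (s : Tm) : EA (.eq (fn .mul ![s, zero]) zero)
  | mul_succ (s t : Tm) : EA (.eq (fn .mul ![s, succ t]) (fn .add ![fn .mul ![s, t], s]))
  | exp_zero : EA (.eq (fn .exp ![zero]) (succ zero))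
  | exp_succ (t : Tm) : EA (.eq (fn .exp ![succ t]) (fn .add ![fn .exp ![t], fn .exp ![t]]))
  | proj {n : ℕ} (i : Fin n) (v : Fin n → Tm) : EA (.eq (fn (.proj i) v) (v i))
  | comp {m n : ℕ} (f : Elem m) (g : Fin m → Elem n) (v : Fin n → Tm) :
      EA (.eq (fn (.comp f g) v) (fn f fun i => fn (g i) v))
  /-- The minimum of `r` and `s` is written `r - (r - s)`. -/
  | brec_zero {n : ℕ} (g : Elem n) (h : Elem (n + 2)) (b : Elem (n + 1)) (v : Fin n → Tm)
      (r s : Tm) : r = fn g v → s = fn b (Matrix.vecCons zero v) →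
      EA (.eq (fn (.brec g h b) (Matrix.vecCons zero v)) (fn .sub ![r, fn .sub ![r, s]]))
  | brec_succ {n : ℕ} (g : Elem n) (h : Elem (n + 2)) (b : Elem (n + 1)) (v : Fin n → Tm)
      (t r s : Tm) :
      r = fn h (Matrix.vecCons t (Matrix.vecCons (fn (.brec g h b) (Matrix.vecCons t v)) v)) →
      s = fn b (Matrix.vecCons (succ t) v) →
      EA (.eq (fn (.brec g h b) (Matrix.vecCons (succ t) v)) (fn .sub ![r, fn .sub ![r, s]]))
  | ind (θ : Fm ι) : Delta0 θ → EA (indAx θ)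

/-- The axioms of the theory `(Θ, Γ)-ID(Acc)`: it extends elementary recursive arithmetic by
complete induction for the formulas in `Θ`, the axioms
`∀ x (φ(R_φ, x) → R_φ(x))` for all operator forms `φ`, and the axioms
`∀ u (R_φ(u) → ∀ x (φ(σ, x) → σ(x)) → σ(u))` for all operator forms `φ` and all `σ` in `Γ`.
The predicate constant `R_φ` is `φ` itself. The variable `x` of `σ(x)` is `var 0`, the other
variables are parameters. -/
inductive IDAxiom (Θ Γ : Set (Fm AccOp)) : Fm AccOp → Prop
  | arith {A : Fm AccOp} : EA A → IDAxiom Θ Γ A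
  | ind {θ : Fm AccOp} : θ ∈ Θ → IDAxiom Θ Γ (indAx θ)
  | closed (φ : AccOp) : IDAxiom Θ Γ (.all ((φ.app fun t => .mem φ t).imp (.mem φ (.var 0))))
  | least (φ : AccOp) {σ : Fm AccOp} : σ ∈ Γ → IDAxiom Θ Γ
      (.all ((Fm.mem φ (.var 0)).imp
        ((Fm.all ((φ.app fun t => σ.subst (scons t fun i => .var (i + 3))).imp
          (σ.subst (scons (.var 0) fun i => .var (i + 2))))).imp σ)))

/-- Provability in `(Π⁰ₖ(P), Acc)-ID(Acc)`. -/
def PiAccIDProves (k : ℕ) (A : Fm AccOp) : Prop :=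
  Derives {B | IDAxiom {θ | Hier true k θ} {σ | AccFm σ} B} [] A

/-- The operator form `∀ y (y < x → y ∈ X)` for the ordering `<` of the notation system. The
predicate constant `R_φ` of this `φ` is `W`. -/
def accW : AccOp where
  guard := .eq (.fn .less ![.var 0, .var 1]) (Tm.succ .zero)
  term := .var 0
  guard_bounded := .eq _ _
  guard_vars := by
    refine ⟨fun i => ?_, fun i => by simp [Tm.zero, Tm.VarsBelow]⟩
    fin_cases i <;> simp [Tm.VarsBelow]
  term_vars := by simp [Tm.VarsBelow]

/-- The sentence `α ∈ W`, for the code of the term `α`. -/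
def inW (α : OT) : Fm AccOp := .mem accW (.numeral α.code)

end WeakID

namespace WeakID

/-! ## Substitution -/

/-- The substitution `τ` under a binder. -/
def up (τ : ℕ → Tm) : ℕ → Tm := scons (.var 0) fun i => (τ i).lift

namespace Tm

theorem subst_subst (t : Tm) (τ σ : ℕ → Tm) :
    (t.subst τ).subst σ = t.subst fun i => (τ i).subst σ := by
  induction t with
  | var i => rfl
  | fn f v ih => simp [subst, ih]

theorem subst_var (t : Tm) : t.subst .var = t := by
  induction t with
  | var i => rfl
  | fn f v ih => simp [subst, ih]

theorem VarsBelow.mono {t : Tm} {m n : ℕ} (h : t.VarsBelow m) (hmn : m ≤ n) : t.VarsBelow n := by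
  induction t with
  | var i => exact lt_of_lt_of_le h hmn
  | fn f v ih => exact fun i => ih i (h i)

theorem exists_varsBelow (t : Tm) : ∃ n, t.VarsBelow n := by
  induction t with
  | var i => exact ⟨i + 1, Nat.lt_succ_self i⟩
  | fn f v ih =>
    choose b hb using ih
    exact ⟨Finset.univ.sup b, fun i => (hb i).mono (Finset.le_sup (Finset.mem_univ i))⟩

theorem subst_congr {t : Tm} {n : ℕ} (h : t.VarsBelow n) {τ σ : ℕ → Tm}
    (hτ : ∀ i < n, τ i = σ i) : t.subst τ = t.subst σ := by
  induction t with
  | var i => exact hτ i h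
  | fn f v ih => simp only [subst, fun i => ih i (h i)]

end Tm

theorem up_subst (τ σ : ℕ → Tm) :
    (fun i => (up τ i).subst (up σ)) = up fun i => (τ i).subst σ := by
  funext i
  cases i with
  | zero => rfl
  | succ i => simp [up, scons, Tm.lift, Tm.subst_subst, Tm.subst]

theorem up_var : up .var = .var := by
  funext i
  cases i <;> rfl

namespace Fm

variable {ι : Type}

theorem subst_all (A : Fm ι) (τ : ℕ → Tm) : (all A).subst τ = all (A.subst (up τ)) := rfl

theorem subst_subst (A : Fm ι) (τ σ : ℕ → Tm) :
    (A.subst τ).subst σ = A.subst fun i => (τ i).subst σ := by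
  induction A generalizing τ σ with
  | eq s t => simp [subst, Tm.subst_subst]
  | lt s t => simp [subst, Tm.subst_subst]
  | mem R t => simp [subst, Tm.subst_subst]
  | bot => rfl
  | imp A B ihA ihB => simp [subst, ihA, ihB]
  | all A ih => rw [subst_all, subst_all, ih, up_subst, subst_all]

theorem subst_var (A : Fm ι) : A.subst .var = A := by
  induction A with
  | eq s t => simp [subst, Tm.subst_var]
  | lt s t => simp [subst, Tm.subst_var]
  | mem R t => simp [subst, Tm.subst_var]
  | bot => rfl
  | imp A B ihA ihB => simp [subst, ihA, ihB]
  | all A ih => rw [subst_all, up_var, ih]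

theorem inst_subst (A : Fm ι) (t : Tm) (τ : ℕ → Tm) :
    (A.inst t).subst τ = A.subst (scons (t.subst τ) τ) := by
  rw [inst, subst_subst]
  congr 1
  funext i
  cases i <;> rfl

theorem subst_up_inst (A : Fm ι) (t : Tm) (τ : ℕ → Tm) :
    (A.subst (up τ)).inst t = A.subst (scons t τ) := by
  rw [inst, subst_subst]
  congr 1
  funext i
  cases i with
  | zero => rfl
  | succ i =>
    simp only [up, scons, Tm.lift, Tm.subst_subst]
    exact Tm.subst_var _

theorem lift_subst (A : Fm ι) (τ : ℕ → Tm) : A.lift.subst (up τ) = (A.subst τ).lift := by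
  rw [lift, lift, subst_subst, subst_subst]
  rfl

theorem VarsBelow.mono {A : Fm ι} {m n : ℕ} (h : A.VarsBelow m) (hmn : m ≤ n) :
    A.VarsBelow n := by
  induction A generalizing m n with
  | eq s t => exact ⟨h.1.mono hmn, h.2.mono hmn⟩
  | lt s t => exact ⟨h.1.mono hmn, h.2.mono hmn⟩
  | mem R t => exact Tm.VarsBelow.mono h hmn
  | bot => trivial
  | imp A B ihA ihB => exact ⟨ihA h.1 hmn, ihB h.2 hmn⟩
  | all A ih => exact ih (m := m + 1) h (Nat.succ_le_succ hmn)

theorem exists_varsBelow (A : Fm ι) : ∃ n, A.VarsBelow n := by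
  induction A with
  | eq s t =>
    obtain ⟨m, hm⟩ := s.exists_varsBelow
    obtain ⟨n, hn⟩ := t.exists_varsBelow
    exact ⟨max m n, hm.mono (le_max_left _ _), hn.mono (le_max_right _ _)⟩
  | lt s t =>
    obtain ⟨m, hm⟩ := s.exists_varsBelow
    obtain ⟨n, hn⟩ := t.exists_varsBelow
    exact ⟨max m n, hm.mono (le_max_left _ _), hn.mono (le_max_right _ _)⟩
  | mem R t => exact t.exists_varsBelow
  | bot => exact ⟨0, trivial⟩
  | imp A B ihA ihB =>
    obtain ⟨m, hm⟩ := ihA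
    obtain ⟨n, hn⟩ := ihB
    exact ⟨max m n, hm.mono (le_max_left _ _), hn.mono (le_max_right _ _)⟩
  | all A ih =>
    obtain ⟨n, hn⟩ := ih
    exact ⟨n, VarsBelow.mono (n := n + 1) hn (Nat.le_succ n)⟩

theorem subst_congr {A : Fm ι} {n : ℕ} (h : A.VarsBelow n) {τ σ : ℕ → Tm}
    (hτ : ∀ i < n, τ i = σ i) : A.subst τ = A.subst σ := by
  induction A generalizing n τ σ with
  | eq s t => simp only [subst, Tm.subst_congr h.1 hτ, Tm.subst_congr h.2 hτ]
  | lt s t => simp only [subst, Tm.subst_congr h.1 hτ, Tm.subst_congr h.2 hτ]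
  | mem R t => simp only [subst, Tm.subst_congr h hτ]
  | bot => rfl
  | imp A B ihA ihB => simp only [subst, ihA h.1 hτ, ihB h.2 hτ]
  | all A ih =>
    rw [subst_all, subst_all, ih (n := n + 1) h]
    intro i hi
    cases i with
    | zero => rfl
    | succ i => simp [up, scons, hτ i (Nat.lt_of_succ_lt_succ hi)]

end Fm

/-! ## The calculus -/

namespace Derives

variable {ι : Type} {T : Set (Fm ι)}

theorem weaken {Γ Δ : List (Fm ι)} {A : Fm ι} (h : Derives T Γ A) (hΓ : Γ ⊆ Δ) :
    Derives T Δ A := by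
  induction h generalizing Δ with
  | ax h => exact ax h
  | hyp h => exact hyp (hΓ h)
  | impI _ ih => exact impI (ih (List.cons_subset_cons _ hΓ))
  | impE _ _ ih₁ ih₂ => exact impE (ih₁ hΓ) (ih₂ hΓ)
  | raa _ ih => exact raa (ih (List.cons_subset_cons _ hΓ))
  | allI _ ih => exact allI (ih (List.map_subset _ hΓ))
  | allE t _ ih => exact allE t (ih hΓ)
  | eqI t => exact eqI t
  | eqE _ _ ih₁ ih₂ => exact eqE (ih₁ hΓ) (ih₂ hΓ)

theorem subst (hT : ∀ A ∈ T, ∀ τ, A.subst τ ∈ T) {Γ : List (Fm ι)} {A : Fm ι}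
    (h : Derives T Γ A) (τ : ℕ → Tm) : Derives T (Γ.map (Fm.subst τ)) (A.subst τ) := by
  induction h generalizing τ with
  | ax h => exact ax (hT _ h τ)
  | hyp h => exact hyp (List.mem_map_of_mem h)
  | impI _ ih => exact impI (ih τ)
  | impE _ _ ih₁ ih₂ => exact impE (ih₁ τ) (ih₂ τ)
  | raa _ ih => exact raa (ih τ)
  | allI _ ih =>
    have h := ih (up τ)
    rw [List.map_map] at h
    refine allI (A := Fm.subst (up τ) _) ?_
    rw [List.map_map]
    convert h using 2
    funext A
    exact (Fm.lift_subst A τ).symm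
  | allE t _ ih =>
    have := allE (A := Fm.subst (up τ) _) (t.subst τ) (ih τ)
    rw [Fm.subst_up_inst] at this
    rwa [Fm.inst_subst]
  | eqI t => exact eqI _
  | eqE _ _ ih₁ ih₂ =>
    have h₁ := ih₁ τ
    have h₂ := ih₂ τ
    rw [Fm.inst_subst, ← Fm.subst_up_inst] at h₂ ⊢
    exact eqE h₁ h₂

theorem negE {Γ : List (Fm ι)} {A : Fm ι} (h : Derives T Γ A.neg) (h' : Derives T Γ A) :
    Derives T Γ .bot :=
  impE h h'

theorem efq {Γ : List (Fm ι)} {A : Fm ι} (h : Derives T Γ .bot) : Derives T Γ A :=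
  raa (h.weaken (List.subset_cons_self _ _))

theorem generalize (hT : ∀ A ∈ T, ∀ τ, A.subst τ ∈ T) {Γ : List (Fm ι)} {A : Fm ι} {y : ℕ}
    (hΓ : ∀ B ∈ Γ, B.VarsBelow y) (hA : A.all.VarsBelow y)
    (h : Derives T Γ (A.inst (.var y))) : Derives T Γ A.all := by
  refine allI ?_
  let τ : ℕ → Tm := fun i => if i = y then .var 0 else .var (i + 1)
  have := h.subst hT τ
  have e : (A.inst (.var y)).subst τ = A := by
    rw [Fm.inst_subst]
    conv_rhs => rw [← Fm.subst_var A]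
    refine Fm.subst_congr (n := y + 1) hA fun i hi => ?_
    cases i with
    | zero => simp [scons, Tm.subst, τ]
    | succ i =>
      have : i ≠ y := by omega
      simp [scons, τ, this]
  have e' : Γ.map (Fm.subst τ) = Γ.map Fm.lift := by
    refine List.map_congr_left fun B hB => Fm.subst_congr (hΓ B hB) fun i hi => ?_
    simp [τ, hi.ne]
  rwa [e, e'] at this

theorem eq_symm {Γ : List (Fm ι)} {s t : Tm} (h : Derives T Γ (.eq s t)) :
    Derives T Γ (.eq t s) := by
  have := eqE (A := .eq (.var 0) s.lift) (t := t) h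
  simp only [Fm.inst, Fm.subst, Tm.lift, Tm.subst_subst, Tm.subst, scons] at this
  rw [Tm.subst_var] at this
  exact this (eqI s)

theorem eq_trans {Γ : List (Fm ι)} {s t u : Tm} (h : Derives T Γ (.eq s t))
    (h' : Derives T Γ (.eq t u)) : Derives T Γ (.eq s u) := by
  have := eqE (A := .eq s.lift (.var 0)) (t := u) h'
  simp only [Fm.inst, Fm.subst, Tm.lift, Tm.subst_subst, Tm.subst, scons] at this
  rw [Tm.subst_var] at this
  exact this h

theorem lt_congr {Γ : List (Fm ι)} {s t s' t' : Tm} (h : Derives T Γ (.eq s s'))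
    (h' : Derives T Γ (.eq t t')) (hl : Derives T Γ (.lt s t)) : Derives T Γ (.lt s' t') := by
  have h₁ := eqE (A := .lt (.var 0) t.lift) (t := s') h
  have h₂ := eqE (A := .lt s'.lift (.var 0)) (t := t') h'
  simp only [Fm.inst, Fm.subst, Tm.lift, Tm.subst_subst, Tm.subst, scons] at h₁ h₂
  rw [Tm.subst_var] at h₁ h₂
  exact h₂ (h₁ hl)

theorem mem_congr {Γ : List (Fm ι)} {R : ι} {s s' : Tm} (h : Derives T Γ (.eq s s'))
    (hl : Derives T Γ (.mem R s)) : Derives T Γ (.mem R s') :=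
  eqE (A := .mem R (.var 0)) h hl

theorem fn_congr {Γ : List (Fm ι)} {n : ℕ} (f : Elem n) {v w : Fin n → Tm}
    (h : ∀ i, Derives T Γ (.eq (v i) (w i))) : Derives T Γ (.eq (.fn f v) (.fn f w)) := by
  have key : ∀ k ≤ n, Derives T Γ (.eq (.fn f v) (.fn f fun i => if i < k then w i else v i)) := by
    intro k
    induction k with
    | zero => exact fun _ => by simpa using eqI _
    | succ k ih =>
      intro hk
      have := eqE (A := .eq (Tm.fn f v).lift (.fn f fun i =>
        if i < k then (w i).lift else if i = ⟨k, hk⟩ then .var 0 else (v i).lift)) (h ⟨k, hk⟩)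
      simp only [Fm.inst, Fm.subst, Tm.lift, Tm.subst_subst, scons, Tm.subst] at this
      simp only [← Tm.lift.eq_1] at this
      have hl : ∀ (t u : Tm), t.lift.subst (scons u .var) = t := fun t u => by
        rw [Tm.lift, Tm.subst_subst]; exact Tm.subst_var t
      simp only [Tm.subst_var, apply_ite (Tm.subst (scons _ Tm.var)), hl, Tm.subst, scons] at this
      convert this ?_ using 3
      · funext i
        rcases lt_trichotomy (i : ℕ) k with hi | hi | hi
        · simp [hi, hi.trans (Nat.lt_succ_self k)]
        · have : i = ⟨k, hk⟩ := Fin.ext hi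
          subst this
          simp
        · have h1 : ¬ (i : ℕ) < k := by omega
          have h2 : ¬ (i : ℕ) < k + 1 := by omega
          have h3 : i ≠ ⟨k, hk⟩ := fun e => by simp [e] at hi
          simp [h1, h2, h3]
      · convert ih (by omega) using 3
        funext i
        by_cases hi : i = ⟨k, hk⟩
        · subst hi; simp
        · simp [hi]
  simpa using key n le_rfl

end Derives

/-! ## Structures -/

/-- A structure for the language. -/
class Str (ι : outParam Type) (M : Type) where
  fn {n : ℕ} : Elem n → (Fin n → M) → M
  lt : M → M → Prop
  mem : ι → M → Prop

/-- Assignments. -/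
abbrev Env (M : Type) := ℕ → M

/-- The assignment `0 ↦ x`, `i + 1 ↦ ρ i`. -/
def Env.cons {M : Type} (x : M) (ρ : Env M) : Env M
  | 0 => x
  | i + 1 => ρ i

section Semantics

variable {ι M : Type} [Str ι M]

/-- The value of a term. -/
def Tm.eval (ρ : Env M) : Tm → M
  | var i => ρ i
  | fn f v => Str.fn f fun i => (v i).eval ρ

/-- Truth of a formula. -/
def Fm.sat (ρ : Env M) : Fm ι → Prop
  | eq s t => s.eval ρ = t.eval ρ
  | lt s t => Str.lt (s.eval ρ) (t.eval ρ)
  | mem R t => Str.mem R (t.eval ρ)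
  | bot => False
  | imp A B => A.sat ρ → B.sat ρ
  | all A => ∀ x, A.sat (Env.cons x ρ)

theorem Tm.eval_subst (t : Tm) (τ : ℕ → Tm) (ρ : Env M) :
    (t.subst τ).eval ρ = t.eval fun i => (τ i).eval ρ := by
  induction t with
  | var i => rfl
  | fn f v ih => simp [subst, eval, ih]

theorem Tm.eval_lift (t : Tm) (x : M) (ρ : Env M) :
    t.lift.eval (Env.cons x ρ) = t.eval ρ := by
  rw [lift, eval_subst]
  rfl

theorem Fm.sat_subst (A : Fm ι) (τ : ℕ → Tm) (ρ : Env M) :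
    (A.subst τ).sat ρ ↔ A.sat fun i => (τ i).eval ρ := by
  induction A generalizing τ ρ with
  | eq s t => simp [subst, sat, Tm.eval_subst]
  | lt s t => simp [subst, sat, Tm.eval_subst]
  | mem R t => simp [subst, sat, Tm.eval_subst]
  | bot => rfl
  | imp A B ihA ihB => simp [subst, sat, ihA, ihB]
  | all A ih =>
    rw [subst_all]
    simp only [sat, ih]
    refine forall_congr' fun x => iff_of_eq (congrArg (A.sat ·) ?_)
    funext i
    cases i with
    | zero => rfl
    | succ i => exact Tm.eval_lift _ _ _

end Semantics

/-! ## Completeness -/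

section Completeness

variable {ι : Type} {T : Set (Fm ι)}

theorem exists_henkin_step (hT : ∀ A ∈ T, ∀ τ, A.subst τ ∈ T) {Γ : List (Fm ι)}
    (hΓ : ¬ Derives T Γ .bot) (F : Fm ι) :
    ∃ Δ, Γ ⊆ Δ ∧ ¬ Derives T Δ .bot ∧ (F ∈ Δ ∨ F.neg ∈ Δ) ∧
      ∀ B, F = .all B → F.neg ∈ Δ → ∃ t, (B.inst t).neg ∈ Δ := by
  by_cases hF : Derives T (F :: Γ) .bot
  · have hF' : ¬ Derives T (F.neg :: Γ) .bot := fun h =>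
      hΓ (.impE (.impI hF) (.raa h))
    by_cases hB : ∃ B, F = .all B
    · obtain ⟨B, rfl⟩ := hB
      have : ∃ y, ∀ A ∈ (Fm.all B).neg :: Γ, A.VarsBelow y := by
        choose b hb using fun A : Fm ι => A.exists_varsBelow
        refine ⟨(((Fm.all B).neg :: Γ).map b).foldr max 0, fun A hA => (hb A).mono ?_⟩
        exact List.le_max_of_le (List.mem_map_of_mem hA) le_rfl
      obtain ⟨y, hy⟩ := this
      refine ⟨(B.inst (.var y)).neg :: (Fm.all B).neg :: Γ, ?_, fun h => ?_, ?_, ?_⟩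
      · exact List.Subset.trans (List.subset_cons_self _ _) (List.subset_cons_self _ _)
      · have h₁ := (Derives.raa h).generalize hT hy (hy (Fm.all B).neg (by simp)).1
        exact hF' (.negE (.hyp (by simp)) h₁)
      · simp
      · rintro B' h -
        cases h
        exact ⟨.var y, by simp⟩
    · exact ⟨F.neg :: Γ, List.subset_cons_self _ _, hF', by simp, fun B h => (hB ⟨B, h⟩).elim⟩
  · refine ⟨F :: Γ, List.subset_cons_self _ _, hF, by simp, fun B _ h => (hF ?_).elim⟩
    exact .negE (.hyp h) (.hyp (by simp))

/-- A maximal consistent set with witnesses. -/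
structure IsHenkin (T S : Set (Fm ι)) : Prop where
  closed : ∀ Γ A, (∀ B ∈ Γ, B ∈ S) → Derives T Γ A → A ∈ S
  bot : .bot ∉ S
  neg : ∀ A, A ∈ S ∨ A.neg ∈ S
  ex : ∀ B, (Fm.all B).neg ∈ S → ∃ t, (B.inst t).neg ∈ S

theorem exists_isHenkin [Countable (Fm ι)] (hT : ∀ A ∈ T, ∀ τ, A.subst τ ∈ T) {A : Fm ι}
    (hA : ¬ Derives T [] A) : ∃ S, IsHenkin T S ∧ A.neg ∈ S := by
  have : Nonempty (Fm ι) := ⟨.bot⟩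
  obtain ⟨F, hF⟩ := exists_surjective_nat (Fm ι)
  let C := {Γ : List (Fm ι) // ¬ Derives T Γ .bot}
  choose next h₁ h₂ h₃ h₄ using fun (Γ : C) (F : Fm ι) => exists_henkin_step hT Γ.2 F
  let Γ : ℕ → C := fun n =>
    Nat.rec ⟨[A.neg], fun h => hA (.raa h)⟩ (fun n Γ => ⟨next Γ (F n), h₂ Γ (F n)⟩) n
  have hmono : ∀ m n, m ≤ n → (Γ m).1 ⊆ (Γ n).1 := fun m n hmn => by
    induction hmn with
    | refl => exact fun _ h => h
    | step _ ih => exact List.Subset.trans ih (h₁ _ _)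
  let S : Set (Fm ι) := {B | ∃ n, B ∈ (Γ n).1}
  have hfin : ∀ Δ : List (Fm ι), (∀ B ∈ Δ, B ∈ S) → ∃ n, Δ ⊆ (Γ n).1 := by
    intro Δ
    induction Δ with
    | nil => exact fun _ => ⟨0, by simp⟩
    | cons B Δ ih =>
      intro h
      obtain ⟨m, hm⟩ := h B (by simp)
      obtain ⟨n, hn⟩ := ih fun B hB => h B (by simp [hB])
      refine ⟨max m n, List.cons_subset.2 ⟨hmono _ _ (le_max_left _ _) hm, ?_⟩⟩
      exact List.Subset.trans hn (hmono _ _ (le_max_right _ _))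
  have hneg : ∀ B, B ∈ S ∨ B.neg ∈ S := fun B => by
    obtain ⟨n, rfl⟩ := hF B
    exact (h₃ (Γ n) (F n)).imp (fun h => ⟨n + 1, h⟩) fun h => ⟨n + 1, h⟩
  have hcon : ∀ Δ : List (Fm ι), (∀ B ∈ Δ, B ∈ S) → ¬ Derives T Δ .bot := fun Δ hΔ h => by
    obtain ⟨n, hn⟩ := hfin Δ hΔ
    exact (Γ n).2 (h.weaken hn)
  refine ⟨S, ⟨fun Δ B hΔ h => ?_, fun h => ?_, hneg, fun B hB => ?_⟩, 0, by simp [Γ]⟩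
  · refine (hneg B).resolve_right fun hB => hcon (B.neg :: Δ) ?_ ?_
    · exact List.forall_mem_cons.2 ⟨hB, hΔ⟩
    · exact .negE (.hyp (by simp)) (h.weaken (List.subset_cons_self _ _))
  · exact hcon [.bot] (by simpa using h) (.hyp (by simp))
  · obtain ⟨n, hn⟩ := hF (.all B)
    have : (F n).neg ∈ next (Γ n) (F n) := by
      refine (h₃ (Γ n) (F n)).resolve_left fun h => ?_
      rw [hn] at h
      refine hcon [.all B, (Fm.all B).neg] ?_
        (.negE (.hyp (by simp)) (.hyp List.mem_cons_self))
      simp only [List.mem_cons, List.not_mem_nil, or_false, forall_eq_or_imp, forall_eq]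
      exact ⟨⟨n + 1, by simpa [Γ, hn] using h⟩, hB⟩
    obtain ⟨t, ht⟩ := h₄ (Γ n) (F n) B hn this
    exact ⟨t, n + 1, ht⟩

namespace IsHenkin

variable {S : Set (Fm ι)}

/-- Provable equality of terms. -/
def setoid (hS : IsHenkin T S) : Setoid Tm where
  r s t := .eq s t ∈ S
  iseqv := by
    refine ⟨fun t => hS.closed [] _ (by simp) (.eqI t), fun {s t} h => ?_, fun {s t u} h h' => ?_⟩
    · exact hS.closed [.eq s t] _ (by simpa using h) (Derives.eq_symm (.hyp (by simp)))
    · exact hS.closed [.eq s t, .eq t u] _ (by simpa using ⟨h, h'⟩)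
        (Derives.eq_trans (.hyp List.mem_cons_self) (.hyp (by simp)))

/-- The term model. -/
@[reducible] noncomputable def str (hS : IsHenkin T S) : Str ι (Quotient hS.setoid) where
  fn f v := ⟦.fn f fun i => (v i).out⟧
  lt a b := .lt a.out b.out ∈ S
  mem R a := .mem R a.out ∈ S

theorem out_eq (hS : IsHenkin T S) (t : Tm) :
    .eq (Quotient.out (Quotient.mk hS.setoid t)) t ∈ S :=
  Quotient.exact (s := hS.setoid) (Quotient.out_eq _)

theorem eval_eq (hS : IsHenkin T S) (t : Tm) (τ : ℕ → Tm) :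
    letI := hS.str
    t.eval (fun i => Quotient.mk hS.setoid (τ i)) = Quotient.mk hS.setoid (t.subst τ) := by
  let := hS.str
  induction t with
  | var i => rfl
  | fn f v ih =>
    simp only [Tm.eval, ih, Tm.subst]
    refine Quotient.sound (s := hS.setoid) ?_
    have h : ∀ i, Fm.eq (Quotient.out (Quotient.mk hS.setoid ((v i).subst τ))) ((v i).subst τ) ∈ S :=
      fun i => hS.out_eq _
    refine hS.closed (List.ofFn fun i => .eq (Quotient.out (Quotient.mk hS.setoid ((v i).subst τ)))
      ((v i).subst τ)) _ (fun B hB => ?_) (.fn_congr f fun i => .hyp ?_)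
    · obtain ⟨i, rfl⟩ := (List.mem_ofFn' _ _).1 hB
      exact h i
    · exact (List.mem_ofFn' _ _).2 ⟨i, rfl⟩

theorem lt_congr (hS : IsHenkin T S) {s s' t t' : Tm} (h : .eq s s' ∈ S) (h' : .eq t t' ∈ S)
    (hl : .lt s t ∈ S) : .lt s' t' ∈ S :=
  hS.closed [.lt s t, .eq s s', .eq t t'] _ (by simpa using ⟨hl, h, h'⟩)
    (Derives.lt_congr (s := s) (t := t) (.hyp (by simp)) (.hyp (by simp)) (.hyp (by simp)))

theorem mem_congr (hS : IsHenkin T S) {R : ι} {s s' : Tm} (h : .eq s s' ∈ S)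
    (hl : .mem R s ∈ S) : .mem R s' ∈ S :=
  hS.closed [.mem R s, .eq s s'] _ (by simpa using ⟨hl, h⟩)
    (Derives.mem_congr (s := s) (.hyp (by simp)) (.hyp (by simp)))

theorem imp_mem (hS : IsHenkin T S) {A B : Fm ι} : A.imp B ∈ S ↔ (A ∈ S → B ∈ S) := by
  refine ⟨fun h hA => ?_, fun h => ?_⟩
  · exact hS.closed [A.imp B, A] _ (by simpa using ⟨h, hA⟩)
      (.impE (.hyp List.mem_cons_self) (.hyp (by simp)))
  · rcases hS.neg A with hA | hA
    · exact hS.closed [B] _ (by simpa using h hA) (.impI (.hyp (by simp)))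
    · exact hS.closed [A.neg] _ (by simpa using hA)
        (.impI (.efq (.negE (.hyp (by simp)) (.hyp List.mem_cons_self))))

theorem all_mem (hS : IsHenkin T S) {A : Fm ι} : A.all ∈ S ↔ ∀ t, A.inst t ∈ S := by
  refine ⟨fun h t => hS.closed [A.all] _ (by simpa using h) (.allE t (.hyp (by simp))), fun h => ?_⟩
  refine (hS.neg _).resolve_right fun hA => ?_
  obtain ⟨t, ht⟩ := hS.ex A hA
  exact hS.bot (hS.imp_mem.1 ht (h t))

theorem sat_iff (hS : IsHenkin T S) (A : Fm ι) (τ : ℕ → Tm) :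
    letI := hS.str
    A.sat (fun i => Quotient.mk hS.setoid (τ i)) ↔ A.subst τ ∈ S := by
  let := hS.str
  have hs : ∀ t, Fm.eq t (Quotient.out (Quotient.mk hS.setoid t)) ∈ S :=
    fun t => hS.setoid.iseqv.symm (hS.out_eq t)
  induction A generalizing τ with
  | eq s t =>
    simp only [Fm.sat, eval_eq, Fm.subst]
    exact Quotient.eq (r := hS.setoid)
  | lt s t =>
    simp only [Fm.sat, eval_eq, Fm.subst]
    constructor <;> intro h
    · exact hS.lt_congr (hS.out_eq _) (hS.out_eq _) h
    · exact hS.lt_congr (hs _) (hs _) h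
  | mem R t =>
    simp only [Fm.sat, eval_eq, Fm.subst]
    constructor <;> intro h
    · exact hS.mem_congr (hS.out_eq _) h
    · exact hS.mem_congr (hs _) h
  | bot => exact iff_of_false (fun h => h) hS.bot
  | imp A B ihA ihB => simp only [Fm.sat, Fm.subst, ihA, ihB, hS.imp_mem]
  | all A ih =>
    rw [Fm.subst_all, hS.all_mem]
    simp only [Fm.subst_up_inst, ← ih, Fm.sat]
    have hc : ∀ t, Env.cons (Quotient.mk hS.setoid t) (fun i => Quotient.mk hS.setoid (τ i)) =
        fun i => Quotient.mk hS.setoid (scons t τ i) := fun t => by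
      funext i
      cases i <;> rfl
    refine ⟨fun h t => hc t ▸ h _, fun h x => ?_⟩
    obtain ⟨t, rfl⟩ := Quotient.exists_rep x
    exact hc t ▸ h t

end IsHenkin

/-- Gödel's completeness theorem for theories that are closed under substitution. -/
theorem completeness [Countable (Fm ι)] (hT : ∀ A ∈ T, ∀ τ, A.subst τ ∈ T) {A : Fm ι}
    (h : ∀ (M : Type) [Str ι M], (∀ B ∈ T, ∀ ρ : Env M, B.sat ρ) → ∀ ρ : Env M, A.sat ρ) :
    Derives T [] A := by
  by_contra hA
  obtain ⟨S, hS, hAS⟩ := exists_isHenkin hT hA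
  let := hS.str
  have := h (Quotient hS.setoid) (fun B hB ρ => ?_) fun i => Quotient.mk hS.setoid (.var i)
  · rw [hS.sat_iff, Fm.subst_var] at this
    exact hS.bot (hS.imp_mem.1 hAS this)
  · have hρ : ρ = fun i => Quotient.mk hS.setoid ((ρ i).out) :=
      funext fun i => (Quotient.out_eq _).symm
    rw [hρ, hS.sat_iff]
    exact hS.closed [] _ (by simp) (.ax (hT B hB _))

end Completeness

/-! ## Countability of the language -/

/-- An injective code of function symbols. -/
def Elem.toNat : {n : ℕ} → Elem n → ℕ
  | _, zero => Nat.pair 0 0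
  | _, succ => Nat.pair 1 0
  | _, pred => Nat.pair 2 0
  | _, add => Nat.pair 3 0
  | _, sub => Nat.pair 4 0
  | _, mul => Nat.pair 5 0
  | _, exp => Nat.pair 6 0
  | _, proj i => Nat.pair 7 i
  | _, comp (m := m) f g =>
    Nat.pair 8 (Nat.pair m (Nat.pair f.toNat (Encodable.encode (List.ofFn fun i => (g i).toNat))))
  | _, brec g h b => Nat.pair 9 (Nat.pair g.toNat (Nat.pair h.toNat b.toNat))

theorem Elem.toNat_injective {n : ℕ} : Function.Injective (Elem.toNat (n := n)) := by
  intro e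
  induction e with
  | comp f g ihf ihg =>
    intro e h
    cases e <;> simp only [toNat, Nat.pair_eq_pair] at h <;> try omega
    obtain ⟨-, rfl, h₁, h₂⟩ := h
    rw [Encodable.encode_inj] at h₂
    have h₂ := List.ofFn_injective h₂
    rw [ihf h₁]
    congr
    funext i
    exact ihg i (congrFun h₂ i)
  | brec g h b ihg ihh ihb =>
    intro e h
    cases e <;> simp only [toNat, Nat.pair_eq_pair] at h <;> try omega
    rw [ihg h.2.1, ihh h.2.2.1, ihb h.2.2.2]
  | proj i =>
    intro e h
    cases e <;> simp only [toNat, Nat.pair_eq_pair] at h <;> try omega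
    rw [Fin.ext h.2]
  | _ =>
    intro e h
    cases e <;> simp only [toNat, Nat.pair_eq_pair] at h <;> first | rfl | omega

/-- An injective code of terms. -/
def Tm.toNat : Tm → ℕ
  | var i => Nat.pair 0 i
  | fn (n := n) f v =>
    Nat.pair 1 (Nat.pair n (Nat.pair f.toNat (Encodable.encode (List.ofFn fun i => (v i).toNat))))

theorem Tm.toNat_injective : Function.Injective Tm.toNat := by
  intro t
  induction t with
  | var i =>
    intro t h
    cases t <;> simp only [toNat, Nat.pair_eq_pair] at h <;> try omega
    rw [h.2]
  | fn f v ih =>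
    intro t h
    cases t <;> simp only [toNat, Nat.pair_eq_pair] at h <;> try omega
    obtain ⟨-, rfl, h₁, h₂⟩ := h
    rw [Encodable.encode_inj] at h₂
    have h₂ := List.ofFn_injective h₂
    rw [Elem.toNat_injective h₁]
    congr
    funext i
    exact ih i (congrFun h₂ i)

instance : Countable Tm := Tm.toNat_injective.countable

/-- An injective code of formulas, from a code of the predicate constants. -/
def Fm.toNat {ι : Type} (r : ι → ℕ) : Fm ι → ℕ
  | eq s t => Nat.pair 0 (Nat.pair s.toNat t.toNat)
  | lt s t => Nat.pair 1 (Nat.pair s.toNat t.toNat)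
  | mem R t => Nat.pair 2 (Nat.pair (r R) t.toNat)
  | bot => Nat.pair 3 0
  | imp A B => Nat.pair 4 (Nat.pair (A.toNat r) (B.toNat r))
  | all A => Nat.pair 5 (A.toNat r)

theorem Fm.toNat_injective {ι : Type} {r : ι → ℕ} (hr : Function.Injective r) :
    Function.Injective (Fm.toNat r) := by
  intro A
  induction A with
  | imp A B ihA ihB =>
    intro C h
    cases C <;> simp only [toNat, Nat.pair_eq_pair] at h <;> try omega
    rw [ihA h.2.1, ihB h.2.2]
  | all A ih =>
    intro C h
    cases C <;> simp only [toNat, Nat.pair_eq_pair] at h <;> try omega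
    rw [ih h.2]
  | mem R t =>
    intro C h
    cases C <;> simp only [toNat, Nat.pair_eq_pair] at h <;> try omega
    rw [hr h.2.1, Tm.toNat_injective h.2.2]
  | bot =>
    intro C h
    cases C <;> simp only [toNat, Nat.pair_eq_pair] at h <;> first | rfl | omega
  | _ =>
    intro C h
    cases C <;> simp only [toNat, Nat.pair_eq_pair] at h <;> try omega
    rw [Tm.toNat_injective h.2.1, Tm.toNat_injective h.2.2]

instance {ι : Type} [Countable ι] : Countable (Fm ι) := by
  obtain ⟨r, hr⟩ := Countable.exists_injective_nat ι
  exact (Fm.toNat_injective hr).countable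

instance : Countable AccOp :=
  Function.Injective.countable (f := fun φ : AccOp => (φ.guard, φ.term)) fun φ ψ h => by
    cases φ
    cases ψ
    simpa using h

/-! ## The axioms are closed under substitution -/

section Closure

variable {ι : Type}

theorem Fm.subst_imp (A B : Fm ι) (τ : ℕ → Tm) :
    (A.imp B).subst τ = (A.subst τ).imp (B.subst τ) := rfl

theorem Delta0.subst {A : Fm ι} (h : Delta0 A) (τ : ℕ → Tm) : Delta0 (A.subst τ) := by
  induction h generalizing τ with
  | eq s t => exact .eq _ _
  | lt s t => exact .lt _ _
  | bot => exact .bot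
  | imp _ _ ihA ihB => exact .imp (ihA τ) (ihB τ)
  | ball t _ ih =>
    have := Delta0.ball (t.subst τ) (ih (up τ))
    rw [Fm.ball, Tm.lift, Tm.subst_subst] at this
    rw [Fm.ball, Fm.subst_all, Fm.subst, Fm.subst, Tm.lift, Tm.subst_subst]
    exact this

theorem Polarity.subst {p : Bool} {A : Fm ι} (h : Polarity p A) (τ : ℕ → Tm) :
    Polarity p (A.subst τ) := by
  induction A generalizing p τ with
  | imp A B ihA ihB => exact ⟨ihA h.1 τ, ihB h.2 τ⟩
  | all A ih => exact ih h _
  | _ => exact h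

theorem Hier.subst {p : Bool} {k : ℕ} {A : Fm ι} (h : Hier p k A) (τ : ℕ → Tm) :
    Hier p k (A.subst τ) := by
  induction h generalizing τ with
  | positive h => exact .positive (h.subst τ)
  | mono _ ih => exact .mono (ih τ)
  | imp _ _ ihA ihB => exact .imp (ihA τ) (ihB τ)
  | ball t _ ih =>
    have := Hier.ball (t.subst τ) (ih (up τ))
    rw [Fm.ball, Tm.lift, Tm.subst_subst] at this
    rw [Fm.ball, Fm.subst_all, Fm.subst, Fm.subst, Tm.lift, Tm.subst_subst]
    exact this
  | all _ ih => exact .all (ih _)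
  | ex _ ih => exact .ex (ih _)

theorem vec_subst {n : ℕ} (v : Fin n → Tm) (t : Tm) (τ : ℕ → Tm) :
    (fun i => Tm.subst τ (Matrix.vecCons t v i)) =
      Matrix.vecCons (t.subst τ) fun i => (v i).subst τ := by
  funext i
  refine Fin.cases rfl (fun i => rfl) i

theorem vec_subst_nil (v : Fin 0 → Tm) (τ : ℕ → Tm) : (fun i => Tm.subst τ (v i)) = ![] :=
  Subsingleton.elim _ _

theorem indAx_subst (θ : Fm ι) (τ : ℕ → Tm) : (indAx θ).subst τ = indAx (θ.subst (up τ)) := by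
  have h₁ : (θ.inst .zero).subst τ = (θ.subst (up τ)).inst .zero := by
    rw [Fm.inst_subst, Fm.subst_up_inst]
    simp only [Tm.zero, Tm.subst, vec_subst_nil]
  have h₂ : (θ.subst (scons (Tm.succ (.var 0)) fun i => .var (i + 1))).subst (up τ) =
      (θ.subst (up τ)).subst (scons (Tm.succ (.var 0)) fun i => .var (i + 1)) := by
    rw [Fm.subst_subst, Fm.subst_subst]
    congr 1
    funext i
    cases i with
    | zero => simp only [scons, Tm.succ, Tm.subst, up, vec_subst, vec_subst_nil]
    | succ i => simp [scons, Tm.subst, up, Tm.lift, Tm.subst_subst]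
  rw [indAx, indAx, ← h₁, ← h₂]
  rfl

set_option linter.unusedSimpArgs false in
theorem EA.subst {A : Fm ι} (h : EA A) (τ : ℕ → Tm) : EA (A.subst τ) := by
  cases h with
  | ind θ h => rw [indAx_subst]; exact .ind _ (h.subst _)
  | succ_ne_zero t =>
    have := EA.succ_ne_zero (ι := ι) (t.subst τ)
    simp only [Fm.subst, Fm.neg, Fm.or, Fm.iff, Fm.and, Tm.succ, Tm.zero, Tm.subst, vec_subst,
      vec_subst_nil] at this ⊢
    exact this
  | succ_inj s t =>
    have := EA.succ_inj (ι := ι) (s.subst τ) (t.subst τ)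
    simp only [Fm.subst, Fm.neg, Fm.or, Fm.iff, Fm.and, Tm.succ, Tm.zero, Tm.subst, vec_subst,
      vec_subst_nil] at this ⊢
    exact this
  | not_lt_zero t =>
    have := EA.not_lt_zero (ι := ι) (t.subst τ)
    simp only [Fm.subst, Fm.neg, Fm.or, Fm.iff, Fm.and, Tm.succ, Tm.zero, Tm.subst, vec_subst,
      vec_subst_nil] at this ⊢
    exact this
  | lt_succ s t =>
    have := EA.lt_succ (ι := ι) (s.subst τ) (t.subst τ)
    simp only [Fm.subst, Fm.neg, Fm.or, Fm.iff, Fm.and, Tm.succ, Tm.zero, Tm.subst, vec_subst,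
      vec_subst_nil] at this ⊢
    exact this
  | pred_zero =>
    have := EA.pred_zero (ι := ι)
    simp only [Fm.subst, Fm.neg, Fm.or, Fm.iff, Fm.and, Tm.succ, Tm.zero, Tm.subst, vec_subst,
      vec_subst_nil] at this ⊢
    exact this
  | pred_succ t =>
    have := EA.pred_succ (ι := ι) (t.subst τ)
    simp only [Fm.subst, Fm.neg, Fm.or, Fm.iff, Fm.and, Tm.succ, Tm.zero, Tm.subst, vec_subst,
      vec_subst_nil] at this ⊢
    exact this
  | add_zero s =>
    have := EA.add_zero (ι := ι) (s.subst τ)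
    simp only [Fm.subst, Fm.neg, Fm.or, Fm.iff, Fm.and, Tm.succ, Tm.zero, Tm.subst, vec_subst,
      vec_subst_nil] at this ⊢
    exact this
  | add_succ s t =>
    have := EA.add_succ (ι := ι) (s.subst τ) (t.subst τ)
    simp only [Fm.subst, Fm.neg, Fm.or, Fm.iff, Fm.and, Tm.succ, Tm.zero, Tm.subst, vec_subst,
      vec_subst_nil] at this ⊢
    exact this
  | sub_zero s =>
    have := EA.sub_zero (ι := ι) (s.subst τ)
    simp only [Fm.subst, Fm.neg, Fm.or, Fm.iff, Fm.and, Tm.succ, Tm.zero, Tm.subst, vec_subst,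
      vec_subst_nil] at this ⊢
    exact this
  | sub_succ s t =>
    have := EA.sub_succ (ι := ι) (s.subst τ) (t.subst τ)
    simp only [Fm.subst, Fm.neg, Fm.or, Fm.iff, Fm.and, Tm.succ, Tm.zero, Tm.subst, vec_subst,
      vec_subst_nil] at this ⊢
    exact this
  | mul_zero s =>
    have := EA.mul_zero (ι := ι) (s.subst τ)
    simp only [Fm.subst, Fm.neg, Fm.or, Fm.iff, Fm.and, Tm.succ, Tm.zero, Tm.subst, vec_subst,
      vec_subst_nil] at this ⊢
    exact this
  | mul_succ s t =>
    have := EA.mul_succ (ι := ι) (s.subst τ) (t.subst τ)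
    simp only [Fm.subst, Fm.neg, Fm.or, Fm.iff, Fm.and, Tm.succ, Tm.zero, Tm.subst, vec_subst,
      vec_subst_nil] at this ⊢
    exact this
  | exp_zero =>
    have := EA.exp_zero (ι := ι)
    simp only [Fm.subst, Fm.neg, Fm.or, Fm.iff, Fm.and, Tm.succ, Tm.zero, Tm.subst, vec_subst,
      vec_subst_nil] at this ⊢
    exact this
  | exp_succ t =>
    have := EA.exp_succ (ι := ι) (t.subst τ)
    simp only [Fm.subst, Fm.neg, Fm.or, Fm.iff, Fm.and, Tm.succ, Tm.zero, Tm.subst, vec_subst,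
      vec_subst_nil] at this ⊢
    exact this
  | proj i v => exact .proj i fun i => (v i).subst τ
  | comp f g v => exact .comp f g fun i => (v i).subst τ
  | brec_zero g h b v r s hr hs =>
    have := EA.brec_zero (ι := ι) g h b (fun i => (v i).subst τ) (r.subst τ) (s.subst τ)
      (by rw [hr]; rfl) (by rw [hs, Tm.subst, vec_subst]; simp only [Tm.zero, Tm.subst, vec_subst_nil])
    simp only [Fm.subst, Tm.succ, Tm.zero, Tm.subst, vec_subst, vec_subst_nil] at this ⊢
    exact this
  | brec_succ g h b v t r s hr hs =>
    have := EA.brec_succ (ι := ι) g h b (fun i => (v i).subst τ) (t.subst τ) (r.subst τ)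
      (s.subst τ) (by rw [hr]; simp only [Tm.subst, vec_subst])
      (by rw [hs, Tm.subst, vec_subst]; simp only [Tm.succ, Tm.subst, vec_subst, vec_subst_nil])
    simp only [Fm.subst, Tm.succ, Tm.zero, Tm.subst, vec_subst, vec_subst_nil] at this ⊢
    exact this

theorem AccFm.subst {σ : Fm AccOp} (h : AccFm σ) (τ : ℕ → Tm) : AccFm (σ.subst τ) := by
  cases h with
  | mk θ t R h => exact .mk _ _ R (h.subst _)

theorem Fm.ofArith_varsBelow {A : Fm Empty} {n : ℕ} (h : A.VarsBelow n) :
    (A.ofArith (ι := ι)).VarsBelow n := by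
  induction A generalizing n with
  | mem R t => exact R.elim
  | imp A B ihA ihB => exact ⟨ihA h.1, ihB h.2⟩
  | all A ih => exact ih (n := n + 1) h
  | _ => exact h

theorem AccOp.app_subst (φ : AccOp) (S : Tm → Fm AccOp) (τ : ℕ → Tm) (hτ : τ 0 = .var 0) :
    (φ.app S).subst τ = φ.app fun t => (S t).subst (up τ) := by
  have h : φ.guard.ofArith.subst (up τ) = φ.guard.ofArith (ι := AccOp) := by
    conv_rhs => rw [← Fm.subst_var φ.guard.ofArith]
    refine Fm.subst_congr (n := 2) (Fm.ofArith_varsBelow φ.guard_vars) fun i hi => ?_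
    interval_cases i
    · rfl
    · simp [up, scons, hτ, Tm.lift, Tm.subst]
  rw [app, app, Fm.subst_all, Fm.subst, h]

theorem AccOp.term_subst (φ : AccOp) (τ : ℕ → Tm) (hτ : τ 0 = .var 0) :
    φ.term.subst (up τ) = φ.term := by
  conv_rhs => rw [← Tm.subst_var φ.term]
  refine Tm.subst_congr (n := 2) φ.term_vars fun i hi => ?_
  interval_cases i
  · rfl
  · simp [up, scons, hτ, Tm.lift, Tm.subst]

theorem IDAxiom.subst {Θ Γ : Set (Fm AccOp)} (hΘ : ∀ A ∈ Θ, ∀ τ, A.subst τ ∈ Θ)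
    (hΓ : ∀ A ∈ Γ, ∀ τ, A.subst τ ∈ Γ) {A : Fm AccOp} (h : IDAxiom Θ Γ A) (τ : ℕ → Tm) :
    IDAxiom Θ Γ (A.subst τ) := by
  cases h with
  | arith h => exact .arith (h.subst τ)
  | ind h => rw [indAx_subst]; exact .ind (hΘ _ h _)
  | closed φ =>
    rw [Fm.subst_all, Fm.subst, AccOp.app_subst _ _ (up τ) rfl]
    simp only [Fm.subst, Tm.subst]
    have := IDAxiom.closed (Θ := Θ) (Γ := Γ) φ
    rw [AccOp.app] at this ⊢
    rw [AccOp.term_subst _ (up τ) rfl]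
    exact this
  | least φ h =>
    rename_i σ
    have := IDAxiom.least (Θ := Θ) φ (hΓ _ h (up τ))
    convert this using 1
    simp only [Fm.subst_all, Fm.subst_imp]
    rw [AccOp.app_subst _ _ (up (up τ)) rfl, AccOp.app, AccOp.app]
    simp only [Fm.subst_subst]
    congr 7
    · refine congrArg (σ.subst ·) (funext fun i => ?_)
      cases i with
      | zero => exact AccOp.term_subst _ (up (up τ)) rfl
      | succ i => simp [up, scons, Tm.subst, Tm.lift, Tm.subst_subst]
    · funext i
      cases i with
      | zero => rfl
      | succ i => simp [up, scons, Tm.subst, Tm.lift, Tm.subst_subst]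

end Closure

/-- Provability in `(Π⁰ₖ(P), Acc)-ID(Acc)` follows from truth in all models. -/
theorem piAccIDProves_of_sat {k : ℕ} {A : Fm AccOp}
    (h : ∀ (M : Type) [Str AccOp M],
      (∀ B, IDAxiom {θ | Hier true k θ} {σ | AccFm σ} B → ∀ ρ : Env M, B.sat ρ) →
        ∀ ρ : Env M, A.sat ρ) : PiAccIDProves k A :=
  completeness (T := {B | IDAxiom {θ | Hier true k θ} {σ | AccFm σ} B})
    (fun _ hA τ => IDAxiom.subst (Θ := {θ | Hier true k θ}) (Γ := {σ | AccFm σ})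
      (fun _ h τ => Hier.subst h τ) (fun _ h τ => AccFm.subst h τ) hA τ) h

/-! ## Models of the theories -/

/-- A model of elementary recursive arithmetic with induction for positive formulas, and with the
axioms for the predicate constants. -/
class IDModel (M : Type) [Str AccOp M] : Prop where
  ea {A : Fm AccOp} : EA A → ∀ ρ : Env M, A.sat ρ
  pos_ind {θ : Fm AccOp} : Polarity true θ → ∀ ρ : Env M, (indAx θ).sat ρ
  fixed {A : Fm AccOp} : IDAxiom ∅ {σ | AccFm σ} A → ∀ ρ : Env M, A.sat ρ

/-! ## Definable functions and relations -/

section Definability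

variable {M : Type}

/-- The assignment that combines the values `ρ` and the parameters `p`. -/
def mix (ρ p : Env M) : Env M := fun i => Sum.elim ρ p (Equiv.natSumNatEquivNat.symm i)

theorem mix_inl (ρ p : Env M) (i : ℕ) : mix ρ p (Equiv.natSumNatEquivNat (.inl i)) = ρ i := by
  simp [mix]

theorem mix_inr (ρ p : Env M) (i : ℕ) : mix ρ p (Equiv.natSumNatEquivNat (.inr i)) = p i := by
  simp [mix]

/-- The renaming of the combined variables by `f` (for values) and `g` (for parameters). -/
def mixRen (f g : ℕ → ℕ) : ℕ → Tm := fun i =>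
  Sum.elim (fun i => .var (f i)) (fun i => .var (g i)) (Equiv.natSumNatEquivNat.symm i)

variable [Str AccOp M]

theorem eval_mixRen (f g : ℕ → ℕ) (ρ : Env M) :
    (fun i => (mixRen f g i).eval ρ) = mix (fun i => ρ (f i)) fun i => ρ (g i) := by
  funext i
  simp only [mixRen, mix]
  cases Equiv.natSumNatEquivNat.symm i <;> rfl

/-- The function is given by a term, with parameters. -/
class TF (f : Env M → M) : Prop where
  out : ∃ (p : Env M) (t : Tm), ∀ ρ, f ρ = t.eval (mix ρ p)

/-- The relation is given by a formula from the class `K`, with parameters. -/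
class Df (K : Fm AccOp → Prop) (P : Env M → Prop) : Prop where
  out : ∃ (p : Env M) (A : Fm AccOp), K A ∧ ∀ ρ, P ρ ↔ A.sat (mix ρ p)

theorem reparam_term {t : Tm} {p p' : Env M} {j : ℕ → ℕ} (h : ∀ i, p' (j i) = p i) :
    ∃ t' : Tm, ∀ ρ, t'.eval (mix ρ p') = t.eval (mix ρ p) :=
  ⟨t.subst (mixRen (fun i => Equiv.natSumNatEquivNat (.inl i))
    fun i => Equiv.natSumNatEquivNat (.inr (j i))), fun ρ => by
    rw [Tm.eval_subst, eval_mixRen]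
    simp only [mix_inl, mix_inr, h]⟩

/-- Closure of a class of formulas under substitution. -/
class SubstClosed (K : Fm AccOp → Prop) : Prop where
  subst {A : Fm AccOp} : K A → ∀ τ, K (A.subst τ)

instance : SubstClosed Delta0 := ⟨Delta0.subst⟩
instance (b : Bool) : SubstClosed (Polarity b) := ⟨Polarity.subst⟩
instance (b : Bool) (k : ℕ) : SubstClosed (Hier b k) := ⟨Hier.subst⟩

theorem reparam {K : Fm AccOp → Prop} [SubstClosed K] {A : Fm AccOp} (hA : K A) {p p' : Env M}
    {j : ℕ → ℕ} (h : ∀ i, p' (j i) = p i) :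
    ∃ A' : Fm AccOp, K A' ∧ ∀ ρ, A'.sat (mix ρ p') ↔ A.sat (mix ρ p) :=
  ⟨A.subst (mixRen (fun i => Equiv.natSumNatEquivNat (.inl i))
    fun i => Equiv.natSumNatEquivNat (.inr (j i))), SubstClosed.subst hA _, fun ρ => by
    rw [Fm.sat_subst, eval_mixRen]
    simp only [mix_inl, mix_inr, h]⟩

instance TF.var (i : ℕ) : TF fun ρ : Env M => ρ i :=
  ⟨fun _ => ‹Str AccOp M›.fn .zero ![], .var (Equiv.natSumNatEquivNat (.inl i)), fun ρ => (mix_inl ρ _ i).symm⟩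

instance TF.const (a : M) : TF fun _ : Env M => a :=
  ⟨fun _ => a, .var (Equiv.natSumNatEquivNat (.inr 0)), fun ρ => (mix_inr ρ (fun _ => a) 0).symm⟩

theorem TF.fn {n : ℕ} (f : Elem n) (g : Fin n → Env M → M) [h : ∀ i, TF (g i)] :
    TF fun ρ => Str.fn f fun i => g i ρ := by
  choose p t ht using fun i => (h i).out
  let p' : Env M := fun j => if h : (Nat.unpair j).1 < n then p ⟨_, h⟩ (Nat.unpair j).2
    else Str.fn Elem.zero ![]
  have : ∀ i : Fin n, ∃ t' : Tm, ∀ ρ, t'.eval (mix ρ p') = (t i).eval (mix ρ (p i)) :=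
    fun i => reparam_term (j := fun j => Nat.pair i j) fun j => by simp [p']
  choose t' ht' using this
  exact ⟨p', .fn f t', fun ρ => by simp only [Tm.eval, ht', ← ht]⟩

/-- A function symbol with one argument. -/
def F1 (f : Elem 1) (x : M) : M := Str.fn f ![x]

/-- A function symbol with two arguments. -/
def F2 (f : Elem 2) (x y : M) : M := Str.fn f ![x, y]

instance TF.f1 (f : Elem 1) (a : Env M → M) [ha : TF a] : TF fun ρ => F1 f (a ρ) := by
  have := TF.fn f ![a] (h := Fin.cons ha finZeroElim)
  convert this using 2 with ρ
  rw [F1]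
  congr 1
  funext i
  fin_cases i
  rfl

instance TF.f2 (f : Elem 2) (a b : Env M → M) [ha : TF a] [hb : TF b] :
    TF fun ρ => F2 f (a ρ) (b ρ) := by
  have := TF.fn f ![a, b] (h := Fin.cons ha (Fin.cons hb finZeroElim))
  convert this using 2 with ρ
  rw [F2]
  congr 1
  funext i
  fin_cases i <;> rfl

/-- Two definable functions with common parameters. -/
theorem TF.pair {f g : Env M → M} (hf : TF f) (hg : TF g) :
    ∃ (p : Env M) (t u : Tm), (∀ ρ, f ρ = t.eval (mix ρ p)) ∧ ∀ ρ, g ρ = u.eval (mix ρ p) := by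
  obtain ⟨p, t, ht⟩ := hf.out
  obtain ⟨q, u, hu⟩ := hg.out
  obtain ⟨t', ht'⟩ := reparam_term (t := t) (p' := mix p q) (mix_inl p q)
  obtain ⟨u', hu'⟩ := reparam_term (t := u) (p' := mix p q) (mix_inr p q)
  exact ⟨mix p q, t', u', fun ρ => by rw [ht, ht'], fun ρ => by rw [hu, hu']⟩

theorem Df.pair {K L : Fm AccOp → Prop} [SubstClosed K] [SubstClosed L] {P Q : Env M → Prop}
    (hP : Df K P) (hQ : Df L Q) :
    ∃ (p : Env M) (A B : Fm AccOp), K A ∧ L B ∧ (∀ ρ, P ρ ↔ A.sat (mix ρ p)) ∧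
      ∀ ρ, Q ρ ↔ B.sat (mix ρ p) := by
  obtain ⟨p, A, hA, hpA⟩ := hP.out
  obtain ⟨q, B, hB, hqB⟩ := hQ.out
  obtain ⟨A', hA', h⟩ := reparam hA (p' := mix p q) (mix_inl p q)
  obtain ⟨B', hB', h'⟩ := reparam hB (p' := mix p q) (mix_inr p q)
  exact ⟨mix p q, A', B', hA', hB', fun ρ => by rw [hpA, h], fun ρ => by rw [hqB, h']⟩

theorem Df.pair_tm {K : Fm AccOp → Prop} [SubstClosed K] {P : Env M → Prop} {f : Env M → M}
    (hP : Df K P) (hf : TF f) :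
    ∃ (p : Env M) (A : Fm AccOp) (t : Tm), K A ∧ (∀ ρ, P ρ ↔ A.sat (mix ρ p)) ∧
      ∀ ρ, f ρ = t.eval (mix ρ p) := by
  obtain ⟨p, A, hA, hpA⟩ := hP.out
  obtain ⟨q, t, ht⟩ := hf.out
  obtain ⟨A', hA', h⟩ := reparam hA (p' := mix p q) (mix_inl p q)
  obtain ⟨t', ht'⟩ := reparam_term (t := t) (p' := mix p q) (mix_inr p q)
  exact ⟨mix p q, A', t', hA', fun ρ => by rw [hpA, h], fun ρ => by rw [ht, ht']⟩

instance : LT M := ⟨Str.lt⟩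

theorem Df.mono {K L : Fm AccOp → Prop} (h : ∀ A, K A → L A) {P : Env M → Prop} (hP : Df K P) :
    Df L P := by
  obtain ⟨p, A, hA, e⟩ := hP.out
  exact ⟨p, A, h A hA, e⟩

theorem Df.congr {K : Fm AccOp → Prop} {P Q : Env M → Prop} (hP : Df K P) (h : ∀ ρ, P ρ ↔ Q ρ) :
    Df K Q := by
  obtain ⟨p, A, hA, e⟩ := hP.out
  exact ⟨p, A, hA, fun ρ => (h ρ).symm.trans (e ρ)⟩

theorem Df.imp' {K L N : Fm AccOp → Prop} [SubstClosed K] [SubstClosed L]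
    (hN : ∀ A B, K A → L B → N (A.imp B)) {P Q : Env M → Prop} (hP : Df K P) (hQ : Df L Q) :
    Df N fun ρ => P ρ → Q ρ := by
  obtain ⟨p, A, B, hA, hB, h, h'⟩ := hP.pair hQ
  exact ⟨p, A.imp B, hN A B hA hB, fun ρ => by rw [h, h']; rfl⟩

/-- The renaming that moves the first value to the front. -/
theorem sat_bind (A : Fm AccOp) (x : M) (ρ p : Env M) :
    (A.subst (mixRen (fun i => Nat.casesOn i 0 fun i => Equiv.natSumNatEquivNat (.inl i) + 1)
      fun i => Equiv.natSumNatEquivNat (.inr i) + 1)).sat (Env.cons x (mix ρ p)) ↔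
      A.sat (mix (Env.cons x ρ) p) := by
  rw [Fm.sat_subst, eval_mixRen]
  refine iff_of_eq (congrArg (A.sat ·) (congrArg₂ mix ?_ ?_)) <;> funext i
  · cases i with
    | zero => rfl
    | succ i => exact mix_inl ρ p i
  · exact mix_inr ρ p i

theorem Df.all' {K L : Fm AccOp → Prop} [SubstClosed K] (hL : ∀ A, K A → L A.all)
    {P : M → Env M → Prop} (hP : Df K fun ρ : Env M => P (ρ 0) fun i => ρ (i + 1)) :
    Df L fun ρ => ∀ x, P x ρ := by
  obtain ⟨p, A, hA, h⟩ := hP.out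
  exact ⟨p, _, hL _ (SubstClosed.subst hA _), fun ρ =>
    forall_congr' fun x => (h (Env.cons x ρ)).trans (sat_bind A x ρ p).symm⟩

theorem Df.ball' {K L : Fm AccOp → Prop} [SubstClosed K] (hL : ∀ t A, K A → L (.ball t A))
    {P : M → Env M → Prop} {f : Env M → M} (hf : TF f)
    (hP : Df K fun ρ : Env M => P (ρ 0) fun i => ρ (i + 1)) :
    Df L fun ρ => ∀ x, x < f ρ → P x ρ := by
  obtain ⟨p, A, t, hA, h, ht⟩ := hP.pair_tm hf
  exact ⟨p, _, hL t _ (SubstClosed.subst hA _), fun ρ => forall_congr' fun x =>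
    imp_congr (by rw [Fm.sat, Tm.eval_lift, ht]; rfl)
      ((h (Env.cons x ρ)).trans (sat_bind A x ρ p).symm)⟩

/-! Bounded arithmetical relations. -/

instance Df.eq (f g : Env M → M) [hf : TF f] [hg : TF g] : Df Delta0 fun ρ => f ρ = g ρ := by
  obtain ⟨p, t, u, ht, hu⟩ := hf.pair hg
  exact ⟨p, .eq t u, .eq _ _, fun ρ => by rw [ht, hu]; rfl⟩

instance Df.lt (f g : Env M → M) [hf : TF f] [hg : TF g] : Df Delta0 fun ρ => f ρ < g ρ := by
  obtain ⟨p, t, u, ht, hu⟩ := hf.pair hg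
  exact ⟨p, .lt t u, .lt _ _, fun ρ => by rw [ht, hu]; rfl⟩

instance Df.bot : Df Delta0 fun _ : Env M => False :=
  ⟨fun _ => Str.fn .zero ![], .bot, .bot, fun _ => Iff.rfl⟩

instance Df.imp (P Q : Env M → Prop) [hP : Df Delta0 P] [hQ : Df Delta0 Q] :
    Df Delta0 fun ρ => P ρ → Q ρ := Df.imp' (fun _ _ => .imp) hP hQ

instance Df.not (P : Env M → Prop) [hP : Df Delta0 P] : Df Delta0 fun ρ => ¬ P ρ :=
  Df.imp P fun _ => False

instance Df.ne (f g : Env M → M) [hf : TF f] [hg : TF g] : Df Delta0 fun ρ => f ρ ≠ g ρ :=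
  Df.not fun ρ => f ρ = g ρ

instance Df.and (P Q : Env M → Prop) [hP : Df Delta0 P] [hQ : Df Delta0 Q] :
    Df Delta0 fun ρ => P ρ ∧ Q ρ :=
  (Df.not fun ρ => P ρ → ¬ Q ρ).congr fun ρ => by tauto

instance Df.or (P Q : Env M → Prop) [hP : Df Delta0 P] [hQ : Df Delta0 Q] :
    Df Delta0 fun ρ => P ρ ∨ Q ρ :=
  (Df.imp (fun ρ => ¬ P ρ) Q).congr fun ρ => by tauto

instance Df.ball (f : Env M → M) (P : M → Env M → Prop) [hf : TF f]
    [hP : Df Delta0 fun ρ : Env M => P (ρ 0) fun i => ρ (i + 1)] :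
    Df Delta0 fun ρ => ∀ x, x < f ρ → P x ρ := Df.ball' (fun t _ => .ball t) hf hP

instance Df.bex (f : Env M → M) (P : M → Env M → Prop) [hf : TF f]
    [hP : Df Delta0 fun ρ : Env M => P (ρ 0) fun i => ρ (i + 1)] :
    Df Delta0 fun ρ => ∃ x, x < f ρ ∧ P x ρ :=
  (Df.not fun ρ => ∀ x, x < f ρ → ¬ P x ρ).congr fun ρ => by push Not; rfl

/-! Positive relations. -/

theorem Delta0.polarity {A : Fm AccOp} (h : Delta0 A) (b : Bool) : Polarity b A := by
  induction h generalizing b with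
  | imp _ _ ihA ihB => exact ⟨ihA _, ihB _⟩
  | ball t _ ih => exact ⟨trivial, ih b⟩
  | _ => trivial

instance (priority := 900) Df.pol_of_delta0 (b : Bool) (P : Env M → Prop) [hP : Df Delta0 P] :
    Df (Polarity b) P := hP.mono fun _ h => h.polarity b

/-- Membership in the interpretation of a predicate constant. -/
def Mem (R : AccOp) (x : M) : Prop := Str.mem R x

instance Df.mem (R : AccOp) (f : Env M → M) [hf : TF f] :
    Df (Polarity true) fun ρ => Mem R (f ρ) := by
  obtain ⟨p, t, ht⟩ := hf.out
  exact ⟨p, .mem R t, rfl, fun ρ => by rw [ht]; rfl⟩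

instance Df.pos_imp (P Q : Env M → Prop) [hP : Df Delta0 P] [hQ : Df (Polarity true) Q] :
    Df (Polarity true) fun ρ => P ρ → Q ρ := Df.imp' (fun _ _ h h' => ⟨h.polarity _, h'⟩) hP hQ

instance Df.pos_all (P : M → Env M → Prop)
    [hP : Df (Polarity true) fun ρ : Env M => P (ρ 0) fun i => ρ (i + 1)] :
    Df (Polarity true) fun ρ => ∀ x, P x ρ := Df.all' (K := Polarity true) (fun _ h => h) hP

end Definability

/-! ## Induction in models -/

section Induction

variable {M : Type} [Str AccOp M]

instance : Zero M := ⟨Str.fn .zero ![]⟩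

theorem eval_zero (ρ : Env M) : Tm.zero.eval ρ = 0 :=
  congrArg (Str.fn Elem.zero) (Subsingleton.elim _ _)

theorem eval_succ (t : Tm) (ρ : Env M) : (Tm.succ t).eval ρ = F1 .succ (t.eval ρ) := by
  refine congrArg (Str.fn Elem.succ) (funext fun i => ?_)
  fin_cases i
  rfl

theorem eval_fn1 (f : Elem 1) (t : Tm) (ρ : Env M) :
    (Tm.fn f ![t]).eval ρ = F1 f (t.eval ρ) := by
  refine congrArg (Str.fn f) (funext fun i => ?_)
  fin_cases i
  rfl

theorem eval_fn2 (f : Elem 2) (s t : Tm) (ρ : Env M) :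
    (Tm.fn f ![s, t]).eval ρ = F2 f (s.eval ρ) (t.eval ρ) := by
  refine congrArg (Str.fn f) (funext fun i => ?_)
  fin_cases i <;> rfl

theorem Fm.sat_neg (A : Fm AccOp) (ρ : Env M) : A.neg.sat ρ ↔ ¬ A.sat ρ := Iff.rfl

theorem Fm.sat_and (A B : Fm AccOp) (ρ : Env M) : (A.and B).sat ρ ↔ A.sat ρ ∧ B.sat ρ := by
  simp only [Fm.and, Fm.sat_neg, Fm.sat]
  tauto

theorem Fm.sat_or (A B : Fm AccOp) (ρ : Env M) : (A.or B).sat ρ ↔ A.sat ρ ∨ B.sat ρ := by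
  simp only [Fm.or, Fm.sat_neg, Fm.sat]
  tauto

theorem Fm.sat_iff (A B : Fm AccOp) (ρ : Env M) : (A.iff B).sat ρ ↔ (A.sat ρ ↔ B.sat ρ) := by
  simp only [Fm.iff, Fm.sat_and, Fm.sat]
  tauto

/-- A unary relation with the parameters listed after its argument. -/
theorem Df.unary {K : Fm AccOp → Prop} [SubstClosed K] {P : M → Prop}
    (hP : Df K fun ρ : Env M => P (ρ 0)) :
    ∃ (p : Env M) (A : Fm AccOp), K A ∧ ∀ x, A.sat (Env.cons x p) ↔ P x := by
  obtain ⟨p, A, hA, h⟩ := hP.out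
  refine ⟨p, A.subst (mixRen id (· + 1)), SubstClosed.subst hA _, fun x => ?_⟩
  rw [Fm.sat_subst, eval_mixRen]
  exact (h (Env.cons x p)).symm

theorem indAx_sat {θ : Fm AccOp} {ρ : Env M} (h : (indAx θ).sat ρ) {P : M → Prop}
    (hP : ∀ x, θ.sat (Env.cons x ρ) ↔ P x) (h₀ : P 0) (hs : ∀ x, P x → P (F1 .succ x)) (x : M) :
    P x := by
  rw [indAx] at h
  refine (hP x).1 (h ((Fm.sat_and _ _ _).2 ⟨?_, fun x hx => ?_⟩) x)
  · rw [Fm.inst, Fm.sat_subst]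
    refine Eq.mp (congrArg (θ.sat ·) ?_) ((hP 0).2 h₀)
    funext i
    cases i with
    | zero => exact (eval_zero _).symm
    | succ i => rfl
  · rw [Fm.sat_subst]
    refine Eq.mp (congrArg (θ.sat ·) ?_) ((hP _).2 (hs x ((hP x).1 hx)))
    funext i
    cases i with
    | zero => exact (eval_succ (.var 0) (Env.cons x ρ)).symm
    | succ i => rfl

theorem succ_induction [IDModel M] (P : M → Prop)
    [hP : Df (Polarity true) fun ρ : Env M => P (ρ 0)] (h₀ : P 0)
    (hs : ∀ x, P x → P (F1 .succ x)) (x : M) : P x := by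
  obtain ⟨p, A, hA, h⟩ := hP.unary
  exact indAx_sat (IDModel.pos_ind hA p) h h₀ hs x

/-- The guard `θ(x, y)` of an operator form, in a model. -/
def AccOp.Guard (φ : AccOp) (y x : M) : Prop :=
  φ.guard.ofArith.sat (Env.cons y (Env.cons x fun _ => 0))

/-- The term `t(x, y)` of an operator form, in a model. -/
def AccOp.tm (φ : AccOp) (y x : M) : M := φ.term.eval (Env.cons y (Env.cons x fun _ => 0))

theorem Tm.eval_congr {t : Tm} {n : ℕ} (h : t.VarsBelow n) {ρ ρ' : Env M}
    (hρ : ∀ i < n, ρ i = ρ' i) : t.eval ρ = t.eval ρ' := by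
  induction t with
  | var i => exact hρ i h
  | fn f v ih => simp only [eval, fun i => ih i (h i)]

theorem Fm.sat_congr {A : Fm AccOp} {n : ℕ} (h : A.VarsBelow n) {ρ ρ' : Env M}
    (hρ : ∀ i < n, ρ i = ρ' i) : A.sat ρ ↔ A.sat ρ' := by
  induction A generalizing n ρ ρ' with
  | eq s t => simp only [sat, Tm.eval_congr h.1 hρ, Tm.eval_congr h.2 hρ]
  | lt s t => simp only [sat, Tm.eval_congr h.1 hρ, Tm.eval_congr h.2 hρ]
  | mem R t => simp only [sat, Tm.eval_congr h hρ]
  | bot => rfl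
  | imp A B ihA ihB => exact imp_congr (ihA h.1 hρ) (ihB h.2 hρ)
  | all A ih =>
    refine forall_congr' fun x => ih (n := n + 1) h fun i hi => ?_
    cases i with
    | zero => rfl
    | succ i => exact hρ i (Nat.lt_of_succ_lt_succ hi)

theorem AccOp.sat_guard (φ : AccOp) (y x : M) (ρ : Env M) :
    φ.guard.ofArith.sat (Env.cons y (Env.cons x ρ)) ↔ φ.Guard y x := by
  refine Fm.sat_congr (n := 2) (Fm.ofArith_varsBelow φ.guard_vars) fun i hi => ?_
  interval_cases i <;> rfl

theorem AccOp.eval_term (φ : AccOp) (y x : M) (ρ : Env M) :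
    φ.term.eval (Env.cons y (Env.cons x ρ)) = φ.tm y x := by
  refine Tm.eval_congr (n := 2) φ.term_vars fun i hi => ?_
  interval_cases i <;> rfl

theorem AccOp.closed [IDModel M] (φ : AccOp) {x : M} (h : ∀ y, φ.Guard y x → Mem φ (φ.tm y x)) :
    Mem φ x := by
  refine IDModel.fixed (.closed φ) (fun _ => (0 : M)) x fun y hy => ?_
  rw [Fm.sat, φ.eval_term]
  exact h y ((φ.sat_guard _ _ _).1 hy)

/-- Induction on a least fixed point. -/
theorem AccOp.induction [IDModel M] (φ R : AccOp) (θ : M → M → Prop) (t : M → M → M)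
    [hθ : Df Delta0 fun ρ : Env M => θ (ρ 0) (ρ 1)] [ht : TF fun ρ : Env M => t (ρ 0) (ρ 1)]
    (hs : ∀ x, (∀ y, φ.Guard y x → ∀ z, θ z (φ.tm y x) → Mem R (t z (φ.tm y x))) →
      ∀ z, θ z x → Mem R (t z x)) {x : M} (hx : Mem φ x) {z : M} (hz : θ z x) :
    Mem R (t z x) := by
  obtain ⟨p, A, u, hA, h, hu⟩ := hθ.pair_tm ht
  let A' := A.subst (mixRen id (· + 2))
  let u' := u.subst (mixRen id (· + 2))
  have hA' : ∀ z x, A'.sat (Env.cons z (Env.cons x p)) ↔ θ z x := fun z x => by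
    rw [Fm.sat_subst, eval_mixRen]
    exact (h (Env.cons z (Env.cons x p))).symm
  have hu' : ∀ z x, u'.eval (Env.cons z (Env.cons x p)) = t z x := fun z x => by
    rw [Tm.eval_subst, eval_mixRen]
    exact (hu (Env.cons z (Env.cons x p))).symm
  have hσ : ∀ x, (Fm.all (A'.imp (.mem R u'))).sat (Env.cons x p) ↔
      ∀ z, θ z x → Mem R (t z x) := fun x => by
    refine forall_congr' fun z => imp_congr (hA' z x) ?_
    rw [Fm.sat, hu']
    rfl
  refine (hσ x).1 (IDModel.fixed (.least φ (σ := .all (A'.imp (.mem R u')))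
    (.mk A' u' R (SubstClosed.subst hA _))) p x hx fun x' hx' => ?_) z hz
  rw [Fm.sat_subst]
  refine Eq.mp (congrArg (Fm.sat · _) ?_) ((hσ x').2 (hs x' fun y hy => ?_))
  · funext i
    cases i <;> rfl
  · have := hx' y ((φ.sat_guard _ _ _).2 hy)
    rw [Fm.sat_subst] at this
    refine (hσ _).1 (Eq.mp (congrArg (Fm.sat · _) ?_) this)
    funext i
    cases i with
    | zero => exact φ.eval_term _ _ _
    | succ i => rfl

/-! ## The axioms of arithmetic in models -/

variable [IDModel M]

theorem eval_vecCons {n : ℕ} (t : Tm) (v : Fin n → Tm) (ρ : Env M) :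
    (fun i => (Matrix.vecCons t v i).eval ρ) = Matrix.vecCons (t.eval ρ) fun i => (v i).eval ρ := by
  funext i
  exact Fin.cases rfl (fun i => rfl) i

theorem F1_succ_ne (x : M) : F1 .succ x ≠ 0 := fun h => by
  refine IDModel.ea (EA.succ_ne_zero (.var 0)) (fun _ => x) ?_
  rw [Fm.sat, eval_succ, eval_zero]
  exact h

theorem not_lt_zero' (x : M) : ¬ x < 0 := fun h => by
  refine IDModel.ea (EA.not_lt_zero (.var 0)) (fun _ => x) ?_
  rw [Fm.sat, eval_zero]
  exact h

theorem lt_F1_succ (x y : M) : x < F1 .succ y ↔ x < y ∨ x = y := by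
  have := IDModel.ea (EA.lt_succ (.var 0) (.var 1)) (Env.cons x fun _ => y)
  simp only [Fm.sat_iff, Fm.sat_or, Fm.sat, eval_succ] at this
  exact this

theorem F1_pred_zero : F1 .pred (0 : M) = 0 := by
  have := IDModel.ea EA.pred_zero (fun _ => (0 : M))
  simp only [Fm.sat, eval_fn1, eval_zero] at this
  exact this

theorem F1_pred_succ (x : M) : F1 .pred (F1 .succ x) = x := by
  have := IDModel.ea (EA.pred_succ (.var 0)) (fun _ => x)
  simp only [Fm.sat, eval_fn1, eval_succ] at this
  exact this

theorem F2_add_zero (x : M) : F2 .add x 0 = x := by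
  have := IDModel.ea (EA.add_zero (.var 0)) (fun _ => x)
  simp only [Fm.sat, eval_fn2, eval_zero] at this
  exact this

theorem F2_add_succ (x y : M) : F2 .add x (F1 .succ y) = F1 .succ (F2 .add x y) := by
  have := IDModel.ea (EA.add_succ (.var 0) (.var 1)) (Env.cons x fun _ => y)
  simp only [Fm.sat, eval_fn2, eval_succ] at this
  exact this

theorem F2_sub_zero (x : M) : F2 .sub x 0 = x := by
  have := IDModel.ea (EA.sub_zero (.var 0)) (fun _ => x)
  simp only [Fm.sat, eval_fn2, eval_zero] at this
  exact this

theorem F2_sub_succ (x y : M) : F2 .sub x (F1 .succ y) = F1 .pred (F2 .sub x y) := by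
  have := IDModel.ea (EA.sub_succ (.var 0) (.var 1)) (Env.cons x fun _ => y)
  simp only [Fm.sat, eval_fn1, eval_fn2, eval_succ] at this
  exact this

theorem F2_mul_zero (x : M) : F2 .mul x 0 = 0 := by
  have := IDModel.ea (EA.mul_zero (.var 0)) (fun _ => x)
  simp only [Fm.sat, eval_fn2, eval_zero] at this
  exact this

theorem F2_mul_succ (x y : M) : F2 .mul x (F1 .succ y) = F2 .add (F2 .mul x y) x := by
  have := IDModel.ea (EA.mul_succ (.var 0) (.var 1)) (Env.cons x fun _ => y)
  simp only [Fm.sat, eval_fn2, eval_succ] at this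
  exact this

theorem F1_exp_zero : F1 .exp (0 : M) = F1 .succ 0 := by
  have := IDModel.ea EA.exp_zero (fun _ => (0 : M))
  simp only [Fm.sat, eval_fn1, eval_succ, eval_zero] at this
  exact this

theorem F1_exp_succ (x : M) : F1 .exp (F1 .succ x) = F2 .add (F1 .exp x) (F1 .exp x) := by
  have := IDModel.ea (EA.exp_succ (.var 0)) (fun _ => x)
  simp only [Fm.sat, eval_fn1, eval_fn2, eval_succ] at this
  exact this

theorem fn_proj {n : ℕ} (i : Fin n) (v : Fin n → M) : Str.fn (.proj i) v = v i := by
  have := IDModel.ea (EA.proj i fun i => .var i) (fun j => if h : j < n then v ⟨j, h⟩ else 0)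
  simp only [Fm.sat, Tm.eval, Fin.is_lt, dite_true, Fin.eta] at this
  exact this

theorem fn_comp {m n : ℕ} (f : Elem m) (g : Fin m → Elem n) (v : Fin n → M) :
    Str.fn (.comp f g) v = Str.fn f fun i => Str.fn (g i) v := by
  have := IDModel.ea (EA.comp f g fun i => .var i) (fun j => if h : j < n then v ⟨j, h⟩ else 0)
  simp only [Fm.sat, Tm.eval, Fin.is_lt, dite_true, Fin.eta] at this
  exact this

/-- The minimum, as it is written in the axioms for limited recursion. -/
def cut (x y : M) : M := F2 .sub x (F2 .sub x y)

theorem fn_brec_zero {n : ℕ} (g : Elem n) (h : Elem (n + 2)) (b : Elem (n + 1)) (v : Fin n → M) :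
    Str.fn (.brec g h b) (Matrix.vecCons 0 v) =
      cut (Str.fn g v) (Str.fn b (Matrix.vecCons 0 v)) := by
  have := IDModel.ea (EA.brec_zero g h b (fun i => .var i) _ _ rfl rfl)
    (fun j => if h : j < n then v ⟨j, h⟩ else 0)
  simp only [Fm.sat, eval_fn2] at this
  simp only [Tm.eval, eval_vecCons, eval_zero, Fin.is_lt, dite_true, Fin.eta] at this
  exact this

theorem fn_brec_succ {n : ℕ} (g : Elem n) (h : Elem (n + 2)) (b : Elem (n + 1)) (v : Fin n → M)
    (x : M) : Str.fn (.brec g h b) (Matrix.vecCons (F1 .succ x) v) =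
      cut (Str.fn h (Matrix.vecCons x (Matrix.vecCons (Str.fn (.brec g h b) (Matrix.vecCons x v)) v)))
        (Str.fn b (Matrix.vecCons (F1 .succ x) v)) := by
  have := IDModel.ea (EA.brec_succ g h b (fun i => .var (i + 1)) (.var 0) _ _ rfl rfl)
    (Env.cons x fun j => if h : j < n then v ⟨j, h⟩ else 0)
  simp only [Fm.sat, eval_fn2] at this
  simp only [Tm.eval, eval_vecCons, eval_succ, Env.cons, Fin.is_lt, dite_true, Fin.eta] at this
  exact this

end Induction

/-! ## Arithmetic in models -/

section Arithmetic

variable {M : Type} [Str AccOp M]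

instance : Add M := ⟨F2 .add⟩
instance : Mul M := ⟨F2 .mul⟩
instance : Sub M := ⟨F2 .sub⟩
instance : One M := ⟨F1 .succ 0⟩

instance (f g : Env M → M) [TF f] [TF g] : TF fun ρ => f ρ + g ρ := TF.f2 .add f g
instance (f g : Env M → M) [TF f] [TF g] : TF fun ρ => f ρ * g ρ := TF.f2 .mul f g
instance (f g : Env M → M) [TF f] [TF g] : TF fun ρ => f ρ - g ρ := TF.f2 .sub f g

variable [IDModel M]

theorem F1_succ (x : M) : F1 .succ x = x + 1 := by
  have := F2_add_succ x 0
  rw [F2_add_zero] at this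
  exact this.symm

theorem ind (P : M → Prop) [hP : Df (Polarity true) fun ρ : Env M => P (ρ 0)] (h₀ : P 0)
    (hs : ∀ x, P x → P (x + 1)) (x : M) : P x :=
  succ_induction P h₀ (fun x hx => by rw [F1_succ]; exact hs x hx) x

theorem lt_succ_iff' (x y : M) : x < y + 1 ↔ x < y ∨ x = y := by
  rw [← F1_succ]
  exact lt_F1_succ x y

namespace Arith

theorem add_zero (x : M) : x + 0 = x := F2_add_zero x

theorem add_succ (x y : M) : x + (y + 1) = x + y + 1 := by
  rw [← F1_succ, ← F1_succ]
  exact F2_add_succ x y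

theorem zero_add (x : M) : 0 + x = x :=
  ind (fun x : M => 0 + x = x) (add_zero 0) (fun x h => by rw [add_succ, h]) x

theorem succ_add (x y : M) : x + 1 + y = x + y + 1 :=
  ind (fun y => x + 1 + y = x + y + 1) (by rw [add_zero, add_zero])
    (fun y h => by rw [add_succ, add_succ, h]) y

theorem add_comm (x y : M) : x + y = y + x :=
  ind (fun y => x + y = y + x) (by rw [add_zero, zero_add])
    (fun y h => by rw [add_succ, succ_add, h]) y

theorem add_assoc (x y z : M) : x + y + z = x + (y + z) :=
  ind (fun z => x + y + z = x + (y + z)) (by rw [add_zero, add_zero])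
    (fun z h => by rw [add_succ, add_succ, add_succ, h]) z

theorem mul_zero (x : M) : x * 0 = 0 := F2_mul_zero x

theorem mul_succ (x y : M) : x * (y + 1) = x * y + x := by
  rw [← F1_succ]
  exact F2_mul_succ x y

theorem zero_mul (x : M) : 0 * x = 0 :=
  ind (fun x : M => 0 * x = 0) (mul_zero 0) (fun x h => by rw [mul_succ, h, add_zero]) x

theorem succ_mul (x y : M) : (x + 1) * y = x * y + y :=
  ind (fun y => (x + 1) * y = x * y + y) (by rw [mul_zero, mul_zero, add_zero])
    (fun y h => by
      rw [mul_succ, mul_succ, h, add_assoc, add_assoc, add_succ, add_comm y x, add_succ, add_succ, add_succ]) y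

theorem mul_comm (x y : M) : x * y = y * x :=
  ind (fun y => x * y = y * x) (by rw [mul_zero, zero_mul])
    (fun y h => by rw [mul_succ, succ_mul, h]) y

theorem mul_add (x y z : M) : x * (y + z) = x * y + x * z :=
  ind (fun z => x * (y + z) = x * y + x * z) (by rw [add_zero, mul_zero, add_zero])
    (fun z h => by rw [add_succ, mul_succ, mul_succ, h, add_assoc]) z

theorem mul_assoc (x y z : M) : x * y * z = x * (y * z) :=
  ind (fun z => x * y * z = x * (y * z)) (by rw [mul_zero, mul_zero, mul_zero])
    (fun z h => by rw [mul_succ, mul_succ, mul_add, h]) z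

theorem one_mul (x : M) : 1 * x = x := by
  have h := succ_mul 0 x
  rwa [zero_add, zero_mul, zero_add] at h

theorem lt_succ (x : M) : x < x + 1 := (lt_succ_iff' _ _).2 (.inr rfl)

theorem zero_lt_or (x : M) : 0 < x ∨ 0 = x :=
  ind (fun x : M => 0 < x ∨ 0 = x) (.inr rfl) (fun _ h => .inl ((lt_succ_iff' _ _).2 h)) x

theorem succ_lt_succ {x y : M} (h : x < y) : x + 1 < y + 1 :=
  ind (fun y => x < y → x + 1 < y + 1) (fun h => (not_lt_zero' _ h).elim)
    (fun y ih h => (lt_succ_iff' _ _).2 <| ((lt_succ_iff' _ _).1 h).imp ih fun h => by rw [h]) y h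

theorem lt_trans {x y z : M} (h : x < y) (h' : y < z) : x < z :=
  ind (fun z => y < z → x < z) (fun h => (not_lt_zero' _ h).elim)
    (fun _ ih h' => (lt_succ_iff' _ _).2 <| .inl <|
      ((lt_succ_iff' _ _).1 h').elim ih fun e => e ▸ h) z h'

theorem lt_irrefl (x : M) : ¬ x < x :=
  ind (fun x : M => ¬ x < x) (not_lt_zero' 0)
    (fun x ih h => ((lt_succ_iff' _ _).1 h).elim (fun h => ih (lt_trans (lt_succ x) h))
      fun h => ih (by have := lt_succ x; rwa [h] at this)) x

theorem lt_trichotomy (x y : M) : x < y ∨ x = y ∨ y < x :=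
  ind (fun x => x < y ∨ x = y ∨ y < x)
    ((zero_lt_or y).imp_right .inl)
    (fun x ih => by
      rcases ih with h | h | h
      · have := succ_lt_succ h
        rw [lt_succ_iff'] at this
        exact this.imp_right .inl
      · exact .inr (.inr ((lt_succ_iff' _ _).2 (.inr h.symm)))
      · exact .inr (.inr ((lt_succ_iff' _ _).2 (.inl h)))) x

theorem add_lt_add_right {x y : M} (h : x < y) (z : M) : x + z < y + z :=
  ind (fun z => x + z < y + z) (by rwa [add_zero, add_zero])
    (fun z ih => by rw [add_succ, add_succ]; exact succ_lt_succ ih) z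

theorem exists_add {x y : M} (h : x < y ∨ x = y) : ∃ z, y = x + z := by
  have := ind (fun y => (x < y ∨ x = y) → ∃ z, z < y + 1 ∧ y = x + z)
    (fun h => ⟨0, lt_succ _, by
      rw [add_zero]; exact h.elim (fun h => (not_lt_zero' _ h).elim) Eq.symm⟩)
    (fun y ih h => by
      rcases h with h | rfl
      · obtain ⟨z, hz, e⟩ := ih ((lt_succ_iff' _ _).1 h)
        exact ⟨z + 1, succ_lt_succ hz, by rw [add_succ, ← e]⟩
      · exact ⟨0, (lt_succ_iff' _ _).2 (zero_lt_or _), (add_zero _).symm⟩) y h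
  obtain ⟨z, -, hz⟩ := this
  exact ⟨z, hz⟩

end Arith

open Classical in
noncomputable instance : LinearOrder M where
  le x y := x < y ∨ x = y
  lt x y := x < y
  le_refl x := .inr rfl
  le_trans x y z h h' := by
    rcases h with h | rfl
    · rcases h' with h' | rfl
      · exact .inl (Arith.lt_trans h h')
      · exact .inl h
    · exact h'
  lt_iff_le_not_ge x y := by
    refine ⟨fun h => ⟨.inl h, ?_⟩, fun h => h.1.resolve_right fun e => h.2 (.inr e.symm)⟩
    rintro (h' | rfl)
    · exact Arith.lt_irrefl x (Arith.lt_trans h h')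
    · exact Arith.lt_irrefl _ h
  le_antisymm x y h h' := by
    rcases h with h | rfl
    · rcases h' with h' | rfl
      · exact (Arith.lt_irrefl x (Arith.lt_trans h h')).elim
      · rfl
    · rfl
  le_total x y := by
    rcases Arith.lt_trichotomy x y with h | h | h
    · exact .inl (.inl h)
    · exact .inl (.inr h)
    · exact .inr (.inl h)
  toDecidableLE := Classical.decRel _

instance : CommSemiring M where
  zero := 0
  add := (· + ·)
  mul := (· * ·)
  one := 1
  nsmul := nsmulRec
  add_assoc := Arith.add_assoc
  zero_add := Arith.zero_add
  add_zero := Arith.add_zero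
  add_comm := Arith.add_comm
  mul_assoc := Arith.mul_assoc
  one_mul := Arith.one_mul
  mul_one x := by rw [Arith.mul_comm, Arith.one_mul]
  zero_mul := Arith.zero_mul
  mul_zero := Arith.mul_zero
  mul_comm := Arith.mul_comm
  left_distrib := Arith.mul_add
  right_distrib x y z := by rw [Arith.mul_comm, Arith.mul_add, Arith.mul_comm z, Arith.mul_comm z]

theorem lt_succ_iff {x y : M} : x < y + 1 ↔ x ≤ y := lt_succ_iff' x y

theorem succ_le_iff {x y : M} : x + 1 ≤ y ↔ x < y := by
  rw [← not_lt, lt_succ_iff, not_le]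

instance : IsOrderedCancelAddMonoid M where
  add_le_add_left x y h z := by
    rcases h with h | rfl
    · exact (Arith.add_lt_add_right h z).le
    · exact le_rfl
  le_of_add_le_add_left x y z h := by
    by_contra h'
    have := Arith.add_lt_add_right (not_le.1 h') x
    rw [add_comm z, add_comm y] at this
    exact absurd h (not_le.2 this)

instance : CanonicallyOrderedAdd M where
  exists_add_of_le h := Arith.exists_add h
  le_self_add x y := by
    have := add_le_add_right (show (0 : M) ≤ y from Arith.zero_lt_or y) x
    rwa [add_zero] at this
  le_add_self x y := by
    have := add_le_add_left (show (0 : M) ≤ y from Arith.zero_lt_or y) x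
    rwa [zero_add] at this

instance : Nontrivial M := ⟨0, 1, (zero_add (1 : M) ▸ Arith.lt_succ (0 : M)).ne⟩

instance : IsStrictOrderedRing M where
  zero_le_one := zero_le
  mul_lt_mul_of_pos_left a h x y hxy := by
    obtain ⟨c, rfl⟩ := exists_add_of_le (succ_le_iff.2 hxy)
    have h' : (0 : M) < a := h
    rw [mul_add, mul_add, mul_one, add_assoc]
    exact lt_add_of_pos_right _ (add_pos_of_pos_of_nonneg h' zero_le)
  mul_lt_mul_of_pos_right a h x y hxy := by
    obtain ⟨c, rfl⟩ := exists_add_of_le (succ_le_iff.2 hxy)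
    have h' : (0 : M) < a := h
    rw [add_mul, add_mul, one_mul, add_assoc]
    exact lt_add_of_pos_right _ (add_pos_of_pos_of_nonneg h' zero_le)

end Arithmetic

section Arithmetic

variable {M : Type} [Str AccOp M] [IDModel M]

instance (f g : Env M → M) [TF f] [TF g] : Df Delta0 fun ρ => f ρ ≤ g ρ :=
  (Df.or (fun ρ => f ρ < g ρ) fun ρ => f ρ = g ρ).congr fun _ => le_iff_lt_or_eq.symm

instance Df.bex_le (f : Env M → M) (P : M → Env M → Prop) [hf : TF f]
    [hP : Df Delta0 fun ρ : Env M => P (ρ 0) fun i => ρ (i + 1)] :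
    Df Delta0 fun ρ => ∃ x, x ≤ f ρ ∧ P x ρ :=
  (Df.bex (fun ρ => f ρ + 1) P).congr fun ρ => by simp only [lt_succ_iff]

theorem strong_ind (P : M → Prop) [hP : Df (Polarity true) fun ρ : Env M => P (ρ 0)]
    (h : ∀ x, (∀ y, y < x → P y) → P x) (x : M) : P x := by
  have : Df (Polarity true) fun ρ : Env M => ∀ y, y < ρ 0 → P y := by
    obtain ⟨p, A, hA, e⟩ := hP.out
    have h' : Df (Polarity true) fun ρ : Env M => P (ρ 0) := hP
    have : Df (Polarity true) fun ρ : Env M => ρ 0 < ρ 1 → P (ρ 0) :=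
      Df.pos_imp _ _
    exact Df.all' (K := Polarity true) (fun _ h => h)
      (P := fun y ρ => y < ρ 0 → P y) this
  exact h x (ind (fun x => ∀ y, y < x → P y) (fun y hy => (not_lt_zero' y hy).elim)
    (fun x ih y hy => h y fun z hz => ih z (hz.trans_le (lt_succ_iff.1 hy))) x)

theorem eq_zero_or_succ (x : M) : x = 0 ∨ ∃ y, x = y + 1 := by
  rcases (zero_le (a := x)).eq_or_lt with h | h
  · exact .inl h.symm
  · obtain ⟨c, rfl⟩ := exists_add_of_le (succ_le_iff.2 h)
    exact .inr ⟨c, by ring⟩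

theorem pred_succ (x : M) : F1 .pred (x + 1) = x := by
  rw [← F1_succ, F1_pred_succ]

theorem sub_zero' (x : M) : x - 0 = x := F2_sub_zero x

theorem sub_succ' (x y : M) : x - (y + 1) = F1 .pred (x - y) := by
  rw [← F1_succ]
  exact F2_sub_succ x y

theorem add_sub_self (x y : M) : x + y - y = x :=
  ind (fun y => ∀ x, x + y - y = x) (fun x => by rw [add_zero, sub_zero'])
    (fun y ih x => by rw [sub_succ', ← add_assoc, add_right_comm, ih, pred_succ]) y x

theorem sub_add_self (x y : M) : x - (x + y) = 0 :=
  ind (fun y => x - (x + y) = 0)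
    (by have := add_sub_self 0 x; rw [zero_add] at this; rwa [add_zero])
    (fun y ih => by rw [← add_assoc, sub_succ', ih, F1_pred_zero]) y

instance : OrderedSub M where
  tsub_le_iff_right a b c := by
    rcases le_total a b with h | h
    · obtain ⟨d, rfl⟩ := exists_add_of_le h
      rw [sub_add_self]
      exact iff_of_true zero_le (h.trans (le_add_left le_rfl))
    · obtain ⟨d, rfl⟩ := exists_add_of_le h
      rw [add_comm b d, add_sub_self]
      exact (add_le_add_iff_right b).symm

theorem cut_eq (x y : M) : cut x y = min x y := by
  rw [cut]
  change x - (x - y) = _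
  rcases le_total x y with h | h
  · rw [tsub_eq_zero_of_le h, sub_zero', min_eq_left h]
  · rw [tsub_tsub_cancel_of_le h, min_eq_right h]

/-! ### Evaluation of function symbols -/

section Eval

variable {n : ℕ} (v : Fin n → M)

theorem fn_ap1 (f : Elem 1) (x : Elem n) : Str.fn (.ap1 f x) v = F1 f (Str.fn x v) := by
  rw [Elem.ap1, fn_comp]
  exact congrArg (Str.fn f) (funext fun i => by fin_cases i; rfl)

theorem fn_ap2 (f : Elem 2) (x y : Elem n) :
    Str.fn (.ap2 f x y) v = F2 f (Str.fn x v) (Str.fn y v) := by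
  rw [Elem.ap2, fn_comp]
  exact congrArg (Str.fn f) (funext fun i => by fin_cases i <;> rfl)

theorem fn_num (k : ℕ) : Str.fn (.num k) v = (k : M) := by
  induction k with
  | zero =>
    rw [Elem.num, fn_comp, Nat.cast_zero]
    exact congrArg (Str.fn Elem.zero) (Subsingleton.elim _ _)
  | succ k ih => rw [Elem.num, fn_ap1, ih, F1_succ, Nat.cast_succ]

theorem F2_add (x y : M) : F2 .add x y = x + y := rfl
theorem F2_sub (x y : M) : F2 .sub x y = x - y := rfl
theorem F2_mul (x y : M) : F2 .mul x y = x * y := rfl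

open Classical in
theorem one_sub (x : M) : 1 - x = if x = 0 then 1 else 0 := by
  split_ifs with h
  · rw [h, sub_zero']
  · rw [tsub_eq_zero_of_le]
    exact (Arith.one_mul (1 : M)) ▸ by
      rcases eq_zero_or_succ x with h' | ⟨y, rfl⟩
      · exact (h h').elim
      · rw [one_mul]; exact le_add_left le_rfl

open Classical in
theorem fn_pos (x : Elem n) : Str.fn (.pos x) v = if Str.fn x v = 0 then 0 else 1 := by
  rw [Elem.pos, fn_ap2, fn_ap2, fn_num, F2_sub, F2_sub, Nat.cast_one, one_sub, one_sub]
  split_ifs with h₁ h₂ h₂ <;> simp_all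

open Classical in
theorem fn_cond (c x y : Elem n) :
    Str.fn (.cond c x y) v = if Str.fn c v = 0 then Str.fn y v else Str.fn x v := by
  rw [Elem.cond, fn_ap2, fn_ap2, fn_ap2, fn_ap2, fn_pos, fn_num, F2_sub, F2_mul, F2_mul, F2_add,
    Nat.cast_one, one_sub]
  split_ifs <;> simp

open Classical in
theorem fn_ltC (x y : Elem n) :
    Str.fn (.ltC x y) v = if Str.fn x v < Str.fn y v then 1 else 0 := by
  rw [Elem.ltC, fn_ap2, fn_ap2, fn_ap1, fn_num, F2_sub, F2_sub, F1_succ, Nat.cast_one, one_sub]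
  simp only [tsub_eq_zero_iff_le, succ_le_iff]

open Classical in
theorem fn_eqC (x y : Elem n) :
    Str.fn (.eqC x y) v = if Str.fn x v = Str.fn y v then 1 else 0 := by
  rw [Elem.eqC, fn_ap2, fn_ap2, fn_ap2, fn_ap2, fn_num, F2_sub, F2_sub, F2_sub, F2_add,
    Nat.cast_one, one_sub]
  have : Str.fn x v - Str.fn y v + (Str.fn y v - Str.fn x v) = 0 ↔ Str.fn x v = Str.fn y v := by
    rw [add_eq_zero, tsub_eq_zero_iff_le, tsub_eq_zero_iff_le, ← le_antisymm_iff]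
  simp only [this]

open Classical in
theorem fn_andC (x y : Elem n) :
    Str.fn (.andC x y) v = if Str.fn x v ≠ 0 ∧ Str.fn y v ≠ 0 then 1 else 0 := by
  rw [Elem.andC, fn_pos, fn_ap2, F2_mul]
  simp only [mul_eq_zero]
  split_ifs <;> simp_all

end Eval

/-! ### Division, square roots and pairs -/

theorem ite_ite_one {α : Type} (c : Prop) [Decidable c] [Decidable ((if c then (1 : M) else 0) = 0)]
    (a b : α) : (if (if c then (1 : M) else 0) = 0 then a else b) = if c then b else a := by
  by_cases h : c <;> simp [h]

theorem div_spec (x y : M) (hy : 0 < y) :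
    F2 .div x y * y ≤ x ∧ x < (F2 .div x y + 1) * y ∧ F2 .div x y ≤ x := by
  refine ind (fun x => F2 .div x y * y ≤ x ∧ x < (F2 .div x y + 1) * y ∧ F2 .div x y ≤ x)
    ?_ (fun x ih => ?_) x
  · have h : F2 .div 0 y = 0 := by
      rw [F2, Elem.div, fn_brec_zero, cut_eq, fn_num]
      simp
    rw [h]
    simpa using hy
  · obtain ⟨h₁, h₂, h₃⟩ := ih
    have h : F2 .div (x + 1) y =
        min (if x + 1 < y * (F2 .div x y + 1) then F2 .div x y else F2 .div x y + 1) (x + 1) := by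
      rw [F2, Elem.div, ← F1_succ, fn_brec_succ, cut_eq, fn_cond, fn_ltC]
      simp only [fn_ap1, fn_ap2, fn_proj, F1_succ, F2_mul, ← Elem.div.eq_1]
      rw [ite_ite_one]
      rfl
    rw [h]
    generalize F2 .div x y = d at *
    split_ifs with hd
    · rw [min_eq_left (h₃.trans (le_add_right le_rfl))]
      refine ⟨h₁.trans (le_add_right le_rfl), by rwa [mul_comm], h₃.trans (le_add_right le_rfl)⟩
    · rw [min_eq_left (by gcongr)]
      rw [not_lt, mul_comm] at hd
      refine ⟨hd, ?_, by gcongr⟩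
      rw [add_one_mul]
      exact add_lt_add_of_lt_of_le h₂ (by simpa using succ_le_iff.2 hy)

theorem div_eq {x y d : M} (h₁ : d * y ≤ x) (h₂ : x < (d + 1) * y) : F2 .div x y = d := by
  have hy : 0 < y := by
    by_contra h
    have : y = 0 := le_antisymm (not_lt.1 h) zero_le
    rw [this] at h₂
    simp at h₂
  obtain ⟨h₃, h₄, -⟩ := div_spec x y hy
  refine le_antisymm (lt_succ_iff.1 ?_) (lt_succ_iff.1 ?_)
  · exact lt_of_mul_lt_mul_right (h₃.trans_lt h₂) zero_le
  · exact lt_of_mul_lt_mul_right (h₁.trans_lt h₄) zero_le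

theorem sqrt_spec (x : M) :
    F1 .sqrt x * F1 .sqrt x ≤ x ∧ x < (F1 .sqrt x + 1) * (F1 .sqrt x + 1) ∧ F1 .sqrt x ≤ x := by
  refine ind (fun x => F1 .sqrt x * F1 .sqrt x ≤ x ∧
    x < (F1 .sqrt x + 1) * (F1 .sqrt x + 1) ∧ F1 .sqrt x ≤ x) ?_ (fun x ih => ?_) x
  · have h : F1 .sqrt (0 : M) = 0 := by
      rw [F1, Elem.sqrt, fn_brec_zero, cut_eq, fn_num]
      simp
    rw [h]
    simp
  · obtain ⟨h₁, h₂, h₃⟩ := ih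
    have h : F1 .sqrt (x + 1) = min (if x + 1 < (F1 .sqrt x + 1) * (F1 .sqrt x + 1) then F1 .sqrt x
        else F1 .sqrt x + 1) (x + 1) := by
      rw [F1, Elem.sqrt, ← F1_succ, fn_brec_succ, cut_eq, fn_cond, fn_ltC]
      simp only [fn_ap1, fn_ap2, fn_proj, F1_succ, F2_mul, ← Elem.sqrt.eq_1]
      rw [ite_ite_one]
      rfl
    rw [h]
    generalize F1 .sqrt x = d at *
    split_ifs with hd
    · rw [min_eq_left (h₃.trans (le_add_right le_rfl))]
      exact ⟨h₁.trans (le_add_right le_rfl), hd, h₃.trans (le_add_right le_rfl)⟩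
    · rw [min_eq_left (by gcongr)]
      refine ⟨not_lt.1 hd, ?_, by gcongr⟩
      have h0 : (0 : M) ≤ d := zero_le
      have h1 := succ_le_iff.2 h₂
      have : (d + 1 + 1) * (d + 1 + 1) = (d + 1) * (d + 1) + (2 * d + 2) + 1 := by ring
      rw [this, lt_succ_iff]
      exact h1.trans (le_add_right le_rfl)

theorem sqrt_eq {x d : M} (h₁ : d * d ≤ x) (h₂ : x < (d + 1) * (d + 1)) : F1 .sqrt x = d := by
  obtain ⟨h₃, h₄, -⟩ := sqrt_spec x
  have key : ∀ a b : M, a * a < (b + 1) * (b + 1) → a ≤ b := fun a b h => by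
    by_contra hab
    have := succ_le_iff.2 (not_le.1 hab)
    exact absurd (mul_le_mul' this this) (not_le.2 h)
  exact le_antisymm (key _ _ (h₃.trans_lt h₂)) (key _ _ (h₁.trans_lt h₄))

/-- The code of a pair. -/
abbrev pr (x y : M) : M := F2 .pair x y

/-- The first component of a pair. -/
abbrev fs (x : M) : M := F1 .fst x

/-- The second component of a pair. -/
abbrev sn (x : M) : M := F1 .snd x

theorem pr_eq (x y : M) : pr x y = if x < y then y * y + x else x * x + x + y := by
  rw [pr, F2, Elem.pair, fn_cond, fn_ltC]
  simp only [fn_ap2, fn_proj, F2_mul, F2_add]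
  by_cases h : x < y <;> simp [h]

theorem fn_sqrtRem (x : M) : Str.fn .sqrtRem ![x] = x - F1 .sqrt x * F1 .sqrt x := by
  rw [Elem.sqrtRem, fn_ap2, fn_ap2, fn_proj]
  rfl

theorem fs_eq (x : M) : fs x =
    if x - F1 .sqrt x * F1 .sqrt x < F1 .sqrt x then x - F1 .sqrt x * F1 .sqrt x
      else F1 .sqrt x := by
  rw [fs, F1, Elem.fst, fn_cond, fn_ltC, fn_sqrtRem, ite_ite_one]
  rfl

theorem sn_eq (x : M) : sn x =
    if x - F1 .sqrt x * F1 .sqrt x < F1 .sqrt x then F1 .sqrt x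
      else x - F1 .sqrt x * F1 .sqrt x - F1 .sqrt x := by
  rw [sn, F1, Elem.snd, fn_cond, fn_ltC, fn_ap2, fn_sqrtRem, ite_ite_one]
  rfl

theorem sqrt_pr (x y : M) : F1 .sqrt (pr x y) = max x y := by
  rw [pr_eq]
  have hx : (0 : M) ≤ x := zero_le
  have hy : (0 : M) ≤ y := zero_le
  split_ifs with h
  · rw [max_eq_right h.le]
    refine sqrt_eq (le_add_right le_rfl) ?_
    have : (y + 1) * (y + 1) = y * y + (y + y + 1) := by ring
    rw [this, add_lt_add_iff_left, lt_succ_iff]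
    exact h.le.trans (le_add_right le_rfl)
  · rw [not_lt] at h
    rw [max_eq_left h]
    refine sqrt_eq (by rw [add_assoc]; exact le_add_right le_rfl) ?_
    have : (x + 1) * (x + 1) = x * x + x + x + 1 := by ring
    rw [this, lt_succ_iff]
    gcongr

@[simp] theorem fs_pr (x y : M) : fs (pr x y) = x := by
  rw [fs_eq, sqrt_pr, pr_eq]
  split_ifs with h h' h' h'
  · rw [max_eq_right h.le, add_tsub_cancel_left]
  · rw [max_eq_right h.le, add_tsub_cancel_left] at h'
    exact (h' h).elim
  · rw [max_eq_left (not_lt.1 h), add_assoc, add_tsub_cancel_left] at h'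
    exact absurd h' (not_lt.2 (le_add_right le_rfl))
  · rw [max_eq_left (not_lt.1 h)]

@[simp] theorem sn_pr (x y : M) : sn (pr x y) = y := by
  rw [sn_eq, sqrt_pr, pr_eq]
  split_ifs with h h' h' h'
  · rw [max_eq_right h.le]
  · rw [max_eq_right h.le, add_tsub_cancel_left] at h'
    exact (h' h).elim
  · rw [max_eq_left (not_lt.1 h), add_assoc, add_tsub_cancel_left] at h'
    exact absurd h' (not_lt.2 (le_add_right le_rfl))
  · rw [max_eq_left (not_lt.1 h), add_assoc, add_tsub_cancel_left, add_tsub_cancel_left]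

theorem pr_fs_sn (x : M) : pr (fs x) (sn x) = x := by
  rw [fs_eq, sn_eq]
  obtain ⟨h₁, h₂, -⟩ := sqrt_spec x
  generalize F1 .sqrt x = s at *
  obtain ⟨r, rfl⟩ := exists_add_of_le h₁
  rw [add_tsub_cancel_left]
  have hr : r ≤ s + s := by
    have : (s + 1) * (s + 1) = s * s + (s + s + 1) := by ring
    rw [this, add_lt_add_iff_left, lt_succ_iff] at h₂
    exact h₂
  split_ifs with h
  · rw [pr_eq, if_pos h]
  · obtain ⟨q, rfl⟩ := exists_add_of_le (not_lt.1 h)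
    rw [add_tsub_cancel_left, pr_eq, if_neg (not_lt.2 (by simpa using hr)), add_assoc]

theorem le_pr_left (x y : M) : x ≤ pr x y := by
  rw [pr_eq]
  split_ifs
  · exact le_add_left le_rfl
  · rw [add_assoc, add_left_comm]
    exact le_add_right le_rfl

theorem le_pr_right (x y : M) : y ≤ pr x y := by
  rw [pr_eq]
  split_ifs with h
  · refine le_add_right ?_
    have : 1 ≤ y := by simpa using succ_le_iff.2 (lt_of_le_of_lt zero_le h)
    simpa using mul_le_mul' this (le_refl y)
  · exact le_add_left le_rfl

theorem pr_lt_pr_right (x : M) {y y' : M} (h : y < y') : pr x y < pr x y' := by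
  rw [pr_eq, pr_eq]
  by_cases h₁ : x < y
  · rw [if_pos h₁, if_pos (h₁.trans h)]
    have := mul_lt_mul'' h h zero_le zero_le
    gcongr
  · rw [if_neg h₁]
    by_cases h₂ : x < y'
    · rw [if_pos h₂]
      have h3 := succ_le_iff.2 h₂
      have h4 := mul_le_mul' h3 h3
      have : (x + 1) * (x + 1) = x * x + x + x + 1 := by ring
      rw [this] at h4
      exact (add_le_add_right (not_lt.1 h₁) _).trans_lt
        ((lt_succ_iff.2 le_rfl).trans_le (h4.trans (le_add_right le_rfl)))
    · rw [if_neg h₂]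
      gcongr

end Arithmetic

section Recursion

variable {M : Type} [Str AccOp M] [IDModel M]

/-! ### Powers of `4` and digits -/

/-- Powers of `4`. -/
abbrev q (x : M) : M := F1 .exp4 x

theorem q_eq (x : M) : q x = F1 .exp (x + x) := by
  rw [q, F1, Elem.exp4, fn_ap1, fn_ap2, fn_proj]
  rfl

theorem exp_zero : F1 .exp (0 : M) = 1 := by
  rw [F1_exp_zero, F1_succ, zero_add]

theorem exp_succ (x : M) : F1 .exp (x + 1) = F1 .exp x + F1 .exp x := by
  rw [← F1_succ, F1_exp_succ]
  rfl

theorem q_zero : q (0 : M) = 1 := by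
  rw [q_eq, add_zero, exp_zero]

theorem q_succ (x : M) : q (x + 1) = 4 * q x := by
  rw [q_eq, q_eq, show x + 1 + (x + 1) = x + x + 1 + 1 by ring, exp_succ, exp_succ]
  ring

theorem q_add (x y : M) : q (x + y) = q x * q y :=
  ind (fun y => q (x + y) = q x * q y) (by rw [add_zero, q_zero, mul_one])
    (fun y ih => by rw [← add_assoc, q_succ, q_succ, ih]; ring) y

theorem q_pos (x : M) : 0 < q x :=
  ind (fun x : M => 0 < q x) (by rw [q_zero]; exact zero_lt_one)
    (fun x ih => by rw [q_succ]; exact mul_pos zero_lt_four ih) x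

theorem digit_eq (t i : M) :
    F2 .digit t i = F2 .div t (q i) - 4 * F2 .div (F2 .div t (q i)) 4 := by
  rw [F2, Elem.digit]
  simp only [fn_ap1, fn_ap2, fn_num, fn_proj]
  rfl

theorem digit_of_eq {t i a b r : M} (h : t = r + (b + 4 * a) * q i) (hr : r < q i) (hb : b < 4) :
    F2 .digit t i = b := by
  have h₁ : F2 .div t (q i) = b + 4 * a := by
    refine div_eq (h ▸ le_add_left le_rfl) ?_
    rw [h, add_one_mul, add_comm]
    gcongr
  have h₂ : F2 .div (b + 4 * a) 4 = a := by
    refine div_eq (by rw [mul_comm]; exact le_add_left le_rfl) ?_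
    rw [add_one_mul, mul_comm a, add_comm]
    gcongr
  rw [digit_eq, h₁, h₂, add_tsub_cancel_right]

theorem digit_add (t i a : M) : F2 .digit (t + 4 * a * q i) i = F2 .digit t i := by
  obtain ⟨h₁, h₂, -⟩ := div_spec t (q i) (q_pos i)
  obtain ⟨r, hr⟩ := exists_add_of_le h₁
  set d := F2 .div t (q i)
  obtain ⟨h₃, h₄, -⟩ := div_spec d 4 zero_lt_four
  obtain ⟨b, hb⟩ := exists_add_of_le h₃
  set e := F2 .div d 4
  have hr' : r < q i := by
    rw [hr, add_one_mul] at h₂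
    exact lt_of_add_lt_add_left h₂
  have hb' : b < 4 := by
    rw [hb, add_one_mul] at h₄
    exact lt_of_add_lt_add_left h₄
  rw [digit_of_eq (t := t) (a := e) (b := b) (r := r) (by rw [hr, hb]; ring) hr' hb',
    digit_of_eq (t := t + _) (a := e + a) (b := b) (r := r) (by rw [hr, hb]; ring) hr' hb']

/-! ### Course-of-values recursion -/

instance TF.cons1 {n : ℕ} (f : Elem (n + 1)) (a : Env M → M) [ha : TF a] (v : Fin n → M) :
    TF fun ρ => Str.fn f (Matrix.vecCons (a ρ) v) := by
  have := TF.fn f (Matrix.vecCons a fun i _ => v i) (h := Fin.cons ha fun i => TF.const _)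
  convert this using 3 with ρ
  funext i
  refine Fin.cases rfl (fun i => rfl) i

instance TF.cons2 {n : ℕ} (f : Elem (n + 2)) (a b : Env M → M) [ha : TF a] [hb : TF b]
    (v : Fin n → M) :
    TF fun ρ => Str.fn f (Matrix.vecCons (a ρ) (Matrix.vecCons (b ρ) v)) := by
  have := TF.fn f (Matrix.vecCons a (Matrix.vecCons b fun i _ => v i))
    (h := Fin.cons ha (Fin.cons hb fun i => TF.const _))
  convert this using 3 with ρ
  funext i
  refine Fin.cases rfl (fun i => Fin.cases rfl (fun i => rfl) i) i

section Table

variable {n : ℕ} (c : Elem (n + 2)) (v : Fin n → M)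

/-- The table of the values below `z` of the recursion with step function `c`. -/
abbrev tab (z : M) : M := Str.fn (.table c) (Matrix.vecCons z v)

/-- The value at `z` of the recursion with step function `c`. -/
abbrev tabStep (z : M) : M := Str.fn c (Matrix.vecCons z (Matrix.vecCons (tab c v z) v))

theorem table_spec (hc : ∀ z t : M, Str.fn c (Matrix.vecCons z (Matrix.vecCons t v)) < 4) (z : M) :
    tab c v z < q z ∧ tab c v (z + 1) = tab c v z + tabStep c v z * q z := by
  have h₀ : tab c v 0 = 0 := by
    rw [tab, Elem.table, fn_brec_zero, cut_eq, fn_num, Nat.cast_zero]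
    exact min_eq_left zero_le
  have hs (z : M) (h : tab c v z < q z) :
      tab c v (z + 1) = tab c v z + tabStep c v z * q z ∧ tab c v (z + 1) < q (z + 1) := by
    have h' : tab c v z + tabStep c v z * q z < q (z + 1) := by
      rw [q_succ]
      calc tab c v z + tabStep c v z * q z < q z + tabStep c v z * q z := by gcongr
        _ = (tabStep c v z + 1) * q z := by ring
        _ ≤ 4 * q z := by
          gcongr
          exact succ_le_iff.2 (hc _ _)
    have e : tab c v (z + 1) = min (tab c v z + tabStep c v z * q z) (q (z + 1)) := by
      conv_lhs => rw [tab, Elem.table, ← F1_succ, fn_brec_succ, cut_eq, ← Elem.table]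
      simp only [fn_ap1, fn_ap2, fn_proj, F1_succ]
      rfl
    rw [e, min_eq_left h'.le]
    exact ⟨rfl, h'⟩
  have : tab c v z < q z := ind (fun z => tab c v z < q z)
    (by rw [h₀]; exact q_pos 0) (fun z h => (hs z h).2) z
  exact ⟨this, (hs z this).1⟩

theorem digit_table (hc : ∀ z t : M, Str.fn c (Matrix.vecCons z (Matrix.vecCons t v)) < 4)
    {i z : M} (h : i < z) : F2 .digit (tab c v z) i = tabStep c v i := by
  obtain ⟨d, rfl⟩ := exists_add_of_le (succ_le_iff.2 h)
  refine ind (fun d => F2 .digit (tab c v (i + 1 + d)) i = tabStep c v i) ?_ (fun d ih => ?_) d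
  · rw [add_zero, (table_spec c v hc i).2]
    exact digit_of_eq (a := 0) (by rw [mul_zero, add_zero]) (table_spec c v hc i).1 (hc _ _)
  · rw [← add_assoc, (table_spec c v hc _).2, ← ih, q_add, q_succ,
      show ∀ x : M, x * (4 * q i * q d) = 4 * (x * q d) * q i by intro x; ring, digit_add]

theorem fn_covRec (z : M) : Str.fn (.covRec c) (Matrix.vecCons z v) = tabStep c v z := by
  rw [Elem.covRec, fn_comp]
  refine congrArg (Str.fn c) (funext fun i => ?_)
  refine Fin.cases ?_ (fun i => Fin.cases ?_ (fun i => ?_) i) i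
  · exact fn_proj _ _
  · rfl
  · exact fn_proj _ _

/-- Recursion equation for a function given by course-of-values recursion. -/
theorem covRec_digit (hc : ∀ z t : M, Str.fn c (Matrix.vecCons z (Matrix.vecCons t v)) < 4)
    {i z : M} (h : i < z) :
    F2 .digit (tab c v z) i = Str.fn (.covRec c) (Matrix.vecCons i v) := by
  rw [digit_table c v hc h, fn_covRec]

end Table

end Recursion

section Arith

/-- Formulas without predicate constants. -/
def Arith (A : Fm AccOp) : Prop := Polarity true A ∧ Polarity false A

instance : SubstClosed Arith := ⟨fun h τ => ⟨Polarity.subst h.1 τ, Polarity.subst h.2 τ⟩⟩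

variable {M : Type} [Str AccOp M]

instance (priority := 100) Df.arith_of_delta0 (P : Env M → Prop) [hP : Df Delta0 P] : Df Arith P :=
  hP.mono fun _ h => ⟨h.polarity _, h.polarity _⟩

instance Df.arith_imp (P Q : Env M → Prop) [hP : Df Arith P] [hQ : Df Arith Q] :
    Df Arith fun ρ => P ρ → Q ρ := Df.imp' (fun _ _ h h' => ⟨⟨h.2, h'.1⟩, h.1, h'.2⟩) hP hQ

instance Df.arith_not (P : Env M → Prop) [hP : Df Arith P] : Df Arith fun ρ => ¬ P ρ :=
  Df.arith_imp P fun _ => False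

instance Df.arith_and (P Q : Env M → Prop) [hP : Df Arith P] [hQ : Df Arith Q] :
    Df Arith fun ρ => P ρ ∧ Q ρ :=
  (Df.arith_not fun ρ => P ρ → ¬ Q ρ).congr fun ρ => by tauto

instance Df.arith_or (P Q : Env M → Prop) [hP : Df Arith P] [hQ : Df Arith Q] :
    Df Arith fun ρ => P ρ ∨ Q ρ :=
  (Df.arith_imp (fun ρ => ¬ P ρ) Q).congr fun ρ => by tauto

instance Df.arith_iff (P Q : Env M → Prop) [hP : Df Arith P] [hQ : Df Arith Q] :
    Df Arith fun ρ => P ρ ↔ Q ρ :=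
  (Df.arith_and (fun ρ => P ρ → Q ρ) fun ρ => Q ρ → P ρ).congr fun ρ => by tauto

instance Df.arith_all (P : M → Env M → Prop)
    [hP : Df Arith fun ρ : Env M => P (ρ 0) fun i => ρ (i + 1)] :
    Df Arith fun ρ => ∀ x, P x ρ := Df.all' (K := Arith) (fun _ h => h) hP

instance Df.arith_ex (P : M → Env M → Prop)
    [hP : Df Arith fun ρ : Env M => P (ρ 0) fun i => ρ (i + 1)] :
    Df Arith fun ρ => ∃ x, P x ρ :=
  (Df.arith_not fun ρ => ∀ x, ¬ P x ρ).congr fun ρ => by push Not; rfl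

end Arith

section Codes

variable {M : Type} [Str AccOp M] [IDModel M]

theorem arith_ind (P : M → Prop) [hP : Df Arith fun ρ : Env M => P (ρ 0)]
    (h : ∀ x, (∀ y, y < x → P y) → P x) (x : M) : P x :=
  strong_ind P (hP := hP.mono fun _ h => h.1) h x

theorem pr_lt_pr_left {x x' : M} (h : x < x') (y : M) : pr x y < pr x' y := by
  rw [pr_eq, pr_eq]
  by_cases h₁ : x' < y
  · rw [if_pos h₁, if_pos (h.trans h₁)]
    gcongr
  · rw [if_neg h₁]
    have := not_lt.1 h₁
    split_ifs with h₂
    · calc y * y + x < y * y + x' := by gcongr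
        _ ≤ x' * x' + x' := by gcongr
        _ ≤ _ := le_add_right le_rfl
    · have := mul_le_mul' h.le h.le
      gcongr

theorem pr_lt_pr {x x' y y' : M} (h : x < x') (h' : y < y') : pr x y < pr x' y' :=
  (pr_lt_pr_left h y).trans (pr_lt_pr_right x' h')

/-! ### Codes of terms -/

/-- The code of the term with kind `k`, argument `a` and rest `b`. -/
def nd (k a b : M) : M := pr (pr k a) b + 1

/-- The kind of a term. -/
def kd (x : M) : M := fs (fs (F1 .pred x))

/-- The argument of the first summand. -/
def ag (x : M) : M := sn (fs (F1 .pred x))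

/-- The term without its first summand. -/
def rs (x : M) : M := sn (F1 .pred x)

instance (f g h : Env M → M) [TF f] [TF g] [TF h] : TF fun ρ => nd (f ρ) (g ρ) (h ρ) := by
  unfold nd pr; infer_instance

instance (f : Env M → M) [TF f] : TF fun ρ => ag (f ρ) := by unfold ag fs sn; infer_instance
@[simp] theorem kd_nd (k a b : M) : kd (nd k a b) = k := by
  rw [kd, nd, pred_succ, fs_pr, fs_pr]

@[simp] theorem ag_nd (k a b : M) : ag (nd k a b) = a := by
  rw [ag, nd, pred_succ, fs_pr, sn_pr]

@[simp] theorem rs_nd (k a b : M) : rs (nd k a b) = b := by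
  rw [rs, nd, pred_succ, sn_pr]

@[simp] theorem nd_ne_zero (k a b : M) : nd k a b ≠ 0 := by
  rw [nd, ← F1_succ]
  exact F1_succ_ne _

theorem nd_surj {x : M} (hx : x ≠ 0) : nd (kd x) (ag x) (rs x) = x := by
  obtain ⟨y, rfl⟩ := (eq_zero_or_succ x).resolve_left hx
  rw [nd, kd, ag, rs, pred_succ, pr_fs_sn, pr_fs_sn]

theorem nd_cases (x : M) : x = 0 ∨ ∃ k a b, x = nd k a b := by
  by_cases hx : x = 0
  · exact .inl hx
  · exact .inr ⟨_, _, _, (nd_surj hx).symm⟩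

@[simp] theorem nd_inj {k a b k' a' b' : M} :
    nd k a b = nd k' a' b' ↔ k = k' ∧ a = a' ∧ b = b' := by
  refine ⟨fun h => ⟨?_, ?_, ?_⟩, fun ⟨h₁, h₂, h₃⟩ => by rw [h₁, h₂, h₃]⟩
  · simpa using congrArg kd h
  · simpa using congrArg ag h
  · simpa using congrArg rs h

theorem arg_lt_nd (k a b : M) : a < nd k a b :=
  lt_succ_iff.2 ((le_pr_right k a).trans (le_pr_left _ b))

theorem rest_lt_nd (k a b : M) : b < nd k a b := lt_succ_iff.2 (le_pr_right _ b)

theorem nd_lt_nd (k a : M) {b b' : M} (h : b < b') : nd k a b < nd k a b' := by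
  rw [nd, nd, add_lt_add_iff_right]
  exact pr_lt_pr_right _ h

theorem nd_le_nd (k a : M) {b b' : M} (h : b ≤ b') : nd k a b ≤ nd k a b' := by
  rcases h.eq_or_lt with rfl | h
  · exact le_rfl
  · exact (nd_lt_nd k a h).le

/-- Induction on codes. -/
theorem code_ind (P : M → Prop) [hP : Df Arith fun ρ : Env M => P (ρ 0)] (h₀ : P 0)
    (h : ∀ k a b, P a → P b → P (nd k a b)) (x : M) : P x := by
  refine arith_ind P (fun x ih => ?_) x
  obtain rfl | ⟨k, a, b, rfl⟩ := nd_cases x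
  · exact h₀
  · exact h k a b (ih a (arg_lt_nd _ _ _)) (ih b (rest_lt_nd _ _ _))

section Eval

variable {n : ℕ} (v : Fin n → M)

theorem fn_kind (x : Elem n) : Str.fn (.kind x) v = kd (Str.fn x v) := by
  rw [Elem.kind, fn_ap1, fn_ap1, fn_ap1]; rfl

theorem fn_arg (x : Elem n) : Str.fn (.arg x) v = ag (Str.fn x v) := by
  rw [Elem.arg, fn_ap1, fn_ap1, fn_ap1]; rfl

theorem fn_rest (x : Elem n) : Str.fn (.rest x) v = rs (Str.fn x v) := by
  rw [Elem.rest, fn_ap1, fn_ap1]; rfl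

theorem fn_node (k a b : Elem n) :
    Str.fn (.node k a b) v = nd (Str.fn k v) (Str.fn a v) (Str.fn b v) := by
  rw [Elem.node, fn_ap1, fn_ap2, fn_ap2, F1_succ]; rfl

end Eval

theorem digit_lt (t i : M) : F2 .digit t i < 4 := by
  rw [digit_eq]
  obtain ⟨h₁, h₂, -⟩ := div_spec (F2 .div t (q i)) 4 zero_lt_four
  rw [mul_comm]
  obtain ⟨c, hc⟩ := exists_add_of_le h₁
  rw [add_one_mul] at h₂
  generalize F2 .div (F2 .div t (q i)) 4 = d at *
  rw [hc] at h₂ ⊢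
  rw [add_tsub_cancel_left]
  exact lt_of_add_lt_add_left h₂

theorem one_lt_four' : (1 : M) < 4 := by
  have h : (1 : M) + 1 + 1 + 1 = 4 := by norm_num
  rw [← h, lt_succ_iff, add_assoc]
  exact le_add_right le_rfl

theorem two_lt_four' : (2 : M) < 4 := by
  have h : (2 : M) + 1 + 1 = 4 := by norm_num
  rw [← h, lt_succ_iff]
  exact le_add_right le_rfl

/-! ### Comparison of codes -/

open Classical in
theorem fn_cmpStep (z t : M) : Str.fn .cmpStep ![z, t] =
    if fs z = 0 then (if sn z = 0 then 1 else 0) else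
    if sn z = 0 then 2 else
    if kd (fs z) < kd (sn z) then 0 else
    if kd (sn z) < kd (fs z) then 2 else
    if F2 .digit t (pr (ag (fs z)) (ag (sn z))) = 1 then F2 .digit t (pr (rs (fs z)) (rs (sn z)))
    else F2 .digit t (pr (ag (fs z)) (ag (sn z))) := by
  rw [Elem.cmpStep]
  simp only [fn_cond, fn_ltC, fn_eqC, fn_kind, fn_arg, fn_rest, fn_ap1, fn_ap2, fn_num, fn_proj,
    ite_ite_one, Nat.cast_zero, Nat.cast_one, Nat.cast_ofNat]
  rfl

theorem cmpStep_lt (z t : M) : Str.fn .cmpStep ![z, t] < 4 := by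
  rw [fn_cmpStep]
  split_ifs <;> first | exact one_lt_four' | exact zero_lt_four | exact two_lt_four' | exact digit_lt _ _

theorem cmp_eq_covRec (x y : M) : F2 .cmp x y = F1 (.covRec .cmpStep) (pr x y) := by
  rw [F2, Elem.cmp, fn_ap1]
  rfl

open Classical in
theorem cmp_eq (x y : M) : F2 .cmp x y =
    if x = 0 then (if y = 0 then 1 else 0) else
    if y = 0 then 2 else
    if kd x < kd y then 0 else
    if kd y < kd x then 2 else
    if F2 .cmp (ag x) (ag y) = 1 then F2 .cmp (rs x) (rs y) else F2 .cmp (ag x) (ag y) := by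
  rw [cmp_eq_covRec, F1]
  refine (fn_covRec .cmpStep ![] (pr x y)).trans ((fn_cmpStep _ _).trans ?_)
  simp only [fs_pr, sn_pr]
  by_cases hx : x = 0
  · simp only [hx, if_true]
  by_cases hy : y = 0
  · simp only [hx, hy, if_true, if_false]
  have e {u w : M} (hu : u < x) (hw : w < y) :
      F2 .digit (tab .cmpStep ![] (pr x y)) (pr u w) = F2 .cmp u w := by
    rw [covRec_digit _ _ (fun z t => cmpStep_lt z t) (pr_lt_pr hu hw), cmp_eq_covRec]
    rfl
  have h₁ : ag x < x := by conv_rhs => rw [← nd_surj hx]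
                           exact arg_lt_nd _ _ _
  have h₂ : ag y < y := by conv_rhs => rw [← nd_surj hy]
                           exact arg_lt_nd _ _ _
  have h₃ : rs x < x := by conv_rhs => rw [← nd_surj hx]
                           exact rest_lt_nd _ _ _
  have h₄ : rs y < y := by conv_rhs => rw [← nd_surj hy]
                           exact rest_lt_nd _ _ _
  rw [e h₁ h₂, e h₃ h₄]

/-- The comparison of codes, irrespective of normal forms. -/
def Sl (x y : M) : Prop := F2 .cmp x y = 0

infix:50 " ≺ " => Sl

instance (f g : Env M → M) [TF f] [TF g] : Df Delta0 fun ρ => f ρ ≺ g ρ := by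
  unfold Sl; infer_instance

theorem cmp_zero_zero : F2 .cmp (0 : M) 0 = 1 := by rw [cmp_eq]; simp
theorem cmp_zero_nd (k a b : M) : F2 .cmp 0 (nd k a b) = 0 := by rw [cmp_eq]; simp
theorem cmp_nd_zero (k a b : M) : F2 .cmp (nd k a b) 0 = 2 := by rw [cmp_eq]; simp

open Classical in
theorem cmp_nd_nd (k a b k' a' b' : M) : F2 .cmp (nd k a b) (nd k' a' b') =
    if k < k' then 0 else if k' < k then 2 else
    if F2 .cmp a a' = 1 then F2 .cmp b b' else F2 .cmp a a' := by
  conv_lhs => rw [cmp_eq]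
  simp only [nd_ne_zero, if_false, kd_nd, ag_nd, rs_nd]

theorem two_ne_one' : (2 : M) ≠ 1 := by
  have h : (1 : M) + 1 = 2 := by norm_num
  rw [← h]
  exact (lt_succ_iff.2 (le_refl (1 : M))).ne'

theorem two_ne_zero' : (2 : M) ≠ 0 := by
  have h : (1 : M) + 1 = 2 := by norm_num
  rw [← h]
  exact (lt_succ_iff.2 (zero_le (a := (1 : M)))).ne'

theorem cmp_spec (x : M) : ∀ y, (F2 .cmp x y = 1 ↔ x = y) ∧
    (F2 .cmp x y = 0 ∨ x = y ∨ F2 .cmp x y = 2) ∧ (F2 .cmp x y = 2 ↔ F2 .cmp y x = 0) ∧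
    (F2 .cmp x y = 0 ↔ F2 .cmp y x = 2) := by
  refine code_ind (fun x => ∀ y, (F2 .cmp x y = 1 ↔ x = y) ∧
    (F2 .cmp x y = 0 ∨ x = y ∨ F2 .cmp x y = 2) ∧ (F2 .cmp x y = 2 ↔ F2 .cmp y x = 0) ∧
    (F2 .cmp x y = 0 ↔ F2 .cmp y x = 2))
    (fun y => ?_) (fun k a b iha ihb y => ?_) x
  · obtain rfl | ⟨k, a, b, rfl⟩ := nd_cases y
    · simp [cmp_zero_zero, two_ne_one'.symm]
    · simp [cmp_zero_nd, cmp_nd_zero, two_ne_zero'.symm, (nd_ne_zero k a b).symm]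
  · obtain rfl | ⟨k', a', b', rfl⟩ := nd_cases y
    · simp [cmp_zero_nd, cmp_nd_zero]
    · obtain ⟨a₁, a₂, a₃, a₅⟩ := iha a'
      obtain ⟨b₁, b₂, b₃, b₅⟩ := ihb b'
      rw [cmp_nd_nd, cmp_nd_nd, nd_inj]
      have a₄ : F2 .cmp a' a = 1 ↔ a = a' := by
        refine ⟨fun h => ?_, fun h => h ▸ a₁.2 h⟩
        rcases a₂ with h' | h' | h'
        · exact (two_ne_one' ((a₅.1 h').symm.trans h)).elim
        · exact h'
        · exact (zero_ne_one ((a₃.1 h').symm.trans h)).elim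
      rcases lt_trichotomy k k' with h | rfl | h
      · simp only [if_pos h, if_neg h.not_gt, h.ne, false_and, true_or, zero_ne_one,
          two_ne_zero'.symm, two_ne_zero', and_self, iff_self]
      · simp only [lt_irrefl, if_false]
        by_cases ha : a = a'
        · rw [if_pos (a₁.2 ha), if_pos (a₄.2 ha)]
          simp only [ha, true_and]
          exact ⟨b₁, b₂, b₃, b₅⟩
        · rw [if_neg (a₁.not.2 ha), if_neg (a₄.not.2 ha)]
          exact ⟨iff_of_false (a₁.not.2 ha) fun h => ha h.2.1,
            a₂.imp_right (Or.imp_left fun h => (ha h).elim), a₃, a₅⟩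
      · simp only [if_pos h, if_neg h.not_gt, h.ne', false_and, or_true, two_ne_one',
          two_ne_zero', two_ne_zero'.symm, and_self, iff_self]

theorem cmp_eq_one {x y : M} : F2 .cmp x y = 1 ↔ x = y := (cmp_spec x y).1

theorem cmp_eq_two {x y : M} : F2 .cmp x y = 2 ↔ y ≺ x := (cmp_spec x y).2.2.1

theorem sl_trichotomy (x y : M) : x ≺ y ∨ x = y ∨ y ≺ x :=
  (cmp_spec x y).2.1.imp_right (Or.imp_right (cmp_spec x y).2.2.1.1)

theorem sl_irrefl (x : M) : ¬ x ≺ x := fun h =>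
  zero_ne_one ((Eq.symm h).trans (cmp_eq_one.2 rfl))

theorem sl_asymm {x y : M} (h : x ≺ y) : ¬ y ≺ x := fun h' =>
  two_ne_zero' ((cmp_eq_two.2 h').symm.trans h)

theorem not_sl_zero (x : M) : ¬ x ≺ 0 := by
  obtain rfl | ⟨k, a, b, rfl⟩ := nd_cases x
  · exact sl_irrefl 0
  · rw [Sl, cmp_nd_zero]; exact two_ne_zero'

theorem zero_sl (k a b : M) : 0 ≺ nd k a b := cmp_zero_nd k a b

theorem sl_nd {k a b k' a' b' : M} : nd k a b ≺ nd k' a' b' ↔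
    k < k' ∨ k = k' ∧ (a ≺ a' ∨ a = a' ∧ b ≺ b') := by
  rw [Sl, cmp_nd_nd]
  rcases lt_trichotomy k k' with h | rfl | h
  · simp only [h, if_true, true_or]
  · simp only [lt_irrefl, if_false, cmp_eq_one, true_and, false_or]
    by_cases ha : a = a'
    · subst ha
      simp only [if_true, sl_irrefl, false_or, true_and]
      rfl
    · simp only [ha, if_false, false_and, or_false]
      rfl
  · simp only [h, h.not_gt, h.ne', two_ne_zero', if_true, if_false, false_and, or_self]

theorem sl_trans {x y z : M} (h : x ≺ y) (h' : y ≺ z) : x ≺ z := by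
  refine code_ind (fun x => ∀ y z, x ≺ y → y ≺ z → x ≺ z) (fun y z h h' => ?_)
    (fun k a b iha ihb y z h h' => ?_) x y z h h'
  · obtain rfl | ⟨k, a, b, rfl⟩ := nd_cases z
    · exact (not_sl_zero y h').elim
    · exact zero_sl _ _ _
  · obtain rfl | ⟨k₁, a₁, b₁, rfl⟩ := nd_cases y
    · exact (not_sl_zero _ h).elim
    obtain rfl | ⟨k₂, a₂, b₂, rfl⟩ := nd_cases z
    · exact (not_sl_zero _ h').elim
    rw [sl_nd] at *
    rcases h with h | ⟨rfl, h | ⟨rfl, h⟩⟩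
    · rcases h' with h' | ⟨rfl, h'⟩
      · exact .inl (h.trans h')
      · exact .inl h
    · rcases h' with h' | ⟨rfl, h' | ⟨rfl, h'⟩⟩
      · exact .inl h'
      · exact .inr ⟨rfl, .inl (iha _ _ h h')⟩
      · exact .inr ⟨rfl, .inl h⟩
    · rcases h' with h' | ⟨rfl, h' | ⟨rfl, h'⟩⟩
      · exact .inl h'
      · exact .inr ⟨rfl, .inl h'⟩
      · exact .inr ⟨rfl, .inr ⟨rfl, ihb _ _ h h'⟩⟩

theorem sl_of_not_of_sl {x y z : M} (h : ¬ y ≺ x) (h' : y ≺ z) : x ≺ z := by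
  rcases sl_trichotomy x y with h₁ | rfl | h₁
  · exact sl_trans h₁ h'
  · exact h'
  · exact (h h₁).elim

theorem sl_of_sl_of_not {x y z : M} (h : x ≺ y) (h' : ¬ z ≺ y) : x ≺ z := by
  rcases sl_trichotomy y z with h₁ | rfl | h₁
  · exact sl_trans h h₁
  · exact h
  · exact (h' h₁).elim

theorem not_sl_trans {x y z : M} (h : ¬ y ≺ x) (h' : ¬ z ≺ y) : ¬ z ≺ x := fun h₁ => by
  exact h (sl_of_not_of_sl h' h₁)

/-! ### Critical arguments and normal forms -/

/-- `G x ≺ a`. -/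
def Gl (x a : M) : Prop := F2 .gLt x a ≠ 0

/-- Codes of normal forms. -/
def Nf (x : M) : Prop := F1 .nf x ≠ 0

/-- The code of `Ω`. -/
def Om : M := nd 1 0 0

instance (f g : Env M → M) [TF f] [TF g] : Df Delta0 fun ρ => Gl (f ρ) (g ρ) := by
  unfold Gl; infer_instance

instance (f : Env M → M) [TF f] : Df Delta0 fun ρ => Nf (f ρ) := by unfold Nf; infer_instance

instance : TF fun _ : Env M => (Om : M) := TF.const _

open Classical in
theorem fn_smaller {n : ℕ} (v : Fin n → M) (x y : Elem n) :
    Str.fn (.smaller x y) v = if Str.fn x v ≺ Str.fn y v then 1 else 0 := by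
  rw [Elem.smaller, fn_eqC, fn_ap2, fn_num, Nat.cast_zero]
  exact if_congr Iff.rfl rfl rfl

open Classical in
theorem fn_gLtStep (x t a : M) : Str.fn .gLtStep ![x, t, a] =
    if x = 0 then 1 else
    if F2 .digit t (rs x) ≠ 0 ∧ (if kd x = 0 then (if (if ag x ≺ a then (1 : M) else 0) ≠ 0 ∧
        F2 .digit t (ag x) ≠ 0 then 1 else 0)
      else if kd x = 2 then F2 .digit t (ag x) else 1) ≠ 0 then 1 else 0 := by
  rw [Elem.gLtStep]
  simp only [fn_cond, fn_andC, fn_smaller, fn_eqC, fn_kind, fn_arg, fn_rest, fn_ap2, fn_num,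
    fn_proj, ite_ite_one, Nat.cast_zero, Nat.cast_one, Nat.cast_ofNat]
  rfl

theorem gLtStep_lt (x t a : M) : Str.fn .gLtStep ![x, t, a] < 4 := by
  rw [fn_gLtStep]
  split_ifs <;> first | exact one_lt_four' | exact zero_lt_four

theorem F2_gLt (x a : M) : F2 .gLt x a = Str.fn .gLtStep ![x, tab .gLtStep ![a] x, a] :=
  fn_covRec .gLtStep ![a] x

theorem gl_zero (a : M) : Gl 0 a := by
  rw [Gl, F2_gLt, fn_gLtStep, if_pos rfl]
  exact one_ne_zero

theorem digit_gLt {u x a : M} (h : u < x) :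
    F2 .digit (tab .gLtStep ![a] x) u = F2 .gLt u a :=
  covRec_digit _ _ (fun z t => gLtStep_lt z t a) h

theorem gl_nd (k u b a : M) : Gl (nd k u b) a ↔
    Gl b a ∧ (k = 0 → u ≺ a ∧ Gl u a) ∧ (k = 2 → Gl u a) := by
  rw [Gl, F2_gLt, fn_gLtStep, if_neg (nd_ne_zero k u b), kd_nd, ag_nd, rs_nd,
    digit_gLt (rest_lt_nd k u b), digit_gLt (arg_lt_nd k u b)]
  by_cases h₀ : k = 0
  · by_cases h : u ≺ a <;> simp [h₀, h, Gl, two_ne_zero'.symm]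
  · by_cases h₂ : k = 2 <;> simp [h₂, h₀, Gl]

open Classical in
theorem fn_nfStep (x t : M) : Str.fn .nfStep ![x, t] =
    if x = 0 then 1 else
    if F2 .digit t (rs x) ≠ 0 ∧ (if
      (if rs x = 0 then 1 else
        if F2 .cmp (nd (kd (rs x)) (ag (rs x)) 0) (nd (kd x) (ag x) 0) < 2 then (1 : M) else 0) ≠ 0 ∧
      (if kd x = 0 then
          (if F2 .digit t (ag x) ≠ 0 ∧ F2 .gLt (ag x) (ag x) ≠ 0 then (1 : M) else 0)
        else if kd x = 1 then (if ag x = 0 then 1 else 0)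
        else if kd x = 2 then
          (if F2 .digit t (ag x) ≠ 0 ∧ (if Om ≺ ag x then (1 : M) else 0) ≠ 0 then 1 else 0)
        else 0) ≠ 0 then (1 : M) else 0) ≠ 0 then 1 else 0 := by
  rw [Elem.nfStep]
  simp only [fn_cond, fn_ltC, fn_andC, fn_smaller, fn_eqC, fn_kind, fn_arg, fn_rest, fn_node,
    fn_ap2, fn_num, fn_proj, ite_ite_one, Nat.cast_zero, Nat.cast_one, Nat.cast_ofNat]
  rfl

theorem nfStep_lt (x t : M) : Str.fn .nfStep ![x, t] < 4 := by
  rw [fn_nfStep]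
  split_ifs <;> first | exact one_lt_four' | exact zero_lt_four

theorem F1_nf (x : M) : F1 .nf x = Str.fn .nfStep ![x, tab .nfStep ![] x] :=
  fn_covRec .nfStep ![] x

theorem nf_zero : Nf (0 : M) := by
  rw [Nf, F1_nf, fn_nfStep, if_pos rfl]
  exact one_ne_zero

theorem digit_nf {u x : M} (h : u < x) : F2 .digit (tab .nfStep ![] x) u = F1 .nf u :=
  covRec_digit _ _ (fun z t => nfStep_lt z t) h

theorem cmp_lt_two {x y : M} : F2 .cmp x y < 2 ↔ ¬ y ≺ x := by
  have h : (1 : M) + 1 = 2 := by norm_num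
  rw [← cmp_eq_two]
  rcases (cmp_spec x y).2.1 with h' | h' | h'
  · rw [h']
    exact iff_of_true zero_lt_two two_ne_zero'.symm
  · rw [cmp_eq_one.2 h']
    exact iff_of_true (by rw [← h]; exact lt_succ_iff.2 le_rfl) two_ne_one'.symm
  · rw [h']
    exact iff_of_false (lt_irrefl _) (not_not.2 rfl)

/-- The first summand. -/
def hd (x : M) : M := nd (kd x) (ag x) 0

@[simp] theorem hd_nd (k a b : M) : hd (nd k a b) = nd k a 0 := by rw [hd, kd_nd, ag_nd]

theorem nf_nd (k u b : M) : Nf (nd k u b) ↔ Nf b ∧ (b = 0 ∨ ¬ nd k u 0 ≺ hd b) ∧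
    (k = 0 ∧ Nf u ∧ Gl u u ∨ k = 1 ∧ u = 0 ∨ k = 2 ∧ Nf u ∧ Om ≺ u) := by
  rw [Nf, F1_nf, fn_nfStep, if_neg (nd_ne_zero k u b), kd_nd, ag_nd, rs_nd,
    digit_nf (rest_lt_nd k u b), digit_nf (arg_lt_nd k u b), hd]
  have h₁ : ∀ (c : Prop) {_ : Decidable c}, ((if c then (1 : M) else 0) ≠ 0 ↔ c) := fun c _ => by
    split_ifs with h <;> simp [h]
  rw [h₁, h₁]
  refine and_congr Iff.rfl (and_congr ?_ ?_)
  · by_cases hb : b = 0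
    · simp [hb]
    · simp only [hb, if_false, false_or, h₁, cmp_lt_two]
  · by_cases h : k = 0
    · simp only [h, if_true, h₁, true_and, zero_ne_one, two_ne_zero'.symm, false_and, or_false]
      rfl
    by_cases h' : k = 1
    · simp only [h', one_ne_zero, if_true, if_false, h₁, true_and, two_ne_one'.symm, false_and,
        or_false, false_or]
    by_cases h'' : k = 2
    · simp only [h'', two_ne_zero', two_ne_one', if_true, if_false, h₁, true_and, false_and,
        false_or]
      rfl
    · simp [h, h', h'']

end Codes

namespace Elem

/-- One step of the recursion that defines `app`. -/
def appStep : Elem 3 :=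
  let a : Elem 3 := ap1 fst (proj 0)
  let d : Elem 3 := ap1 snd (proj 0)
  cond a
    (cond d
      (andC (andC (eqC (kind a) (kind d)) (eqC (arg a) (arg d)))
        (ap2 digit (proj 1) (ap2 pair (rest a) (rest d))))
      (num 0))
    (eqC d (proj 2))

/-- The characteristic function of the relation, between the pair of `a` and `d` and `x`, that
the list of summands of `d` is the concatenation of those of `a` and `x`. -/
def app : Elem 2 := covRec appStep

/-- One step of the recursion that defines `high`. -/
def highStep : Elem 3 :=
  let u : Elem 3 := proj 0
  cond u
    (andC (ap2 digit (proj 1) (rest u))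
      (eqC (smaller (node (kind u) (arg u) (num 0)) (proj 2)) (num 0)))
    (num 1)

/-- The characteristic function of the relation that no summand of `u` is smaller than `s`. -/
def high : Elem 2 := covRec highStep

/-- The power of `ω` with exponent `x`, for multiples `x` of `Ω`. -/
def power : Elem 1 :=
  cond (smaller (node (num 1) (num 0) (num 0)) (proj 0)) (node (num 2) (proj 0) (num 0))
    (node (num 1) (num 0) (num 0))

/-- The exponent of the first summand, if it is at least `Ω`. -/
def expo : Elem 1 :=
  cond (eqC (kind (proj 0)) (num 1)) (node (num 1) (num 0) (num 0)) (arg (proj 0))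

end Elem

section Lists

variable {M : Type} [Str AccOp M] [IDModel M]

/-- The list of summands of `d` is the concatenation of those of `a` and `x`. -/
def App (a x d : M) : Prop := F2 .app (pr a d) x ≠ 0

/-- No summand of `u` is smaller than `s`. -/
def Hi (u s : M) : Prop := F2 .high u s ≠ 0

/-- The power of `ω` with exponent `x`, for multiples `x` of `Ω`. -/
def pw (x : M) : M := F1 .power x

/-- The exponent of the first summand, if it is at least `Ω`. -/
def lg (x : M) : M := F1 .expo x

instance (f g h : Env M → M) [TF f] [TF g] [TF h] :
    Df Delta0 fun ρ => App (f ρ) (g ρ) (h ρ) := by unfold App pr; infer_instance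

instance (f g : Env M → M) [TF f] [TF g] : Df Delta0 fun ρ => Hi (f ρ) (g ρ) := by
  unfold Hi; infer_instance

instance (f : Env M → M) [TF f] : TF fun ρ => pw (f ρ) := by unfold pw; infer_instance

instance (f : Env M → M) [TF f] : TF fun ρ => lg (f ρ) := by unfold lg; infer_instance

open Classical in
theorem fn_appStep (z t x : M) : Str.fn .appStep ![z, t, x] =
    if fs z = 0 then (if sn z = x then 1 else 0) else
    if sn z = 0 then 0 else
    if (if (if kd (fs z) = kd (sn z) then (1 : M) else 0) ≠ 0 ∧
      (if ag (fs z) = ag (sn z) then (1 : M) else 0) ≠ 0 then (1 : M) else 0) ≠ 0 ∧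
        F2 .digit t (pr (rs (fs z)) (rs (sn z))) ≠ 0 then 1 else 0 := by
  rw [Elem.appStep]
  simp only [fn_cond, fn_andC, fn_eqC, fn_kind, fn_arg, fn_rest, fn_ap1, fn_ap2, fn_num, fn_proj,
    Nat.cast_zero]
  rfl

theorem appStep_lt (z t x : M) : Str.fn .appStep ![z, t, x] < 4 := by
  rw [fn_appStep]
  split_ifs <;> first | exact one_lt_four' | exact zero_lt_four

theorem F2_app (z x : M) : F2 .app z x = Str.fn .appStep ![z, tab .appStep ![x] z, x] :=
  fn_covRec .appStep ![x] z

theorem app_zero_left {x d : M} : App 0 x d ↔ d = x := by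
  rw [App, F2_app, fn_appStep, fs_pr, sn_pr, if_pos rfl]
  split_ifs with h <;> simp [h]

theorem digit_app {i z x : M} (h : i < z) :
    F2 .digit (tab .appStep ![x] z) i = F2 .app i x :=
  covRec_digit _ _ (fun z t => appStep_lt z t x) h

theorem not_app_zero (k a b x : M) : ¬ App (nd k a b) x 0 := by
  rw [App, F2_app, fn_appStep, fs_pr, sn_pr, if_neg (nd_ne_zero _ _ _), if_pos rfl, not_not]

theorem app_nd_nd {k a b x k' a' d : M} :
    App (nd k a b) x (nd k' a' d) ↔ k = k' ∧ a = a' ∧ App b x d := by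
  rw [App, F2_app, fn_appStep, fs_pr, sn_pr, if_neg (nd_ne_zero _ _ _), if_neg (nd_ne_zero _ _ _),
    kd_nd, kd_nd, ag_nd, ag_nd, rs_nd, rs_nd,
    digit_app (pr_lt_pr (rest_lt_nd k a b) (rest_lt_nd k' a' d)), App]
  by_cases h : k = k' <;> by_cases h' : a = a' <;> by_cases h'' : F2 .app (pr b d) x = 0 <;>
    simp [h, h', h'']

theorem app_nd {k a b x d : M} :
    App (nd k a b) x d ↔ ∃ d', d = nd k a d' ∧ App b x d' := by
  obtain rfl | ⟨k', a', d, rfl⟩ := nd_cases d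
  · refine iff_of_false (not_app_zero k a b x) fun ⟨d', h, _⟩ => nd_ne_zero _ _ _ h.symm
  · rw [app_nd_nd]
    constructor
    · rintro ⟨rfl, rfl, h⟩
      exact ⟨d, rfl, h⟩
    · rintro ⟨d', h, h'⟩
      obtain ⟨rfl, rfl, rfl⟩ := nd_inj.1 h
      exact ⟨rfl, rfl, h'⟩

open Classical in
theorem fn_highStep (u t s : M) : Str.fn .highStep ![u, t, s] =
    if u = 0 then 1 else if F2 .digit t (rs u) ≠ 0 ∧
      (if (if nd (kd u) (ag u) 0 ≺ s then (1 : M) else 0) = 0 then (1 : M) else 0) ≠ 0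
      then 1 else 0 := by
  rw [Elem.highStep]
  simp only [fn_cond, fn_andC, fn_eqC, fn_kind, fn_arg, fn_rest, fn_ap2, fn_num, fn_proj,
    fn_smaller, fn_node, Nat.cast_zero, Nat.cast_one]
  rfl

theorem highStep_lt (u t s : M) : Str.fn .highStep ![u, t, s] < 4 := by
  rw [fn_highStep]
  split_ifs <;> first | exact one_lt_four' | exact zero_lt_four

theorem F2_high (u s : M) : F2 .high u s = Str.fn .highStep ![u, tab .highStep ![s] u, s] :=
  fn_covRec .highStep ![s] u

theorem hi_zero (s : M) : Hi 0 s := by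
  rw [Hi, F2_high, fn_highStep, if_pos rfl]
  exact one_ne_zero

theorem digit_high {i u s : M} (h : i < u) :
    F2 .digit (tab .highStep ![s] u) i = F2 .high i s :=
  covRec_digit _ _ (fun z t => highStep_lt z t s) h

theorem hi_nd {k a b s : M} : Hi (nd k a b) s ↔ Hi b s ∧ ¬ nd k a 0 ≺ s := by
  rw [Hi, F2_high, fn_highStep, if_neg (nd_ne_zero _ _ _), kd_nd, ag_nd, rs_nd,
    digit_high (rest_lt_nd k a b)]
  by_cases h : nd k a 0 ≺ s <;> simp [h, Hi]

open Classical in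
theorem pw_eq (x : M) : pw x = if Om ≺ x then nd 2 x 0 else Om := by
  rw [pw, F1, Elem.power]
  simp only [fn_cond, fn_smaller, fn_node, fn_num, fn_proj, Nat.cast_zero, Nat.cast_one,
    Nat.cast_ofNat, ite_ite_one]
  rfl

open Classical in
theorem lg_eq (x : M) : lg x = if kd x = 1 then Om else ag x := by
  rw [lg, F1, Elem.expo]
  simp only [fn_cond, fn_eqC, fn_kind, fn_arg, fn_node, fn_num, fn_proj, Nat.cast_zero,
    Nat.cast_one, ite_ite_one]
  rfl

/-! ### Concatenation -/

theorem app_le_right {a x d : M} (h : App a x d) : x ≤ d := by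
  refine code_ind (fun a => ∀ d, App a x d → x ≤ d) (fun d h => ?_)
    (fun k a b _ ih d h => ?_) a d h
  · rw [app_zero_left] at h
    exact h.ge
  · rw [app_nd] at h
    obtain ⟨d', rfl, h⟩ := h
    exact (ih d' h).trans (rest_lt_nd _ _ _).le

theorem app_zero_right {a d : M} : App a 0 d ↔ d = a := by
  refine code_ind (fun a => ∀ d, App a 0 d ↔ d = a) (fun d => app_zero_left)
    (fun k a b _ ih d => ?_) a d
  rw [app_nd]
  constructor
  · rintro ⟨d', rfl, h⟩
    rw [(ih d').1 h]
  · rintro rfl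
    exact ⟨b, rfl, (ih b).2 rfl⟩

theorem app_lt_left {a x d : M} (hx : x ≠ 0) (h : App a x d) : a < d := by
  refine code_ind (fun a => ∀ d, App a x d → a < d) (fun d h => ?_)
    (fun k a b _ ih d h => ?_) a d h
  · rw [app_zero_left] at h
    exact h ▸ pos_iff_ne_zero.2 hx
  · rw [app_nd] at h
    obtain ⟨d', rfl, h⟩ := h
    exact nd_lt_nd _ _ (ih d' h)

theorem app_le_left {a x d : M} (h : App a x d) : a ≤ d := by
  by_cases hx : x = 0
  · subst hx
    exact (app_zero_right.1 h).ge
  · exact (app_lt_left hx h).le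

theorem app_assoc {a u r w d : M} (h : App a w d) (h' : App u r w) :
    ∃ a', App a u a' ∧ App a' r d := by
  refine code_ind (fun a => ∀ d, App a w d → ∃ a', App a u a' ∧ App a' r d) (fun d h => ?_)
    (fun k a b _ ih d h => ?_) a d h
  · rw [app_zero_left] at h
    subst h
    exact ⟨u, app_zero_left.2 rfl, h'⟩
  · rw [app_nd] at h
    obtain ⟨d', rfl, h⟩ := h
    obtain ⟨a', h₁, h₂⟩ := ih d' h
    exact ⟨nd k a a', app_nd_nd.2 ⟨rfl, rfl, h₁⟩, app_nd_nd.2 ⟨rfl, rfl, h₂⟩⟩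

theorem app_cons {p k a x y d : M} (h : App p (nd k a 0) x) (h' : App x y d) :
    App p (nd k a y) d := by
  refine code_ind (fun p => ∀ x d, App p (nd k a 0) x → App x y d → App p (nd k a y) d)
    (fun x d h h' => ?_) (fun k' a' b _ ih x d h h' => ?_) p x d h h'
  · rw [app_zero_left] at h
    subst h
    rw [app_nd] at h'
    obtain ⟨d', rfl, h'⟩ := h'
    rw [app_zero_left] at h'
    rw [h', app_zero_left]
  · rw [app_nd] at h
    obtain ⟨x', rfl, h⟩ := h
    rw [app_nd] at h'
    obtain ⟨d', rfl, h'⟩ := h'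
    exact app_nd_nd.2 ⟨rfl, rfl, ih x' d' h h'⟩

theorem exists_snoc {x : M} (hx : x ≠ 0) : ∃ p k a, App p (nd k a 0) x := by
  refine code_ind (fun x : M => x ≠ 0 → ∃ p k a, App p (nd k a 0) x) (fun h => (h rfl).elim)
    (fun k a b _ ih _ => ?_) x hx
  by_cases hb : b = 0
  · exact ⟨0, k, a, by rw [app_zero_left, hb]⟩
  · obtain ⟨p, k', a', h⟩ := ih hb
    exact ⟨nd k a p, k', a', app_nd_nd.2 ⟨rfl, rfl, h⟩⟩

theorem app_nf_right {a x d : M} (h : App a x d) (hd : Nf d) : Nf x := by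
  refine code_ind (fun a => ∀ d, App a x d → Nf d → Nf x) (fun d h hd => ?_)
    (fun k a b _ ih d h hd => ?_) a d h hd
  · rwa [← app_zero_left.1 h]
  · rw [app_nd] at h
    obtain ⟨d', rfl, h⟩ := h
    exact ih d' h ((nf_nd _ _ _).1 hd).1

theorem app_gl_right {a x d s : M} (h : App a x d) (hd : Gl d s) : Gl x s := by
  refine code_ind (fun a => ∀ d, App a x d → Gl d s → Gl x s) (fun d h hd => ?_)
    (fun k a b _ ih d h hd => ?_) a d h hd
  · rwa [← app_zero_left.1 h]
  · rw [app_nd] at h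
    obtain ⟨d', rfl, h⟩ := h
    exact ih d' h ((gl_nd _ _ _ _).1 hd).1

theorem app_hi_right {a x d s : M} (h : App a x d) (hd : Hi d s) : Hi x s := by
  refine code_ind (fun a => ∀ d, App a x d → Hi d s → Hi x s) (fun d h hd => ?_)
    (fun k a b _ ih d h hd => ?_) a d h hd
  · rwa [← app_zero_left.1 h]
  · rw [app_nd] at h
    obtain ⟨d', rfl, h⟩ := h
    exact ih d' h (hi_nd.1 hd).1

theorem app_nf_left {a x d : M} (h : App a x d) (hd : Nf d) : Nf a := by
  refine code_ind (fun a => ∀ d, App a x d → Nf d → Nf a) (fun d h hd => nf_zero)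
    (fun k a b _ ih d h hd => ?_) a d h hd
  rw [app_nd] at h
  obtain ⟨d', rfl, h⟩ := h
  rw [nf_nd] at hd ⊢
  refine ⟨ih d' h hd.1, ?_, hd.2.2⟩
  obtain rfl | ⟨k₁, a₁, b₁, rfl⟩ := nd_cases b
  · exact .inl rfl
  · obtain ⟨d₁, rfl, _⟩ := app_nd.1 h
    have := hd.2.1
    rw [hd_nd] at this ⊢
    exact .inr (this.resolve_left (nd_ne_zero _ _ _))

theorem sl_app {a x d d' : M} (h : App a x d) (hd : d' ≺ d) :
    d' ≺ a ∨ ∃ x', App a x' d' ∧ x' ≺ x := by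
  refine code_ind (fun a => ∀ d d', App a x d → d' ≺ d → d' ≺ a ∨ ∃ x', App a x' d' ∧ x' ≺ x)
    (fun d d' h hd => ?_) (fun k a b _ ih d d' h hd => ?_) a d d' h hd
  · exact .inr ⟨d', app_zero_left.2 rfl, by rwa [← app_zero_left.1 h]⟩
  · rw [app_nd] at h
    obtain ⟨e, rfl, h⟩ := h
    obtain rfl | ⟨k', a', b', rfl⟩ := nd_cases d'
    · exact .inl (zero_sl _ _ _)
    · rw [sl_nd] at hd ⊢
      rcases hd with hd | ⟨rfl, hd | ⟨rfl, hd⟩⟩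
      · exact .inl (.inl hd)
      · exact .inl (.inr ⟨rfl, .inl hd⟩)
      · rcases ih e b' h hd with h' | ⟨x', h₁, h₂⟩
        · exact .inl (.inr ⟨rfl, .inr ⟨rfl, h'⟩⟩)
        · exact .inr ⟨x', app_nd_nd.2 ⟨rfl, rfl, h₁⟩, h₂⟩

theorem not_sl_of_app {a x d : M} (h : App a x d) : ¬ d ≺ a := by
  refine code_ind (fun a => ∀ d, App a x d → ¬ d ≺ a)
    (fun d h => not_sl_zero d) (fun k a b _ ih d h => ?_) a d h
  rw [app_nd] at h
  obtain ⟨d', rfl, h⟩ := h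
  rw [sl_nd]
  rintro (h' | ⟨-, h' | ⟨-, h'⟩⟩)
  · exact lt_irrefl _ h'
  · exact sl_irrefl _ h'
  · exact ih d' h h'

theorem nf_rest {k a b : M} (h : Nf (nd k a b)) : Nf b := ((nf_nd _ _ _).1 h).1

theorem nf_hd {k a b : M} (h : Nf (nd k a b)) : Nf (nd k a 0) := by
  rw [nf_nd] at h ⊢
  exact ⟨nf_zero, .inl rfl, h.2.2⟩

/-- Comparison with a single summand is decided by the first summand. -/
theorem nd_sl_single {k a b k' a' : M} : nd k a b ≺ nd k' a' 0 ↔ nd k a 0 ≺ nd k' a' 0 := by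
  rw [sl_nd, sl_nd]
  simp only [not_sl_zero, and_false]

/-- The summands of a normal form do not exceed the first one. -/
theorem summand_le {p k a y k' a' b : M} (hr : Nf (nd k' a' b))
    (h : App p (nd k a y) (nd k' a' b)) : ¬ nd k' a' 0 ≺ nd k a 0 := by
  refine code_ind (fun p => ∀ k' a' b, Nf (nd k' a' b) → App p (nd k a y) (nd k' a' b) →
    ¬ nd k' a' 0 ≺ nd k a 0) (fun k' a' b hr h => ?_) (fun k₁ a₁ b₁ _ ih k' a' b hr h => ?_)
    p k' a' b hr h
  · obtain ⟨rfl, rfl, rfl⟩ := nd_inj.1 (app_zero_left.1 h)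
    exact sl_irrefl _
  · rw [app_nd_nd] at h
    obtain ⟨rfl, rfl, h⟩ := h
    obtain rfl | ⟨k₂, a₂, b₂, rfl⟩ := nd_cases b
    · exact (nd_ne_zero _ _ _ (nonpos_iff_eq_zero.1 (app_le_right h))).elim
    · have := ((nf_nd _ _ _).1 hr).2.1.resolve_left (nd_ne_zero _ _ _)
      rw [hd_nd] at this
      exact not_sl_trans (ih k₂ a₂ b₂ (nf_rest hr) h) this

/-- Splitting of a normal form at a single summand. -/
theorem exists_split (k a : M) {w : M} (hw : Nf w) :
    ∃ v r, App v r w ∧ Hi v (nd k a 0) ∧ r ≺ nd k a 0 := by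
  refine code_ind (fun w => Nf w → ∃ v r, App v r w ∧ Hi v (nd k a 0) ∧ r ≺ nd k a 0)
    (fun _ => ⟨0, 0, app_zero_left.2 rfl, hi_zero _, zero_sl _ _ _⟩)
    (fun k' a' b _ ih hw => ?_) w hw
  by_cases h : nd k' a' 0 ≺ nd k a 0
  · exact ⟨0, _, app_zero_left.2 rfl, hi_zero _, nd_sl_single.2 h⟩
  · obtain ⟨v, r, h₁, h₂, h₃⟩ := ih (nf_rest hw)
    exact ⟨nd k' a' v, r, app_nd_nd.2 ⟨rfl, rfl, h₁⟩, hi_nd.2 ⟨h₂, h⟩, h₃⟩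

/-! ### Powers of `ω` above `Ω` -/

theorem one_lt_two' : (1 : M) < 2 := by
  have h : (1 : M) + 1 = 2 := by norm_num
  rw [← h]
  exact lt_succ_iff.2 le_rfl

theorem lt_one_iff {k : M} : k < 1 ↔ k = 0 := by
  rw [← zero_add (1 : M), lt_succ_iff, nonpos_iff_eq_zero]

theorem exists_pw_eq (e : M) : ∃ k a, pw e = nd k a 0 := by
  rw [pw_eq]
  split_ifs
  · exact ⟨2, e, rfl⟩
  · exact ⟨1, 0, rfl⟩

theorem nf_kind {k a b : M} (h : Nf (nd k a b)) (hk : k ≠ 0) :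
    k = 1 ∧ a = 0 ∨ k = 2 ∧ Nf a ∧ Om ≺ a := by
  rcases ((nf_nd _ _ _).1 h).2.2 with h | h | h
  · exact (hk h.1).elim
  · exact .inl h
  · exact .inr h

theorem sl_om {k a b : M} : nd k a b ≺ Om ↔ k = 0 := by
  rw [Om, sl_nd, lt_one_iff]
  simp only [not_sl_zero, and_false, or_false]

/-- The first summand of a normal form above `Ω` is a power of `ω`. -/
theorem pw_lg {k a b : M} (h : Nf (nd k a b)) (hk : k ≠ 0) :
    pw (lg (nd k a b)) = nd k a 0 ∧ ¬ lg (nd k a b) ≺ Om ∧ Nf (lg (nd k a b)) := by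
  rw [lg_eq, kd_nd, ag_nd]
  rcases nf_kind h hk with ⟨rfl, rfl⟩ | ⟨rfl, h₁, h₂⟩
  · rw [if_pos rfl, pw_eq, if_neg (sl_irrefl _)]
    refine ⟨rfl, sl_irrefl _, (nf_nd _ _ _).2 ⟨nf_zero, .inl rfl, .inr (.inl ⟨rfl, rfl⟩)⟩⟩
  · rw [if_neg two_ne_one', pw_eq, if_pos h₂]
    exact ⟨rfl, sl_asymm h₂, h₁⟩

theorem pw_sl_pw {a b : M} : pw a ≺ pw b → a ≺ b := by
  rw [pw_eq, pw_eq]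
  split_ifs with h₁ h₂ h₂
  · rw [sl_nd]
    rintro (h | ⟨-, h | ⟨-, h⟩⟩)
    · exact (lt_irrefl _ h).elim
    · exact h
    · exact (not_sl_zero _ h).elim
  · rw [Om, sl_nd]
    rintro (h | ⟨h, -⟩)
    · exact (h.not_gt one_lt_two').elim
    · exact (two_ne_one' h).elim
  · exact fun _ => sl_of_not_of_sl h₁ h₂
  · exact fun h => (sl_irrefl _ h).elim

end Lists

/-- The accessible part of the relation with characteristic function `r`. -/
def accOf (r : Elem 2) : AccOp where
  guard := .eq (.fn r ![.var 0, .var 1]) (Tm.succ .zero)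
  term := .var 0
  guard_bounded := .eq _ _
  guard_vars := by
    refine ⟨fun i => ?_, fun i => by simp [Tm.zero, Tm.VarsBelow]⟩
    fin_cases i <;> simp [Tm.VarsBelow]
  term_vars := by simp [Tm.VarsBelow]

/-- The ordering of pairs `(s, u)` by their second component, where `s` is fixed and `u` is a
normal form without summands smaller than `s`. -/
def Elem.block : Elem 2 :=
  andC (ap2 less (ap1 snd (proj 0)) (ap1 snd (proj 1)))
    (andC (eqC (ap1 fst (proj 0)) (ap1 fst (proj 1)))
      (andC (ap2 high (ap1 snd (proj 0)) (ap1 fst (proj 0)))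
        (ap2 high (ap1 snd (proj 1)) (ap1 fst (proj 1)))))

section WellOrdering

variable {M : Type} [Str AccOp M] [IDModel M]

theorem guard_accOf (r : Elem 2) (y x : M) : (accOf r).Guard y x ↔ F2 r y x = 1 := by
  have : (accOf r).Guard y x ↔
      (Tm.fn r ![.var 0, .var 1]).eval (Env.cons y (Env.cons x fun _ => 0)) =
        (Tm.succ .zero).eval (Env.cons y (Env.cons x fun _ => 0)) := Iff.rfl
  rw [this, eval_fn2, eval_succ, eval_zero, F1_succ, zero_add]
  rfl

theorem ite_one_eq_one (c : Prop) {_ : Decidable c} : (if c then (1 : M) else 0) = 1 ↔ c := by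
  split_ifs with h <;> simp [h]

theorem ite_one_ne_zero (c : Prop) {_ : Decidable c} : (if c then (1 : M) else 0) ≠ 0 ↔ c := by
  split_ifs with h <;> simp [h]

open Classical in
theorem F2_less (y x : M) : F2 .less y x = if (Nf y ∧ Nf x) ∧ y ≺ x then 1 else 0 := by
  rw [F2, Elem.less]
  simp only [fn_andC, fn_ap1, fn_smaller, fn_proj, ite_one_ne_zero]
  exact if_congr Iff.rfl rfl rfl

theorem guard_less (y x : M) : accW.Guard y x ↔ (Nf y ∧ Nf x) ∧ y ≺ x := by
  rw [show accW = accOf .less from rfl, guard_accOf, F2_less, ite_one_eq_one]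

theorem guard_block (y x : M) : (accOf .block).Guard y x ↔
    ((Nf (sn y) ∧ Nf (sn x)) ∧ sn y ≺ sn x) ∧ fs y = fs x ∧ Hi (sn y) (fs y) ∧
      Hi (sn x) (fs x) := by
  classical
  rw [guard_accOf, F2, Elem.block]
  simp only [fn_andC, fn_eqC, fn_ap1, fn_ap2, fn_proj, ite_one_ne_zero, ite_one_eq_one, F2_less]
  rfl

/-- Membership in the accessible part of the ordering of the notation system. -/
abbrev W (x : M) : Prop := Mem accW x

theorem W_closed {x : M} (h : ∀ y, Nf y → Nf x → y ≺ x → W y) : W x :=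
  accW.closed fun y hy => h y ((guard_less y x).1 hy).1.1 ((guard_less y x).1 hy).1.2
    ((guard_less y x).1 hy).2

theorem W_induction (R : AccOp) (θ : M → M → Prop) (t : M → M → M)
    [hθ : Df Delta0 fun ρ : Env M => θ (ρ 0) (ρ 1)] [ht : TF fun ρ : Env M => t (ρ 0) (ρ 1)]
    (hs : ∀ x, (∀ y, Nf y → Nf x → y ≺ x → ∀ z, θ z y → Mem R (t z y)) →
      ∀ z, θ z x → Mem R (t z x)) {x : M} (hx : W x) {z : M} (hz : θ z x) : Mem R (t z x) :=
  accW.induction R θ t (fun x ih => hs x fun y h₁ h₂ h₃ =>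
    ih y ((guard_less y x).2 ⟨⟨h₁, h₂⟩, h₃⟩)) hx hz

theorem W_down {x y : M} (hx : W x) (hy : Nf y) (hx' : Nf x) (h : y ≺ x) : W y :=
  W_induction accW (fun z x => Nf z ∧ Nf x ∧ z ≺ x) (fun z _ => z)
    (fun _ ih z hz => W_closed fun y hy _ h => ih z hz.1 hz.2.1 hz.2.2 y ⟨hy, hz.1, h⟩)
    hx ⟨hy, hx', h⟩

theorem W_zero : W (0 : M) := W_closed fun y _ _ h => (not_sl_zero y h).elim

/-- The code of `ψ x`. -/
def ps (x : M) : M := nd 0 x 0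

instance (f : Env M → M) [TF f] : TF fun ρ => ps (f ρ) := by unfold ps; infer_instance

theorem nf_ps {x : M} : Nf (ps x) ↔ Nf x ∧ Gl x x := by
  rw [ps, nf_nd]
  simp [nf_zero, two_ne_zero'.symm]

theorem W_add {d b : M} (hd : W (ps d)) (hb : W b) : W (nd 0 d b) := by
  refine W_induction accW (fun z _ => z = 0) (fun _ x => nd 0 d x) (fun x ih z _ => ?_) hb
    (z := 0) rfl
  refine W_closed fun y hy hx h => ?_
  obtain rfl | ⟨k, a, c, rfl⟩ := nd_cases y
  · exact W_zero
  rw [sl_nd] at h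
  rcases h with h | ⟨rfl, h | ⟨rfl, h⟩⟩
  · exact (not_lt_zero' _ h).elim
  · exact W_down hd hy (nf_hd hx) (sl_nd.2 (.inr ⟨rfl, .inl h⟩))
  · exact ih c (nf_rest hy) (nf_rest hx) h 0 rfl

theorem W_sum {N d : M} (H : ∀ y, y < N → y ≺ d → Nf (ps y) → W (ps y)) {x : M} (hx : x ≤ N)
    (hn : Nf x) (ho : x ≺ Om) (ha : x = 0 ∨ ag x ≺ d) : W x := by
  refine strong_ind (fun x => x ≤ N → Nf x → x ≺ Om → (x = 0 ∨ ag x ≺ d) → W x)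
    (fun x ih hx hn ho ha => ?_) x hx hn ho ha
  obtain rfl | ⟨k, a, b, rfl⟩ := nd_cases x
  · exact W_zero
  obtain rfl := sl_om.1 ho
  have ha' := ha.resolve_left (nd_ne_zero _ _ _)
  rw [ag_nd] at ha'
  refine W_add (H a ((arg_lt_nd _ _ _).trans_le hx) ha' (nf_hd hn)) ?_
  have hb : b = 0 ∨ ∃ a' b', b = nd 0 a' b' ∧ ¬ a ≺ a' := by
    rcases ((nf_nd _ _ _).1 hn).2.1 with h | h
    · exact .inl h
    obtain rfl | ⟨k, a', b', rfl⟩ := nd_cases b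
    · exact .inl rfl
    rw [hd_nd, sl_nd] at h
    obtain ⟨h₁, h₂⟩ := not_or.1 h
    have hk : k = 0 := nonpos_iff_eq_zero.1 (not_lt.1 h₁)
    subst hk
    exact .inr ⟨a', b', rfl, fun h' => h₂ ⟨rfl, .inl h'⟩⟩
  rcases hb with rfl | ⟨a', b', rfl, h⟩
  · exact W_zero
  · refine ih _ (rest_lt_nd _ _ _) ((rest_lt_nd _ _ _).le.trans hx) (nf_rest hn)
      (sl_om.2 rfl) (.inr ?_)
    rw [ag_nd]
    exact sl_of_not_of_sl h ha'

theorem W_sum_gl {N d : M} (H : ∀ y, y < N → y ≺ d → Nf (ps y) → W (ps y)) {x : M} (hx : x ≤ N)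
    (hn : Nf x) (ho : x ≺ Om) (ha : Gl x d) : W x := by
  refine W_sum H hx hn ho ?_
  obtain rfl | ⟨k, a, b, rfl⟩ := nd_cases x
  · exact .inl rfl
  · rw [ag_nd]
    exact .inr (((gl_nd _ _ _ _).1 ha).2.1 (sl_om.1 ho)).1

theorem W_ps {d : M} (H : ∀ y, y ≺ d → Nf (ps y) → W (ps y)) : W (ps d) := by
  refine W_closed fun y hy _ h => ?_
  obtain rfl | ⟨k, a, b, rfl⟩ := nd_cases y
  · exact W_zero
  rw [ps, nd_sl_single, sl_nd] at h
  rcases h with h | ⟨rfl, h | ⟨-, h⟩⟩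
  · exact (not_lt_zero' _ h).elim
  · exact W_sum (fun y _ => H y) le_rfl hy (sl_om.2 rfl) (.inr (by rwa [ag_nd]))
  · exact (not_sl_zero _ h).elim

/-! ### Jumps -/

/-- `δ` is smaller than `α`, or it extends `α` by a list smaller than `s`. -/
def Pl (δ α s : M) : Prop := δ ≺ α ∨ ∃ x, x ≤ δ ∧ App α x δ ∧ x ≺ s

theorem TF.shift (f : Env M → M) [hf : TF f] : TF fun ρ : Env M => f fun i => ρ (i + 1) := by
  obtain ⟨p, t, h⟩ := hf.out
  refine ⟨p, t.subst (mixRen (fun i => Equiv.natSumNatEquivNat (.inl (i + 1)))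
    fun i => Equiv.natSumNatEquivNat (.inr i)), fun ρ => ?_⟩
  rw [h, Tm.eval_subst, eval_mixRen]
  simp only [mix_inl, mix_inr]

instance (f g h : Env M → M) [TF f] [TF g] [TF h] :
    Df Delta0 fun ρ => Pl (f ρ) (g ρ) (h ρ) := by
  have := TF.shift f
  have := TF.shift g
  have := TF.shift h
  unfold Pl
  infer_instance

theorem Pl.of_sl {δ δ' α s : M} (h : Pl δ α s) (h' : δ' ≺ δ) : Pl δ' α s := by
  rcases h with h | ⟨x, -, h₁, h₂⟩
  · exact .inl (sl_trans h' h)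
  · rcases sl_app h₁ h' with h | ⟨x', h₃, h₄⟩
    · exact .inl h
    · exact .inr ⟨x', app_le_right h₃, h₃, sl_trans h₄ h₂⟩

/-- If `B` holds below `α`, then also below `α + s`. -/
def Jump (B : M → Prop) (s : M) : Prop :=
  ∀ α, (∀ δ, δ ≺ α → B δ) → ∀ δ, Pl δ α s → B δ

/-- The code of `ψ δ` belongs to `W`, if it is in normal form. -/
def PsiW (δ : M) : Prop := Nf (ps δ) → W (ps δ)

theorem jump_om : Jump PsiW (Om : M) := by
  refine fun α hα δ hδ => strong_ind (fun δ => Pl δ α Om → Nf (ps δ) → W (ps δ))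
    (fun δ ih hδ hn => ?_) δ hδ
  have hδ' := hδ
  rcases hδ with h | ⟨x, -, h, hx⟩
  · exact hα δ h hn
  obtain ⟨h₁, h₂⟩ := nf_ps.1 hn
  have hW : W x := W_sum_gl (N := δ) (d := δ)
    (fun y h₃ h₄ h₅ => ih y h₃ (hδ'.of_sl h₄) h₅)
    (app_le_right h) (app_nf_right h h₁) hx (app_gl_right h h₂)
  refine W_induction accW (fun z x => App α x z ∧ Nf (ps z)) (fun z _ => ps z)
    (fun x ih z ⟨hz, _⟩ => W_ps fun y hy hn => ?_) hW ⟨h, hn⟩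
  rcases sl_app hz hy with h' | ⟨x', h₃, h₄⟩
  · exact hα y h' hn
  · have hn' := (nf_ps.1 hn).1
    by_cases hzn : Nf z
    · exact ih x' (app_nf_right h₃ hn') (app_nf_right hz hzn) h₄ y ⟨h₃, hn⟩
    · exact (hzn (nf_ps.1 ‹_›).1).elim

theorem pw_strict {a b : M} (ha : ¬ a ≺ Om) (h : a ≺ b) : pw a ≺ pw b := by
  have hb : Om ≺ b := sl_of_not_of_sl ha h
  rw [pw_eq, pw_eq, if_pos hb]
  split_ifs
  · exact sl_nd.2 (.inr ⟨rfl, .inl h⟩)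
  · exact sl_nd.2 (.inl one_lt_two')

theorem om_not_lt_pw (e : M) : ¬ pw e ≺ Om := by
  rw [pw_eq]
  split_ifs
  · rw [sl_om]
    exact two_ne_zero'
  · exact sl_irrefl _

theorem hi_kind {k a b e : M} (h : Hi (nd k a b) (pw e)) : k ≠ 0 := fun hk =>
  (hi_nd.1 h).2 (sl_of_sl_of_not (sl_om.2 hk) (om_not_lt_pw e))

theorem block_zero (s : M) : Mem (accOf .block) (pr s 0) :=
  AccOp.closed _ fun y hy => by
    have := ((guard_block _ _).1 hy).1.2
    rw [sn_pr] at this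
    exact (not_sl_zero _ this).elim

/-- The sums of powers of `ω` with exponents between `e` and `e + c` are accessible. -/
theorem block_mem {e c : M} (hc : W c) {u : M} (hu : u ≠ 0) (hn : Nf u) (hi : Hi u (pw e))
    (h : App e c (lg u)) : Mem (accOf .block) (pr (pw e) u) := by
  refine W_induction (accOf .block) (fun u c => u ≠ 0 ∧ Nf u ∧ Hi u (pw e) ∧ App e c (lg u))
    (fun u _ => pr (pw e) u) (fun c ih u hu => ?_) hc ⟨hu, hn, hi, h⟩
  -- sums with smaller leading exponents
  have low : ∀ L, App e c L → ∀ k a b, Nf (nd k a b) → Nf c → Hi (nd k a b) (pw e) →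
      lg (nd k a b) ≺ L → Mem (accOf .block) (pr (pw e) (nd k a b)) := by
    intro L hL k a b hn hc hi h
    obtain ⟨h₁, h₂, h₃⟩ := pw_lg hn (hi_kind hi)
    rcases sl_app hL h with h' | ⟨c', h₄, h₅⟩
    · have := pw_strict h₂ h'
      rw [h₁] at this
      exact ((hi_nd.1 hi).2 this).elim
    · exact ih c' (app_nf_right h₄ h₃) hc h₅ _ ⟨nd_ne_zero _ _ _, hn, hi, h₄⟩
  refine strong_ind (fun u => (u ≠ 0 ∧ Nf u ∧ Hi u (pw e) ∧ App e c (lg u)) →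
    Mem (accOf .block) (pr (pw e) u)) (fun u ihu ⟨h₀, hn, hi, h⟩ => ?_) u hu
  obtain rfl | ⟨k, a, b, rfl⟩ := nd_cases u
  · exact (h₀ rfl).elim
  obtain ⟨h₁, h₂, h₃⟩ := pw_lg hn (hi_kind hi)
  have hcn := app_nf_right h h₃
  have hb : Mem (accOf .block) (pr (pw e) b) := by
    obtain rfl | ⟨k', a', b', rfl⟩ := nd_cases b
    · exact block_zero _
    have hi' := (hi_nd.1 hi).1
    have hn' := nf_rest hn
    obtain ⟨h₁', h₂', h₃'⟩ := pw_lg hn' (hi_kind hi')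
    rcases sl_trichotomy (lg (nd k' a' b')) (lg (nd k a (nd k' a' b'))) with h' | h' | h'
    · exact low _ h k' a' b' hn' hcn hi' h'
    · exact ihu _ (rest_lt_nd _ _ _) ⟨nd_ne_zero _ _ _, hn', hi', by rwa [h']⟩
    · have := pw_strict h₂ h'
      rw [h₁, h₁'] at this
      have h'' := ((nf_nd _ _ _).1 hn).2.1.resolve_left (nd_ne_zero _ _ _)
      rw [hd_nd] at h''
      exact (h'' this).elim
  have key := AccOp.induction (accOf .block) (accOf .block) (fun _ x : M => fs x = pw e)
    (fun _ x => pr (pw e) (nd k a (sn x))) (fun x ih z hx => ?_) hb (z := 0) (fs_pr _ _)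
  · rwa [sn_pr] at key
  · refine AccOp.closed _ fun y hy => ?_
    obtain ⟨⟨⟨g₁, g₂⟩, g₃⟩, g₄, g₅, g₆⟩ := (guard_block _ _).1 hy
    rw [sn_pr] at g₂ g₃ g₆
    rw [fs_pr] at g₄ g₆
    change Mem (accOf .block) y
    obtain ⟨v, rfl⟩ : ∃ v, y = pr (pw e) v := ⟨sn y, by rw [← g₄, pr_fs_sn]⟩
    rw [sn_pr] at g₁ g₃ g₅
    rw [fs_pr] at g₅
    obtain rfl | ⟨k', a', b', rfl⟩ := nd_cases v
    · exact block_zero _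
    by_cases hh : nd k' a' 0 ≺ nd k a 0
    · refine low _ h k' a' b' g₁ hcn g₅ (pw_sl_pw ?_)
      rw [h₁, (pw_lg g₁ (hi_kind g₅)).1]
      exact hh
    · rw [sl_nd] at g₃ hh
      simp only [not_or, not_and] at hh
      rcases g₃ with g₃ | ⟨rfl, g₃ | ⟨rfl, g₃⟩⟩
      · exact (hh.1 g₃).elim
      · exact ((hh.2 rfl).1 g₃).elim
      · have := ih (pr (pw e) b') ((guard_block _ _).2 ?_) 0 (fs_pr _ _)
        · change Mem (accOf .block) (pr (pw e) (nd k' a' (sn (pr (pw e) b')))) at this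
          rwa [sn_pr] at this
        · rw [fs_pr, sn_pr, hx]
          exact ⟨⟨⟨nf_rest g₁, nf_rest g₂⟩, g₃⟩, rfl, (hi_nd.1 g₅).1, (hi_nd.1 g₆).1⟩

theorem lg_congr (k a b b' : M) : lg (nd k a b) = lg (nd k a b') := by
  rw [lg_eq, lg_eq, kd_nd, kd_nd, ag_nd, ag_nd]

theorem lg_le {k a b : M} (h : Nf (nd k a b)) (hk : k ≠ 0) : lg (nd k a b) ≤ nd k a b := by
  rw [lg_eq, kd_nd, ag_nd]
  rcases nf_kind h hk with ⟨rfl, rfl⟩ | ⟨rfl, -, -⟩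
  · rw [if_pos rfl]
    exact nd_le_nd _ _ zero_le
  · rw [if_neg two_ne_one']
    exact (arg_lt_nd _ _ _).le

theorem lg_gl {k a b d : M} (h : Nf (nd k a b)) (hk : k ≠ 0) (hg : Gl (nd k a b) d) :
    Gl (lg (nd k a b)) d := by
  rw [lg_eq, kd_nd, ag_nd]
  rcases nf_kind h hk with ⟨rfl, rfl⟩ | ⟨rfl, -, -⟩
  · rw [if_pos rfl, Om, gl_nd]
    exact ⟨gl_zero _, fun h => (hk h).elim, fun h => (two_ne_one' h.symm).elim⟩
  · rw [if_neg two_ne_one']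
    exact ((gl_nd _ _ _ _).1 hg).2.2 rfl

/-- `Jump PsiW (ω ^ e)`, for multiples `e` of `Ω`. -/
def JumpPow (e : M) : Prop := Nf e → Hi e Om → Jump PsiW (pw e)

theorem jumpPow_prog {e : M} (ih : ∀ e', e' ≺ e → JumpPow e') : JumpPow e := by
  intro hen hei α hα δ hδ
  refine strong_ind (fun δ => Pl δ α (pw e) → Nf (ps δ) → W (ps δ)) (fun δ ihδ hδ hn => ?_) δ hδ
  have hδ' := hδ
  rcases hδ with h | ⟨r, -, h, hr⟩
  · exact hα δ h hn
  by_cases hro : r ≺ Om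
  · exact jump_om α hα δ (.inr ⟨r, app_le_right h, h, hro⟩) hn
  obtain rfl | ⟨k, a, b, rfl⟩ := nd_cases r
  · exact (hro (zero_sl _ _ _)).elim
  have hk : k ≠ 0 := fun hk => hro (sl_om.2 hk)
  obtain ⟨h₁, h₂⟩ := nf_ps.1 hn
  have hrn := app_nf_right h h₁
  have hrg := app_gl_right h h₂
  obtain ⟨l₁, l₂, l₃⟩ := pw_lg hrn hk
  have hle := lg_le hrn hk
  have hlg := lg_gl hrn hk hrg
  have heo : Om ≺ e := by
    by_contra hh
    rw [pw_eq, if_neg hh] at hr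
    exact hro hr
  have hae : lg (nd k a b) ≺ e := by
    refine pw_sl_pw ?_
    rw [l₁]
    obtain ⟨k', a', he⟩ := exists_pw_eq e
    rw [he] at hr ⊢
    exact nd_sl_single.1 hr
  obtain ⟨e₁, c, hec, he₁, hco⟩ := exists_split 1 0 l₃
  have hB : Jump PsiW (pw e₁) := ih e₁ (sl_of_not_of_sl (not_sl_of_app hec) hae)
    (app_nf_left hec l₃) he₁
  have hcW : W c := W_sum_gl (N := δ) (d := δ)
    (fun y h₃ h₄ h₅ => ihδ y h₃ (hδ'.of_sl h₄) h₅)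
    ((app_le_right hec).trans (hle.trans (app_le_right h))) (app_nf_right hec l₃) hco
    (app_gl_right hec hlg)
  obtain ⟨ks, as, hs⟩ := exists_pw_eq e₁
  obtain ⟨u, r', hur, hui, hr's⟩ := exists_split ks as hrn
  rw [← hs] at hui hr's
  have hun := app_nf_left hur hrn
  have huR : Mem (accOf .block) (pr (pw e₁) u) := by
    obtain rfl | ⟨k', a', b', rfl⟩ := nd_cases u
    · exact block_zero _
    refine block_mem hcW (nd_ne_zero _ _ _) hun hui ?_
    obtain ⟨rfl, rfl, -⟩ := app_nd_nd.1 hur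
    rwa [lg_congr k' a' b' b]
  refine AccOp.induction (accOf .block) accW (fun z x => (fs x = pw e₁ ∧ Hi (sn x) (pw e₁) ∧
    ∃ w, w ≤ z ∧ ∃ r', r' ≤ z ∧ App α w z ∧ App (sn x) r' w ∧ r' ≺ pw e₁) ∧ Nf (ps z))
    (fun z _ => ps z) (fun x ih z ⟨⟨hx, hxi, w, _, r', _, hw, hxr, hr'⟩, hzn⟩ => ?_) huR
    (z := δ) ⟨⟨fs_pr _ _, by rwa [sn_pr], _, app_le_right h, r',
      (app_le_right hur).trans (app_le_right h), h, by rwa [sn_pr], hr's⟩, hn⟩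
  obtain ⟨α', ha₁, ha₂⟩ := app_assoc hw hxr
  refine hB α' (fun δ' hδ' hn' => ?_) z (.inr ⟨r', app_le_right ha₂, ha₂, hr'⟩) hzn
  rcases sl_app ha₁ hδ' with hh | ⟨x', hx₁, hx₂⟩
  · exact hα δ' hh hn'
  have hx'n := app_nf_right hx₁ (nf_ps.1 hn').1
  obtain ⟨v, r'', hv₁, hv₂, hv₃⟩ := exists_split ks as hx'n
  rw [← hs] at hv₂ hv₃
  refine ih (pr (pw e₁) v) ((guard_block _ _).2 ?_) δ' ⟨⟨fs_pr _ _, ?_, x', app_le_right hx₁, r'',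
    (app_le_right hv₁).trans (app_le_right hx₁), hx₁, ?_, hv₃⟩, hn'⟩
  · rw [fs_pr, sn_pr, hx]
    exact ⟨⟨⟨app_nf_left hv₁ hx'n,
      app_nf_left hxr (app_nf_right hw (nf_ps.1 hzn).1)⟩,
      sl_of_not_of_sl (not_sl_of_app hv₁) hx₂⟩, rfl, hv₂, hxi⟩
  · change Hi (sn (pr (pw e₁) v)) _
    rwa [sn_pr]
  · change App (sn (pr (pw e₁) v)) _ _
    rwa [sn_pr]

end WellOrdering

theorem Hier.of_le {p : Bool} {j k : ℕ} {A : Fm AccOp} (h : Hier p j A) (hjk : j ≤ k) :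
    Hier p k A := by
  induction hjk with
  | refl => exact h
  | step _ ih => exact .mono ih

theorem Hier.of_positive {A : Fm AccOp} (h : Polarity true A) (p : Bool) (k : ℕ) : Hier p k A :=
  Hier.of_le (.positive h) (Nat.zero_le k)

/-- Complete induction for the formulas in `Π⁰ₖ(P)` holds in `M`. -/
class HierInd (k : ℕ) (M : Type) [Str AccOp M] : Prop where
  ind {θ : Fm AccOp} : Hier true k θ → ∀ ρ : Env M, (indAx θ).sat ρ

section Jump

variable {M : Type} [Str AccOp M] [IDModel M]

theorem hier_strong_ind (k : ℕ) [HierInd k M] (P : M → Prop)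
    (hP : Df (Hier true k) fun ρ : Env M => P (ρ 0))
    (h : ∀ x, (∀ y, y < x → P y) → P x) (x : M) : P x := by
  have hQ : Df (Hier true k) fun ρ : Env M => ∀ y, y < ρ 0 → P y :=
    Df.ball' (K := Hier true k) (P := fun y _ => P y) (fun t _ => .ball t) (TF.var 0) hP
  obtain ⟨p, A, hA, hAP⟩ := Df.unary (P := fun x => ∀ y, y < x → P y) hQ
  refine h x (indAx_sat (HierInd.ind hA p) hAP (fun y hy => (not_lt_zero' y hy).elim)
    (fun x ih y hy => h y fun z hz => ih z ?_) x)
  rw [F1_succ] at hy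
  exact hz.trans_le (lt_succ_iff.1 hy)

/-- The jump of `B` at `P h`, for the elements `h` of the domain `C`. -/
def JumpAt (B C : M → Prop) (P : M → M) (h : M) : Prop := C h → Jump B (P h)

/-- The relation `B` is progressive. -/
def Prog (B : M → Prop) : Prop := ∀ e, (∀ e', e' ≺ e → B e') → B e

theorem jumpAt_prog (k : ℕ) [HierInd k M] {B C D : M → Prop} {P : M → M}
    (hD : Df (Hier true k) fun ρ : Env M => ∀ e, e ≺ ρ 0 → B e) (hB : Prog B)
    (hBD : ∀ e, (D e → B e) → B e) (hDn : ∀ e, D e → Nf e) (hPs : ∀ h, ∃ k a, P h = nd k a 0)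
    (hP : ∀ h e p k a y, C h → D e → App p (nd k a y) e → nd k a 0 ≺ P h →
      ∃ a', C a' ∧ a' ≺ h ∧ P a' = nd k a 0) : Prog (JumpAt B C P) := by
  intro h ih hC α hα e he
  refine hBD e fun hDe => ?_
  rcases he with he | ⟨r, -, hr, hrs⟩
  · exact hα e he
  have hrn := app_nf_right hr (hDn e hDe)
  have key := hier_strong_ind k (fun p => (∃ x, x ≤ e ∧ ∃ y, y ≤ e ∧ App x y r ∧ App α x p ∧
    App p y e) → ∀ e', e' ≺ p → B e') ?_ ?_ e
  · exact hB e (key ⟨r, app_le_right hr, 0, zero_le, app_zero_right.2 rfl, hr,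
      app_zero_right.2 rfl⟩)
  · refine Df.imp' (K := Delta0) (L := Hier true k) (fun A A' hA hA' =>
      .imp (Hier.of_positive (hA.polarity _) _ _) hA') ?_ hD
    infer_instance
  · rintro p ihp ⟨x, -, y, -, hxy, hx, hy⟩ e' he'
    by_cases hx0 : x = 0
    · rw [hx0, app_zero_right] at hx
      exact hα e' (by rwa [← hx])
    obtain ⟨x₀, k', a, hx₀⟩ := exists_snoc hx0
    obtain ⟨p₀, hp₀, hp⟩ := app_assoc hx hx₀
    have hr₀ := app_cons hx₀ hxy
    have he₀ := app_cons hp hy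
    have hD₀ := ihp p₀ (app_lt_left (nd_ne_zero _ _ _) hp) ⟨x₀, (app_le_left hr₀).trans
      (app_le_right hr), _, app_le_right he₀, hr₀, hp₀, he₀⟩
    have hs : nd k' a 0 ≺ P h := by
      obtain ⟨k₁, a₁, hPh⟩ := hPs h
      rw [hPh] at hrs ⊢
      obtain rfl | ⟨k₂, a₂, b₂, rfl⟩ := nd_cases r
      · exact (nd_ne_zero _ _ _ (nonpos_iff_eq_zero.1 (app_le_right hr₀))).elim
      · exact sl_of_not_of_sl (summand_le hrn hr₀) (nd_sl_single.1 hrs)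
    obtain ⟨a', ha₁, ha₂, ha₃⟩ := hP h e p₀ k' a y hC hDe he₀ hs
    refine ih a' ha₂ ha₁ p₀ hD₀ e' ?_
    rw [ha₃]
    rcases sl_app hp he' with h' | ⟨x', h₁, h₂⟩
    · exact .inl h'
    · exact .inr ⟨x', app_le_right h₁, h₁, h₂⟩

theorem jumpAt_df {k : ℕ} {B C : M → Prop} {P : M → M}
    [hC : Df Delta0 fun ρ : Env M => C (ρ 0)] [hP : TF fun ρ : Env M => P (ρ 0)]
    (hB : Df (Hier true k) fun ρ : Env M => B (ρ 0))
    (hD : Df (Hier true k) fun ρ : Env M => ∀ e, e ≺ ρ 0 → B e) :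
    Df (Hier true (k + 1)) (fun ρ : Env M => JumpAt B C P (ρ 0)) ∧
      Df (Hier true (k + 1)) fun ρ : Env M => ∀ e, e ≺ ρ 0 → JumpAt B C P e := by
  have delta0_imp : ∀ A A' : Fm AccOp, Delta0 A → Hier true (k + 1) A' →
      Hier true (k + 1) (A.imp A') := fun A A' hA hA' =>
    .imp (Hier.of_positive (hA.polarity _) _ _) hA'
  have h₁ : Df (Hier true (k + 1)) fun ρ : Env M => JumpAt B C P (ρ 0) := by
    refine Df.imp' (K := Delta0) delta0_imp hC ?_
    refine Df.all' (K := Hier true (k + 1)) (fun _ h => .all h) (P := fun α ρ =>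
      (∀ δ, δ ≺ α → B δ) → ∀ δ, Pl δ α (P (ρ 0)) → B δ) ?_
    refine Df.imp' (K := Hier false (k + 1)) (L := Hier true (k + 1)) (fun A A' h h' => .imp h h')
      (hD.mono fun _ h => .mono h) ?_
    refine Df.all' (K := Hier true (k + 1)) (fun _ h => .all h)
      (P := fun δ ρ => Pl δ (ρ 0) (P (ρ 1)) → B δ) ?_
    have hP₂ : TF fun ρ : Env M => P (ρ 2) :=
      have := TF.shift fun ρ : Env M => P (ρ 0)
      TF.shift fun ρ : Env M => P (ρ 1)
    refine Df.imp' (K := Delta0) delta0_imp ?_ (hB.mono fun _ h => .mono h)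
    infer_instance
  refine ⟨h₁, ?_⟩
  refine Df.all' (K := Hier true (k + 1)) (fun _ h => .all h)
    (P := fun e ρ => e ≺ ρ 0 → JumpAt B C P e) ?_
  refine Df.imp' (K := Delta0) delta0_imp ?_ h₁
  infer_instance

/-! ### The iterated jumps -/

/-- The domain of the first jump. -/
def DomHigh (e : M) : Prop := Nf e ∧ Hi e Om

/-- The domain of the second jump. -/
def DomAbove (e : M) : Prop := Nf e ∧ ¬ e ≺ Om

/-- The domain of the later jumps. -/
def DomBelow (e : M) : Prop := Nf e ∧ e ≺ Om

instance : Df Delta0 fun ρ : Env M => DomHigh (ρ 0) := by unfold DomHigh; infer_instance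
instance : Df Delta0 fun ρ : Env M => DomAbove (ρ 0) := by unfold DomAbove; infer_instance
instance : Df Delta0 fun ρ : Env M => DomBelow (ρ 0) := by unfold DomBelow; infer_instance

/-- The iterated jumps. -/
def Level : ℕ → M → Prop
  | 0 => JumpAt PsiW DomHigh pw
  | 1 => JumpAt (Level 0) DomAbove pw
  | j + 2 => JumpAt (Level (j + 1)) DomBelow ps

theorem level_df (j : ℕ) : Df (Hier true (j + 1)) (fun ρ : Env M => Level j (ρ 0)) ∧
    Df (Hier true (j + 1)) fun ρ : Env M => ∀ e, e ≺ ρ 0 → Level j e := by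
  induction j with
  | zero =>
    have h₁ : Df (Polarity true) fun ρ : Env M => PsiW (ρ 0) := by unfold PsiW; infer_instance
    refine jumpAt_df (h₁.mono fun _ h => .positive h)
      (Df.mono (K := Polarity true) (fun _ h => .positive h) ?_)
    unfold PsiW
    infer_instance
  | succ j ih => cases j <;> exact jumpAt_df ih.1 ih.2

theorem level_zero_prog : Prog (M := M) (Level 0) := fun e ih h =>
  jumpPow_prog (e := e) (fun e' he' h₁ h₂ => ih e' he' ⟨h₁, h₂⟩) h.1 h.2

theorem level_prog (k : ℕ) [HierInd k M] {j : ℕ} (hj : j ≤ k) : Prog (M := M) (Level j) := by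
  induction j with
  | zero => exact level_zero_prog
  | succ j ih =>
    have hD := (level_df (M := M) j).2.mono fun _ h => Hier.of_le h hj
    have ih := ih (Nat.le_of_succ_le hj)
    rcases j with _ | j
    · refine jumpAt_prog (M := M) k (D := DomHigh) hD ih (fun e h h' => h h' h')
        (fun e h => h.1) exists_pw_eq fun h e p k' a y hC hDe hp hs => ?_
      have hi := (hi_nd.1 (app_hi_right hp hDe.2)).2
      obtain ⟨h₁, h₂, h₃⟩ := pw_lg (app_nf_right hp hDe.1) (fun hk => hi (sl_om.2 hk))
      refine ⟨_, ⟨h₃, h₂⟩, pw_sl_pw ?_, h₁⟩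
      rwa [h₁]
    · have hP : ∀ h e p k' a y : M, DomBelow h → Nf e → App p (nd k' a y) e → nd k' a 0 ≺ ps h →
          ∃ a', DomBelow a' ∧ a' ≺ h ∧ ps a' = nd k' a 0 := by
        intro h e p k' a y hC hDe hp hs
        rw [ps, sl_nd] at hs
        rcases hs with hs | ⟨rfl, hs | ⟨-, hs⟩⟩
        · exact (not_lt_zero' _ hs).elim
        · exact ⟨a, ⟨(nf_ps.1 (nf_hd (app_nf_right hp hDe))).1, sl_trans hs hC.2⟩, hs, rfl⟩
        · exact (not_sl_zero _ hs).elim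
      rcases j with _ | j
      · exact jumpAt_prog (M := M) k (D := DomAbove) hD ih (fun e h h' => h h' h')
          (fun e h => h.1) (fun h => ⟨0, h, rfl⟩) fun h e p k' a y hC hDe => hP h e p k' a y hC hDe.1
      · exact jumpAt_prog (M := M) k (D := DomBelow) hD ih (fun e h h' => h h' h')
          (fun e h => h.1) (fun h => ⟨0, h, rfl⟩) fun h e p k' a y hC hDe => hP h e p k' a y hC hDe.1

theorem Jump.below {B : M → Prop} {s : M} (h : Jump B s) {d : M} (hd : d ≺ s) : B d :=
  h 0 (fun d hd => (not_sl_zero d hd).elim) d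
    (.inr ⟨d, le_rfl, app_zero_left.2 rfl, hd⟩)

/-! ### Finite multiples and iterations -/

/-- The code of the `m`-fold sum of `ψ 0`. -/
def fin : ℕ → M
  | 0 => 0
  | m + 1 => nd 0 0 (fin m)

/-- The code of `Ω * m`. -/
def omm : ℕ → M
  | 0 => 0
  | m + 1 => nd 1 0 (omm m)

theorem sl_fin {m : ℕ} {x : M} (h : x ≺ fin m) : ∃ i < m, x = fin i := by
  induction m generalizing x with
  | zero => exact (not_sl_zero _ h).elim
  | succ m ih =>
    obtain rfl | ⟨k, a, b, rfl⟩ := nd_cases x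
    · exact ⟨0, Nat.succ_pos m, rfl⟩
    rw [fin, sl_nd] at h
    rcases h with h | ⟨rfl, h | ⟨rfl, h⟩⟩
    · exact (not_lt_zero' _ h).elim
    · exact (not_sl_zero _ h).elim
    · obtain ⟨i, hi, rfl⟩ := ih h
      exact ⟨i + 1, Nat.succ_lt_succ hi, rfl⟩

theorem sl_omm {m : ℕ} {x : M} (hx : Hi x Om) (h : x ≺ omm m) : ∃ i < m, x = omm i := by
  induction m generalizing x with
  | zero => exact (not_sl_zero _ h).elim
  | succ m ih =>
    obtain rfl | ⟨k, a, b, rfl⟩ := nd_cases x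
    · exact ⟨0, Nat.succ_pos m, rfl⟩
    rw [hi_nd, sl_om] at hx
    rw [omm, sl_nd, lt_one_iff] at h
    rcases h with h | ⟨rfl, h | ⟨rfl, h⟩⟩
    · exact (hx.2 h).elim
    · exact (not_sl_zero _ h).elim
    · obtain ⟨i, hi, rfl⟩ := ih hx.1 h
      exact ⟨i + 1, Nat.succ_lt_succ hi, rfl⟩

theorem fin_sl_fin {i m : ℕ} (h : i < m) : (fin i : M) ≺ fin m := by
  induction m generalizing i with
  | zero => omega
  | succ m ih =>
    rcases i with _ | i
    · exact zero_sl _ _ _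
    · exact sl_nd.2 (.inr ⟨rfl, .inr ⟨rfl, ih (Nat.lt_of_succ_lt_succ h)⟩⟩)

theorem nf_fin (m : ℕ) : Nf (fin m : M) := by
  induction m with
  | zero => exact nf_zero
  | succ m ih =>
    refine (nf_nd _ _ _).2 ⟨ih, ?_, .inl ⟨rfl, nf_zero, gl_zero _⟩⟩
    rcases m with _ | m
    · exact .inl rfl
    · right
      rw [fin, hd_nd]
      exact sl_irrefl _

theorem gl_fin {m : ℕ} {a : M} (h : 0 ≺ a) : Gl (fin m) a := by
  induction m with
  | zero => exact gl_zero _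
  | succ m ih => exact (gl_nd _ _ _ _).2 ⟨ih, fun _ => ⟨h, gl_zero _⟩,
      fun h => (two_ne_zero' h.symm).elim⟩

theorem nf_omm (m : ℕ) : Nf (omm m : M) := by
  induction m with
  | zero => exact nf_zero
  | succ m ih =>
    refine (nf_nd _ _ _).2 ⟨ih, ?_, .inr (.inl ⟨rfl, rfl⟩)⟩
    rcases m with _ | m
    · exact .inl rfl
    · right
      rw [omm, hd_nd]
      exact sl_irrefl _

theorem hi_omm (m : ℕ) : Hi (omm m : M) Om := by
  induction m with
  | zero => exact hi_zero _
  | succ m ih => exact hi_nd.2 ⟨ih, sl_irrefl _⟩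

theorem gl_mono {x a b : M} (h : Gl x a) (hab : a ≺ b) : Gl x b := by
  refine code_ind (fun x => Gl x a → Gl x b) (fun _ => gl_zero _) (fun k u c ihu ihc h => ?_) x h
  rw [gl_nd] at h ⊢
  exact ⟨ihc h.1, fun hk => ⟨sl_trans (h.2.1 hk).1 hab, ihu (h.2.1 hk).2⟩, fun hk => ihu (h.2.2 hk)⟩

theorem ps_sl_ps {x y : M} : ps x ≺ ps y ↔ x ≺ y := by
  rw [ps, ps, sl_nd]
  simp only [lt_irrefl, not_sl_zero, false_or, true_and, and_false, or_false]

theorem iterate_ps (i m : ℕ) : Nf (ps^[i] (fin m) : M) ∧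
    Gl (ps^[i] (fin m) : M) (ps^[i] (fin m)) ∧ (ps^[i] (fin m) : M) ≺ ps (ps^[i] (fin m)) ∧
    (ps^[i] (fin m) : M) ≺ Om := by
  induction i with
  | zero =>
    rcases m with _ | m
    · exact ⟨nf_zero, gl_zero _, zero_sl _ _ _, zero_sl _ _ _⟩
    · exact ⟨nf_fin _, gl_fin (zero_sl _ _ _), sl_nd.2 (.inr ⟨rfl, .inl (zero_sl _ _ _)⟩),
        sl_om.2 rfl⟩
  | succ i ih =>
    rw [Function.iterate_succ_apply']
    obtain ⟨h₁, h₂, h₃, h₄⟩ := ih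
    refine ⟨nf_ps.2 ⟨h₁, h₂⟩, (gl_nd _ _ _ _).2 ⟨gl_zero _, fun _ => ⟨h₃, gl_mono h₂ h₃⟩,
      fun h => (two_ne_zero' h.symm).elim⟩, ps_sl_ps.2 h₃, sl_om.2 rfl⟩

theorem iterate_ps_sl (i : ℕ) {m n : ℕ} (h : m < n) :
    (ps^[i] (fin m) : M) ≺ ps^[i] (fin n) := by
  induction i with
  | zero => exact fin_sl_fin h
  | succ i ih =>
    rw [Function.iterate_succ_apply', Function.iterate_succ_apply']
    exact ps_sl_ps.2 ih

theorem level_omm [HierInd 0 M] (m : ℕ) : Level 0 (omm m : M) := by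
  induction m using Nat.strong_induction_on with
  | _ m ih =>
    refine level_prog 0 le_rfl _ fun x hx hC => ?_
    obtain ⟨i, hi, rfl⟩ := sl_omm hC.2 hx
    exact ih i hi hC

theorem psiW_of_sl_zero [HierInd 0 M] (m : ℕ) {d : M} (hd : d ≺ pw (omm m)) : PsiW d :=
  Jump.below (level_omm m ⟨nf_omm m, hi_omm m⟩) hd

theorem level_fin (k : ℕ) [HierInd (k + 2) M] (m : ℕ) : Level (k + 2) (fin m : M) := by
  induction m using Nat.strong_induction_on with
  | _ m ih =>
    refine level_prog (k + 2) le_rfl _ fun x hx => ?_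
    obtain ⟨i, hi, rfl⟩ := sl_fin hx
    exact ih i hi

theorem level_one_fin [HierInd 1 M] (m : ℕ) : Level 1 (nd 1 0 (fin m) : M) := by
  induction m using Nat.strong_induction_on with
  | _ m ih =>
    refine level_prog 1 le_rfl _ fun x hx hC => ?_
    obtain rfl | ⟨k, a, b, rfl⟩ := nd_cases x
    · exact (hC.2 (zero_sl _ _ _)).elim
    have hk := hC.2
    rw [sl_om] at hk
    rw [sl_nd, lt_one_iff] at hx
    rcases hx with h | ⟨rfl, h | ⟨rfl, h⟩⟩
    · exact (hk h).elim
    · exact (not_sl_zero _ h).elim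
    · obtain ⟨i, hi, rfl⟩ := sl_fin h
      exact ih i hi hC

theorem level_iterate (k : ℕ) [HierInd (k + 2) M] (i j : ℕ) (h : i + j = k) (m : ℕ) :
    Level (j + 2) (ps^[i] (fin m) : M) := by
  induction i generalizing j m with
  | zero =>
    obtain rfl : j = k := by omega
    exact level_fin j m
  | succ i ih =>
    rw [Function.iterate_succ_apply']
    have := iterate_ps (M := M) i (m + 1)
    exact Jump.below (ih (j + 1) (by omega) (m + 1) ⟨this.1, this.2.2.2⟩)
      (ps_sl_ps.2 (iterate_ps_sl i (Nat.lt_succ_self m)))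

theorem level_one (k : ℕ) [HierInd (k + 1) M] (m : ℕ) :
    Level 1 (nd 1 0 (ps^[k] (fin m)) : M) := by
  rcases k with _ | k
  · exact level_one_fin m
  have := iterate_ps (M := M) k (m + 1)
  refine level_iterate k k 0 rfl (m + 1) ⟨this.1, this.2.2.2⟩ Om (fun d hd hC => (hC.2 hd).elim) _
    (.inr ⟨_, (rest_lt_nd _ _ _).le, app_nd_nd.2 ⟨rfl, rfl, app_zero_left.2 rfl⟩, ?_⟩)
  rw [Function.iterate_succ_apply']
  exact ps_sl_ps.2 (iterate_ps_sl k (Nat.lt_succ_self m))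

theorem nf_om_add {x : M} (hx : Nf x) (ho : x ≺ Om) : Nf (nd 1 0 x) := by
  refine (nf_nd _ _ _).2 ⟨hx, ?_, .inr (.inl ⟨rfl, rfl⟩)⟩
  obtain rfl | ⟨k, a, b, rfl⟩ := nd_cases x
  · exact .inl rfl
  · right
    rw [hd_nd]
    exact sl_asymm (sl_om.2 (sl_om.1 ho))

theorem nf_pw {x : M} (hx : Nf x) : Nf (pw x) := by
  rw [pw_eq]
  split_ifs with h
  · exact (nf_nd _ _ _).2 ⟨nf_zero, .inl rfl, .inr (.inr ⟨rfl, hx, h⟩)⟩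
  · exact (nf_nd _ _ _).2 ⟨nf_zero, .inl rfl, .inr (.inl ⟨rfl, rfl⟩)⟩

theorem hi_pw (x : M) : Hi (pw x) Om := by
  have := om_not_lt_pw x
  obtain ⟨k, a, h⟩ := exists_pw_eq x
  rw [h] at this ⊢
  exact hi_nd.2 ⟨hi_zero _, this⟩

theorem psiW_of_sl_succ (k : ℕ) [HierInd (k + 1) M] (m : ℕ) {d : M}
    (hd : d ≺ pw (pw (nd 1 0 (ps^[k] (fin m))))) : PsiW d := by
  have hx : ∀ m, DomAbove (nd 1 0 (ps^[k] (fin m)) : M) := fun m =>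
    ⟨nf_om_add (iterate_ps k m).1 (iterate_ps k m).2.2.2, fun h => one_ne_zero (sl_om.1 h)⟩
  have h₁ : Level 0 (pw (nd 1 0 (ps^[k] (fin m)) : M)) :=
    Jump.below (level_one k (m + 1) (hx (m + 1))) (pw_strict (hx m).2
      (sl_nd.2 (.inr ⟨rfl, .inr ⟨rfl, iterate_ps_sl k (Nat.lt_succ_self m)⟩⟩)))
  exact Jump.below (h₁ ⟨nf_pw (hx m).1, hi_pw _⟩) hd

theorem W_of_psiW {x d : M} (hx : Nf x) (ho : x ≺ Om) (ha : x = 0 ∨ ag x ≺ d)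
    (h : ∀ y, y ≺ d → PsiW y) : W x :=
  W_sum (fun y _ hy => h y hy) le_rfl hx ho ha

end Jump

section Ordinals

open Ordinal Order

/-! ### The collapsing function -/

theorem Hull.mono {α α' : Ordinal.{0}} (h : α ≤ α') {X : Set Ordinal.{0}} {γ : Ordinal.{0}}
    (hγ : Hull α (fun δ _ => WeakID.psi δ) X γ) : Hull α' (fun δ _ => WeakID.psi δ) X γ := by
  induction hγ with
  | base h => exact .base h
  | zero => exact .zero
  | Om => exact .Om
  | pow h _ ih => exact .pow h ih
  | add _ _ ih₁ ih₂ => exact .add ih₁ ih₂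
  | psi h' _ ih => exact .psi (h'.trans_le h) ih

/-- The ordinals that are closed under the hull. -/
def Closed (α : Ordinal.{0}) : Set Ordinal.{0} :=
  {β | β ≤ ω₁ ∧ ∀ γ, Hull α (fun δ _ => psi δ) (Set.Iio β) γ → γ < ω₁ → γ < β}

theorem psi_eq (α : Ordinal.{0}) : psi α = sInf (Closed α) := by
  rw [psi]
  rfl

theorem omega_mem_closed (α : Ordinal.{0}) : ω₁ ∈ Closed α := ⟨le_rfl, fun _ _ h => h⟩

theorem psi_mem (α : Ordinal.{0}) : psi α ∈ Closed α := by
  rw [psi_eq]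
  exact csInf_mem ⟨_, omega_mem_closed α⟩

theorem psi_le_omega (α : Ordinal.{0}) : psi α ≤ ω₁ := (psi_mem α).1

theorem psi_mono {α α' : Ordinal.{0}} (h : α ≤ α') : psi α ≤ psi α' := by
  conv_lhs => rw [psi_eq]
  exact csInf_le' ⟨(psi_mem α').1, fun γ hγ hγ' => (psi_mem α').2 γ (hγ.mono h) hγ'⟩

theorem psi_pos (α : Ordinal.{0}) : 0 < psi α := (psi_mem α).2 0 .zero (omega_pos 1)

theorem psi_principal (α : Ordinal.{0}) : IsPrincipal (· + ·) (psi α) := fun _ _ ha hb =>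
  (psi_mem α).2 _ (.add (.base ha) (.base hb))
    (isPrincipal_add_omega 1 (ha.trans_le (psi_le_omega α)) (hb.trans_le (psi_le_omega α)))

theorem psi_lt_psi {α β : Ordinal.{0}} (h : β < α) (h' : β < psi α) (ho : psi β < ω₁) :
    psi β < psi α :=
  (psi_mem α).2 _ (.psi h (.base h')) ho

theorem omegaTower_lt (n : ℕ) : omegaTower n < ω₁ := by
  induction n with
  | zero => exact one_lt_omega0.trans (omega0_lt_omega_one)
  | succ n ih => exact isPrincipal_opow_omega 1 omega0_lt_omega_one ih

theorem lt_opow_of_lt_tower {n : ℕ} {γ : Ordinal.{0}} (h : γ < omegaTower n) : γ < ω ^ γ := by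
  induction n generalizing γ with
  | zero =>
    rw [omegaTower, Order.lt_one_iff] at h
    simp [h]
  | succ n ih =>
    by_contra hh
    have h' : γ < omegaTower n :=
      (opow_lt_opow_iff_right one_lt_omega0).1 ((not_lt.1 hh).trans_lt h)
    exact hh (ih h')

/-- A lower bound for the collapsing function below `ε₀`. -/
theorem opow_le_psi {n : ℕ} {γ : Ordinal.{0}} (h : γ < omegaTower n) : ω ^ γ ≤ psi γ := by
  induction γ using WellFoundedLT.induction with
  | ind γ ih =>
    have hγ : ω ^ γ < ω₁ := isPrincipal_opow_omega 1 omega0_lt_omega_one (h.trans (omegaTower_lt n))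
    by_contra hlt
    rw [not_le] at hlt
    have step : ∀ β < γ, β < psi γ → ω ^ β < psi γ := by
      intro β hβ hβ'
      refine (ih β hβ (hβ.trans h)).trans_lt (psi_lt_psi hβ hβ' ?_)
      exact ((psi_mono hβ.le).trans hlt.le).trans_lt hγ
    obtain ⟨η, hη⟩ : ∃ η : Ordinal.{0}, psi γ = ω ^ η := by
      rcases isPrincipal_add_iff_zero_or_omega0_opow.1 (psi_principal γ) with h' | ⟨η, h'⟩
      · exact ((psi_pos γ).ne' h').elim
      · exact ⟨η, h'.symm⟩
    have hηγ : η < γ := (opow_lt_opow_iff_right one_lt_omega0).1 (hη ▸ hlt)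
    have := step η hηγ (hη ▸ lt_opow_of_lt_tower (hηγ.trans h))
    rw [hη] at this
    exact lt_irrefl _ this

/-! ### Lower bounds for the values of terms -/

namespace OT

theorem one_le_val {a : OT} (h : a ≠ zero) : 1 ≤ a.val := by
  rw [one_le_iff_pos]
  cases a with
  | zero => exact (h rfl).elim
  | psi a b => exact (psi_pos _).trans_le le_self_add
  | Om b => exact (omega_pos 1).trans_le le_self_add
  | pow a b => exact (opow_pos _ omega0_pos).trans_le le_self_add

/-- The sum of `m` terms `ψ 0`. -/
def fin : ℕ → OT
  | 0 => zero
  | m + 1 => psi zero (fin m)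

/-- The term `Ω * m`. -/
def omm : ℕ → OT
  | 0 => zero
  | m + 1 => Om (omm m)

/-- The term `ψ a`. -/
def ps (a : OT) : OT := psi a zero

/-- A lower bound for the value of the term `ps^[i] (fin m)`. -/
noncomputable def low : ℕ → ℕ → Ordinal.{0}
  | 0, m => m
  | i + 1, m => ω ^ low i m

theorem low_lt (i m : ℕ) : low i m < omegaTower (i + 1) := by
  induction i with
  | zero =>
    rw [low, omegaTower, omegaTower, opow_one]
    exact natCast_lt_omega0 m
  | succ i ih => exact (opow_lt_opow_iff_right one_lt_omega0).2 ih

theorem low_lt_omega (i m : ℕ) : low i m < ω₁ := (low_lt i m).trans (omegaTower_lt _)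

theorem omega_add_one_le {e : OT} (he : e.NF) (h : Lt (Om zero) e) : ω₁ + 1 ≤ e.val := by
  induction e with
  | zero => simp [Lt, cmp] at h
  | psi a b => simp [Lt, cmp] at h
  | Om b =>
    refine add_le_add_right (one_le_val fun hb => ?_) _
    simp [Lt, cmp, hb] at h
  | pow a b ih _ =>
    exact (ih he.1 he.2.2.1).trans ((right_le_opow _ one_lt_omega0).trans le_self_add)

theorem opow_omega_add_one_le {a b : OT} (h : (pow a b).NF) :
    ω ^ (ω₁ + 1) ≤ (pow a b).val :=
  (opow_le_opow_right omega0_pos (omega_add_one_le h.1 h.2.2.1)).trans le_self_add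

theorem omega_mul_omega_le : ω₁ * ω ≤ ω ^ (ω₁ + 1) := by
  rw [opow_add, opow_one]
  exact mul_le_mul_left (right_le_opow _ one_lt_omega0) _

theorem omega_le_pow {a b : OT} (h : (pow a b).NF) : ω₁ ≤ (pow a b).val :=
  (le_mul_of_one_le_right zero_le one_lt_omega0.le).trans
    (omega_mul_omega_le.trans (opow_omega_add_one_le h))

theorem low_le_val {i m : ℕ} {c : OT} (hc : c.NF) (h : ¬ Lt c (ps^[i] (fin m))) :
    low i m ≤ c.val := by
  induction i generalizing c with
  | zero =>
    induction m generalizing c with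
    | zero => simp [low]
    | succ m ih =>
      rw [Function.iterate_zero_apply, fin, Lt] at h
      rw [low]
      cases c with
      | zero => exact (h rfl).elim
      | psi a b =>
        by_cases ha : a = zero
        · subst ha
          have hb : ¬ Lt b (fin m) := fun hb => h (by rw [cmp, hb]; rfl)
          have := ih hc.2.1 hb
          rw [low] at this
          rw [val, Nat.add_comm, Nat.cast_add, Nat.cast_one]
          exact add_le_add (one_le_iff_pos.2 (psi_pos _)) this
        · refine le_trans (natCast_lt_omega0 _).le (le_trans ?_ (le_self_add (a := WeakID.psi _)))
          refine le_trans ?_ (psi_mono (one_le_val ha))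
          conv_lhs => rw [← opow_one ω]
          refine opow_le_psi (n := 1) ?_
          rw [omegaTower, omegaTower, opow_one]
          exact one_lt_omega0
      | Om b => exact ((natCast_lt_omega0 _).trans omega0_lt_omega_one).le.trans le_self_add
      | pow a b => exact ((natCast_lt_omega0 _).trans omega0_lt_omega_one).le.trans (omega_le_pow hc)
  | succ i ih =>
    rw [Function.iterate_succ_apply', ps, Lt] at h
    cases c with
    | zero => exact (h rfl).elim
    | psi a b =>
      have ha : ¬ Lt a (ps^[i] (fin m)) := fun ha => h (by rw [cmp, ha]; rfl)
      exact (opow_le_psi (low_lt i m)).trans ((psi_mono (ih hc.1 ha)).trans le_self_add)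
    | Om b => exact (low_lt_omega (i + 1) m).le.trans le_self_add
    | pow a b => exact (low_lt_omega (i + 1) m).le.trans (omega_le_pow hc)

theorem omega_mul_le_val {m : ℕ} {c : OT} (hc : c.NF) (h : ¬ Lt c (omm m)) :
    ω₁ * m ≤ c.val := by
  induction m generalizing c with
  | zero => simp
  | succ m ih =>
    cases c with
    | zero => exact (h rfl).elim
    | psi a b => exact (h rfl).elim
    | Om b =>
      have hb : ¬ Lt b (omm m) := fun hb => h (by rw [omm, Lt, cmp, hb])
      rw [val, Nat.add_comm, Nat.cast_add, Nat.cast_one, mul_add, mul_one]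
      exact add_le_add_right (ih hc.1 hb) _
    | pow a b =>
      refine le_trans ?_ (omega_mul_omega_le.trans (opow_omega_add_one_le hc))
      exact mul_le_mul_right (natCast_lt_omega0 _).le _

theorem omega_opow_le_val {m : ℕ} {d : OT} (hd : d.NF) (h : ¬ Lt d (pow (omm m) zero)) :
    ω₁ ^ (m : Ordinal.{0}) ≤ d.val := by
  cases d with
  | zero => exact (h rfl).elim
  | psi a b => exact (h rfl).elim
  | Om b => exact (h rfl).elim
  | pow a b =>
    have ha : ¬ Lt a (omm m) := fun ha => h (by rw [Lt, cmp, ha]; rfl)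
    calc ω₁ ^ (m : Ordinal.{0}) ≤ (ω ^ ω₁) ^ (m : Ordinal.{0}) :=
          opow_le_opow_left _ (right_le_opow _ one_lt_omega0)
      _ = ω ^ (ω₁ * m) := (opow_mul _ _ _).symm
      _ ≤ ω ^ a.val := opow_le_opow_right omega0_pos (omega_mul_le_val hd.1 ha)
      _ ≤ _ := le_self_add

theorem opow_opow_le_val {k m : ℕ} {d : OT} (hd : d.NF)
    (h : ¬ Lt d (pow (pow (Om (ps^[k] (fin m))) zero) zero)) :
    ω ^ ω ^ (ω₁ + low k m) ≤ d.val := by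
  cases d with
  | zero => exact (h rfl).elim
  | psi a b => exact (h rfl).elim
  | Om b => exact (h rfl).elim
  | pow a b =>
    refine (opow_le_opow_right omega0_pos ?_).trans (le_self_add (a := ω ^ a.val))
    have ha : ¬ Lt a (pow (Om (ps^[k] (fin m))) zero) := fun ha => h (by rw [Lt, cmp, ha]; rfl)
    have han := hd.1
    cases a with
    | zero => exact (ha rfl).elim
    | psi a b => exact (ha rfl).elim
    | Om b => exact (ha rfl).elim
    | pow a b =>
      refine (opow_le_opow_right omega0_pos ?_).trans (le_self_add (a := ω ^ a.val))
      have hb : ¬ Lt a (Om (ps^[k] (fin m))) := fun hb => ha (by rw [Lt, cmp, hb]; rfl)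
      have hbn := han.1
      cases a with
      | zero => exact (hb rfl).elim
      | psi a b => exact (hb rfl).elim
      | Om b =>
        have : ¬ Lt b (ps^[k] (fin m)) := fun hc => hb (by rw [Lt, cmp, hc])
        exact add_le_add_right (low_le_val hbn.1 this) _
      | pow a b =>
        calc ω₁ + low k m ≤ ω₁ + ω₁ := add_le_add_right (low_lt_omega k m).le _
          _ = ω₁ * (1 + 1 : ℕ) := by rw [Nat.cast_add, Nat.cast_one, mul_add, mul_one]
          _ ≤ ω₁ * ω := mul_le_mul_right (natCast_lt_omega0 _).le _
          _ ≤ _ := omega_mul_omega_le.trans (opow_omega_add_one_le hbn)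

theorem le_of_low_le (i : ℕ) {F : Ordinal.{0} → Ordinal.{0}} (hF : IsNormal F) {X : Ordinal.{0}}
    (h : ∀ m, F (low i m) ≤ X) : F (omegaTower (i + 1)) ≤ X := by
  induction i generalizing F with
  | zero =>
    rw [omegaTower, omegaTower, opow_one, hF.le_iff_forall_le isSuccLimit_omega0]
    intro a ha
    obtain ⟨m, rfl⟩ := lt_omega0.1 ha
    exact h m
  | succ i ih => exact ih (F := fun ξ => F (ω ^ ξ)) (hF.comp (isNormal_opow one_lt_omega0)) h

/-- The terms `ω ^ (Ω * m)` and `ω ^ ω ^ (Ω + ψ (⋯ ψ m))`, whose values are cofinal in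
`Ω ^ ω_{1+k}`. -/
def bound : ℕ → ℕ → OT
  | 0, m => pow (omm m) zero
  | k + 1, m => pow (pow (Om (ps^[k] (fin m))) zero) zero

theorem exists_lt_bound {k : ℕ} {d : OT} (hd : d.NF) (h : d.val < ω₁ ^ omegaTower (1 + k)) :
    ∃ m, Lt d (bound k m) := by
  by_contra! hh
  refine h.not_ge ?_
  rcases k with _ | k
  · exact le_of_low_le 0 (F := fun ξ => ω₁ ^ ξ)
      (isNormal_opow (one_lt_omega0.trans omega0_lt_omega_one)) fun m => omega_opow_le_val hd (hh m)
  · have := le_of_low_le k (F := fun ξ => ω ^ ω ^ (ω₁ + ξ))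
      ((isNormal_opow one_lt_omega0).comp ((isNormal_opow one_lt_omega0).comp
        (isNormal_add_right _))) fun m => opow_opow_le_val hd (hh m)
    refine le_trans ?_ this
    rw [Nat.add_comm 1, omegaTower, opow_add, opow_mul]
    exact opow_le_opow_left _ ((right_le_opow _ one_lt_omega0).trans
      (right_le_opow _ one_lt_omega0))

theorem exists_arg_lt_bound {k : ℕ} {a : OT} (ha : a.NF)
    (h : a.val < WeakID.psi (ω₁ ^ omegaTower (1 + k))) :
    a = zero ∨ ∃ d b m, a = psi d b ∧ Lt d (bound k m) := by
  cases a with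
  | zero => exact .inl rfl
  | psi d b =>
    obtain ⟨m, hm⟩ := exists_lt_bound (k := k) ha.1 (by
      by_contra hh
      exact ((le_self_add (a := WeakID.psi d.val)).trans_lt h).not_ge (psi_mono (not_lt.1 hh)))
    exact .inr ⟨d, b, m, rfl, hm⟩
  | Om b => exact (((le_self_add (a := ω₁)).trans_lt h).not_ge (psi_le_omega _)).elim
  | pow d b => exact (((omega_le_pow ha).trans_lt h).not_ge (psi_le_omega _)).elim

end OT

end Ordinals

/-! ## Terms in models -/

section Terms

variable {M : Type} [Str AccOp M] [IDModel M]

/-- The code of a term, as an element of a model. -/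
def OT.toM : OT → M
  | zero => 0
  | psi a b => nd 0 a.toM b.toM
  | Om b => nd 1 0 b.toM
  | pow a b => nd 2 a.toM b.toM

theorem natCast_pair (a b : ℕ) : ((Nat.pair a b : ℕ) : M) = pr (a : M) b := by
  rw [pr_eq, Nat.pair]
  by_cases h : a < b
  · rw [if_pos h, if_pos (Nat.cast_lt.2 h)]
    push_cast
    rfl
  · rw [if_neg h, if_neg (Nat.cast_lt.not.2 h)]
    push_cast
    rfl

theorem natCast_code (a : OT) : ((a.code : ℕ) : M) = a.toM := by
  induction a with
  | zero => exact Nat.cast_zero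
  | psi a b iha ihb =>
    rw [OT.code, OT.toM, nd, Nat.cast_add, natCast_pair, natCast_pair, iha, ihb, Nat.cast_zero,
      Nat.cast_one]
  | Om b ihb =>
    rw [OT.code, OT.toM, nd, Nat.cast_add, natCast_pair, natCast_pair, ihb, Nat.cast_zero,
      Nat.cast_one]
  | pow a b iha ihb =>
    rw [OT.code, OT.toM, nd, Nat.cast_add, natCast_pair, natCast_pair, iha, ihb, Nat.cast_ofNat,
      Nat.cast_one]

theorem eval_numeral (n : ℕ) (ρ : Env M) : (Tm.numeral n).eval ρ = n := by
  induction n with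
  | zero => rw [Tm.numeral, eval_zero, Nat.cast_zero]
  | succ n ih => rw [Tm.numeral, eval_succ, ih, F1_succ, Nat.cast_succ]

theorem toM_cmp (x y : OT) : (OT.cmp x y = .lt → (x.toM : M) ≺ y.toM) ∧
    (OT.cmp x y = .eq → x = y) ∧ (OT.cmp x y = .gt → (y.toM : M) ≺ x.toM) := by
  have then_lt {a b c d : OT} {k : M} (ha : (OT.cmp a c = .lt → (a.toM : M) ≺ c.toM) ∧
      (OT.cmp a c = .eq → a = c) ∧ (OT.cmp a c = .gt → (c.toM : M) ≺ a.toM))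
      (hb : (OT.cmp b d = .lt → (b.toM : M) ≺ d.toM) ∧
      (OT.cmp b d = .eq → b = d) ∧ (OT.cmp b d = .gt → (d.toM : M) ≺ b.toM)) :
      ((OT.cmp a c).then (OT.cmp b d) = .lt → nd k a.toM b.toM ≺ nd k c.toM d.toM) ∧
      ((OT.cmp a c).then (OT.cmp b d) = .eq → a = c ∧ b = d) ∧
      ((OT.cmp a c).then (OT.cmp b d) = .gt → nd k c.toM d.toM ≺ nd k a.toM b.toM) := by
    cases h : OT.cmp a c
    · have := ha.1 h
      simp [Ordering.then, sl_nd, this]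
    · obtain rfl := ha.2.1 h
      simp only [Ordering.then]
      exact ⟨fun h => sl_nd.2 <| .inr ⟨rfl, .inr ⟨rfl, hb.1 h⟩⟩, fun h => ⟨trivial, hb.2.1 h⟩,
        fun h => sl_nd.2 <| .inr ⟨rfl, .inr ⟨rfl, hb.2.2 h⟩⟩⟩
    · have := ha.2.2 h
      simp [Ordering.then, sl_nd, this]
  induction x generalizing y with
  | zero => cases y <;> simp [OT.cmp, OT.toM, zero_sl]
  | psi a b iha ihb =>
    cases y with
    | zero => simp [OT.cmp, OT.toM, zero_sl]
    | psi c d =>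
      have := then_lt (k := 0) (iha c) (ihb d)
      simpa only [OT.cmp, OT.toM, OT.psi.injEq] using this
    | Om d => simp [OT.cmp, OT.toM, sl_nd]
    | pow c d => simp [OT.cmp, OT.toM, sl_nd]
  | Om b ihb =>
    cases y with
    | zero => simp [OT.cmp, OT.toM, zero_sl]
    | psi c d => simp [OT.cmp, OT.toM, sl_nd]
    | Om d => simpa [OT.cmp, OT.toM, sl_nd, sl_irrefl] using ihb d
    | pow c d => simp [OT.cmp, OT.toM, sl_nd]
  | pow a b iha ihb =>
    cases y with
    | zero => simp [OT.cmp, OT.toM, zero_sl]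
    | psi c d => simp [OT.cmp, OT.toM, sl_nd]
    | Om d => simp [OT.cmp, OT.toM, sl_nd]
    | pow c d =>
      have := then_lt (k := 2) (iha c) (ihb d)
      simpa only [OT.cmp, OT.toM, OT.pow.injEq] using this

theorem OT.Lt.toM {a b : OT} (h : OT.Lt a b) : (a.toM : M) ≺ b.toM := (toM_cmp a b).1 h

theorem gl_toM {x a : OT} (h : ∀ g ∈ x.G, OT.Lt g a) : Gl (x.toM : M) a.toM := by
  induction x with
  | zero => exact gl_zero _
  | psi c d ihc ihd =>
    exact (gl_nd _ _ _ _).2 ⟨ihd fun g hg => h g (.inr hg),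
      fun _ => ⟨(h c (.inl (.inl rfl))).toM, ihc fun g hg => h g (.inl (.inr hg))⟩,
      fun h => (two_ne_zero' h.symm).elim⟩
  | Om d ihd =>
    exact (gl_nd _ _ _ _).2 ⟨ihd h, fun h => (one_ne_zero h).elim,
      fun h => (two_ne_one' h.symm).elim⟩
  | pow c d ihc ihd =>
    exact (gl_nd _ _ _ _).2 ⟨ihd fun g hg => h g (.inr hg), fun h => (two_ne_zero' h).elim,
      fun _ => ihc fun g hg => h g (.inl hg)⟩

theorem toM_head (b : OT) : b = .zero ∨ hd (b.toM : M) = b.head.toM := by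
  cases b <;> simp [OT.head, OT.toM]

theorem not_sl_of_cmp {b x : OT} (h : OT.cmp b.head x ≠ .gt) :
    (b.toM : M) = 0 ∨ ¬ (x.toM : M) ≺ hd b.toM := by
  rcases toM_head (M := M) b with rfl | hb
  · exact .inl rfl
  · right
    rw [hb]
    cases h' : OT.cmp b.head x
    · exact sl_asymm ((toM_cmp _ _).1 h')
    · rw [(toM_cmp (M := M) _ _).2.1 h']
      exact sl_irrefl _
    · exact (h h').elim

theorem nf_toM {a : OT} (h : a.NF) : Nf (a.toM : M) := by
  induction a with
  | zero => exact nf_zero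
  | psi a b iha ihb =>
    exact (nf_nd _ _ _).2 ⟨ihb h.2.1, not_sl_of_cmp h.2.2.2,
      .inl ⟨rfl, iha h.1, gl_toM h.2.2.1⟩⟩
  | Om b ihb =>
    exact (nf_nd _ _ _).2 ⟨ihb h.1, not_sl_of_cmp h.2, .inr (.inl ⟨rfl, rfl⟩)⟩
  | pow a b iha ihb =>
    exact (nf_nd _ _ _).2 ⟨ihb h.2.1, not_sl_of_cmp h.2.2.2,
      .inr (.inr ⟨rfl, iha h.1, h.2.2.1.toM⟩)⟩

theorem toM_fin (m : ℕ) : ((OT.fin m).toM : M) = fin m := by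
  induction m with
  | zero => rfl
  | succ m ih => rw [OT.fin, OT.toM, ih]; rfl

theorem toM_omm (m : ℕ) : ((OT.omm m).toM : M) = omm m := by
  induction m with
  | zero => rfl
  | succ m ih => rw [OT.omm, OT.toM, ih]; rfl

theorem toM_iterate_ps (i m : ℕ) : ((OT.ps^[i] (OT.fin m)).toM : M) = ps^[i] (fin m) := by
  induction i with
  | zero => exact toM_fin m
  | succ i ih =>
    rw [Function.iterate_succ_apply', Function.iterate_succ_apply', OT.ps, OT.toM, ih]
    rfl

theorem omm_sl_omm (m : ℕ) : (omm m : M) ≺ omm (m + 1) := by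
  induction m with
  | zero => exact zero_sl _ _ _
  | succ m ih => exact sl_nd.2 (.inr ⟨rfl, .inr ⟨rfl, ih⟩⟩)

theorem psiW_of_sl_bound (k : ℕ) [HierInd k M] (m : ℕ) {d : M} (hd : d ≺ (OT.bound k m).toM) :
    PsiW d := by
  rcases k with _ | k
  · rw [OT.bound, OT.toM, toM_omm] at hd
    refine psiW_of_sl_zero (m + 2) (sl_trans hd ?_)
    have h : (Om : M) ≺ omm (m + 2) := sl_nd.2 (.inr ⟨rfl, .inr ⟨rfl, zero_sl _ _ _⟩⟩)
    rw [pw_eq, if_pos h]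
    exact sl_nd.2 (.inr ⟨rfl, .inl (sl_trans (omm_sl_omm m) (omm_sl_omm (m + 1)))⟩)
  · rw [OT.bound, OT.toM, OT.toM, OT.toM, OT.toM, OT.toM, toM_iterate_ps] at hd
    refine psiW_of_sl_succ k (m + 1) (sl_trans hd ?_)
    have h₁ := iterate_ps_sl (M := M) k (Nat.lt_succ_self m)
    have h₂ : (Om : M) ≺ nd 1 0 (ps^[k] (fin (m + 1))) := by
      refine sl_nd.2 (.inr ⟨rfl, .inr ⟨rfl, ?_⟩⟩)
      obtain h | ⟨k', a, b, h⟩ := nd_cases (ps^[k] (fin (m + 1)) : M)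
      · rw [Nat.succ_eq_add_one, h] at h₁
        exact (not_sl_zero _ h₁).elim
      · rw [h]
        exact zero_sl _ _ _
    have h₃ : (Om : M) ≺ nd 2 (nd 1 0 (ps^[k] (fin (m + 1)))) 0 := sl_nd.2 (.inl one_lt_two')
    rw [pw_eq (nd 1 0 _), if_pos h₂, pw_eq, if_pos h₃]
    exact sl_nd.2 (.inr ⟨rfl, .inl (sl_nd.2 (.inr ⟨rfl, .inl (sl_nd.2 (.inr ⟨rfl,
      .inr ⟨rfl, h₁⟩⟩))⟩))⟩)

theorem W_toM (k : ℕ) [HierInd k M] {a : OT} (ha : a.NF)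
    (h : a.val < WeakID.psi (Ordinal.omega 1 ^ omegaTower (1 + k))) : W (a.toM : M) := by
  obtain rfl | ⟨d, b, m, rfl, hd⟩ := OT.exists_arg_lt_bound ha h
  · exact W_zero
  · refine W_of_psiW (nf_toM ha) (sl_om.2 rfl) (.inr ?_) fun y hy => psiW_of_sl_bound k m hy
    rw [OT.toM, ag_nd]
    exact hd.toM

end Terms

end WeakID

/-- Every ordinal below `ψ(Ω ^ ω_{1+k})` is, as a term of the notation system, provably in `W`. -/
theorem lemma2p5 (k : ℕ) (α : WeakID.OT) (hα : α.NF)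
    (h : α.val < WeakID.psi (Ordinal.omega 1 ^ WeakID.omegaTower (1 + k))) :
    WeakID.PiAccIDProves k (WeakID.inW α) := by
  refine WeakID.piAccIDProves_of_sat fun M _ hT ρ => ?_
  have : WeakID.IDModel M :=
    { ea := fun hA => hT _ (.arith hA)
      pos_ind := fun hθ => hT _ (.ind (WeakID.Hier.of_positive hθ true k))
      fixed := fun hA => hT _ (by
        cases hA with
        | arith h => exact .arith h
        | ind h => exact h.elim
        | closed φ => exact .closed φ
        | least φ h => exact .least φ h) }
  have : WeakID.HierInd k M := ⟨fun hθ => hT _ (.ind hθ)⟩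
  have := WeakID.W_toM (M := M) k hα h
  rw [← WeakID.natCast_code] at this
  rw [WeakID.inW, WeakID.Fm.sat, WeakID.eval_numeral]
  exact this
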